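/- An instance consists of a finite set $A$ of applicants and a finite set $P$ of posts. Every applicant has a preference list of posts, possibly with ties: a sequence of nonempty, pairwise disjoint sets of posts, best first. Let $G=(A\cup P,E)$ be the bipartite graph in which $(a,p)\in E$ if and only if $p$ is on the list of $a$; the edge $(a,p)$ has rank $k$ if $p$ lies in the $k$-th set of the list of $a$, and $r$ is the largest rank. Every vertex $u$ has a quota $q(u)\ge 1$ and a classification $\mathcal C_u$, a family of subsets (classes) $C$ of its neighbourhood, each with a quota $q(C)\ge 0$. A set $M\subseteq E$ is a feasible matching if, for every vertex $u$, the set $M(u)$ of its partners in $M$ satisfies $|M(u)|\le q(u)$ and $|M(u)\cap C|\le q(C)$ for all $C\in\mathcal C_u$. The signature of $M$ is $(x_1,\dots,x_r)$, where $x_k$ is the number of rank-$k$ edges in $M$. A classified rank-maximal matching (CRMM) is a feasible matching whose signature is lexicographically maximal among all feasible matchings. The classification of $u$ is laminar if any two of its classes are disjoint or one contains the other. Theorem. There is an algorithm that, given an instance in which the classification of every vertex is laminar, computes a CRMM in $O(|E|^2)$ time. Precisely, there are a program for the word RAM (registers, indirectly addressed memory that is zero outside the input, unit-cost addition, subtraction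 and comparison) and a constant $c$ such that, for every such instance, every encoding of it of some length $n$ (a table of the edges with their ranks, in any order, and a table of pointers to the quota and the classes of each vertex, the classes being given by their quotas and lists of their elements, in any order) and every $W\ge (n+2)^c$ exceeding all numbers in the encoding, the program, run with words that hold the numbers below $W$, halts after at most $c\,(|E|^2+1)$ steps without overflow and outputs a CRMM. -/

import Mathlib

namespace CRMM

/-! ### Instances -/

/-- What a vertex specifies about the set of its partners, who are elements of `β`: a quota, a
classification (a family of classes, each of them a set of possible partners), and a quota for each
class. Only the values of `classQuota` on `classes` matter. -/
structure Classification (β : Type*) where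
  quota : ℕ
  classes : Finset (Finset β)
  classQuota : Finset β → ℕ

/-- A set `X` of partners respects the quota of the vertex and the quotas of all its classes. -/
def Classification.Respects {β : Type*} [DecidableEq β] (c : Classification β) (X : Finset β) :
    Prop :=
  X.card ≤ c.quota ∧ ∀ C ∈ c.classes, (X ∩ C).card ≤ c.classQuota C

/-- The classes form a laminar family. -/
def Classification.IsLaminar {β : Type*} (c : Classification β) : Prop :=
  ∀ X ∈ c.classes, ∀ Y ∈ c.classes, X ⊆ Y ∨ Y ⊆ X ∨ Disjoint X Y

/-- An instance with applicants `A` and posts `P`. The preference list of an applicant is a list of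
ties, best first: nonempty and pairwise disjoint sets of posts. The neighbours of an applicant are
the posts on its list. -/
structure Instance (A P : Type*) [Fintype A] [Fintype P] [DecidableEq A] [DecidableEq P] where
  pref : A → List (Finset P)
  tie_nonempty : ∀ a, ∀ T ∈ pref a, T.Nonempty
  tie_disjoint : ∀ a, (pref a).Pairwise Disjoint
  /-- quota and classification of an applicant -/
  clA : A → Classification P
  /-- quota and classification of a post -/
  clP : P → Classification A
  quotaA_pos : ∀ a, 0 < (clA a).quota
  quotaP_pos : ∀ p, 0 < (clP p).quota
  /-- the classes of an applicant consist of neighbours -/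
  classA_subset : ∀ a, ∀ C ∈ (clA a).classes, ∀ p ∈ C, ∃ T ∈ pref a, p ∈ T
  /-- the classes of a post consist of neighbours -/
  classP_subset : ∀ p, ∀ C ∈ (clP p).classes, ∀ a ∈ C, ∃ T ∈ pref a, p ∈ T

namespace Instance

variable {A P : Type*} [Fintype A] [Fintype P] [DecidableEq A] [DecidableEq P]

/-- The edge set `E` of the bipartite graph. -/
def edges (I : Instance A P) : Finset (A × P) :=
  Finset.univ.filter fun e => ∃ T ∈ I.pref e.1, e.2 ∈ T

/-- The rank of an edge: it is `k` if the post lies in the `k`-th tie of the applicant's list,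
counted from one. (Used on edges only.) -/
def rank (I : Instance A P) (e : A × P) : ℕ :=
  (I.pref e.1).findIdx (fun T => decide (e.2 ∈ T)) + 1

/-- The largest rank `r` used by an applicant. -/
def maxRank (I : Instance A P) : ℕ :=
  Finset.univ.sup fun a => (I.pref a).length

/-- `M(a)`, the partners of the applicant `a` in `M`. -/
def partnersA (M : Finset (A × P)) (a : A) : Finset P :=
  Finset.univ.filter fun p => (a, p) ∈ M

/-- `M(p)`, the partners of the post `p` in `M`. -/
def partnersP (M : Finset (A × P)) (p : P) : Finset A :=
  Finset.univ.filter fun a => (a, p) ∈ M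

/-- `M` is a feasible matching. -/
def IsFeasible (I : Instance A P) (M : Finset (A × P)) : Prop :=
  M ⊆ I.edges ∧ (∀ a, (I.clA a).Respects (partnersA M a)) ∧
    (∀ p, (I.clP p).Respects (partnersP M p))

/-- The signature of `M`: the tuple `(x₁, …, x_r)` in which `x_k` is the number of edges of rank `k`
in `M`; the entry `x_k` is `signature M (k - 1)`. -/
def signature (I : Instance A P) (M : Finset (A × P)) (k : Fin I.maxRank) : ℕ :=
  (M.filter fun e => I.rank e = (k : ℕ) + 1).card

/-- `M ≻ M'`: the signature of `M` is lexicographically larger than that of `M'`. -/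
def Better (I : Instance A P) (M M' : Finset (A × P)) : Prop :=
  ∃ k, (∀ i < k, I.signature M i = I.signature M' i) ∧ I.signature M' k < I.signature M k

/-- `M` is a classified rank-maximal matching: feasible, and no feasible matching is better. -/
def IsCRMM (I : Instance A P) (M : Finset (A × P)) : Prop :=
  I.IsFeasible M ∧ ¬ ∃ M', I.IsFeasible M' ∧ I.Better M' M

/-- Every vertex has a laminar classification. -/
def IsLaminar (I : Instance A P) : Prop :=
  (∀ a, (I.clA a).IsLaminar) ∧ (∀ p, (I.clP p).IsLaminar)

end Instance

/-! ### The machine: a word RAM -/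

/-- Tests on registers. -/
inductive Test
  | lt (x y : ℕ)
  | eq (x y : ℕ)

/-- Programs of a random access machine with registers `0, 1, 2, …` (of which a program names only
finitely many) and an indirectly addressed memory. -/
inductive Program
  /-- do nothing -/
  | skip
  /-- `x := n` -/
  | const (x n : ℕ)
  /-- `x := y` -/
  | copy (x y : ℕ)
  /-- `x := y + z` -/
  | add (x y z : ℕ)
  /-- `x := max (y - z) 0` -/
  | sub (x y z : ℕ)
  /-- `x := mem[y]` -/
  | load (x y : ℕ)
  /-- `mem[x] := y` -/
  | store (x y : ℕ)
  /-- first `p`, then `q` -/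
  | seq (p q : Program)
  /-- if `b` then `p` else `q` -/
  | ite (b : Test) (p q : Program)
  /-- while `b` do `p` -/
  | while (b : Test) (p : Program)

/-- The contents of the registers and of the memory. -/
structure State where
  reg : ℕ → ℕ
  mem : ℕ → ℕ

/-- The outcome of a test. -/
def Test.Holds : Test → State → Prop
  | .lt x y, s => s.reg x < s.reg y
  | .eq x y, s => s.reg x = s.reg y

/-- The state after `n` is written to the register `x`. -/
def State.setReg (s : State) (x n : ℕ) : State :=
  { s with reg := Function.update s.reg x n }

/-- The state after `n` is written to the memory cell with address `i`. -/
def State.setMem (s : State) (i n : ℕ) : State :=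
  { s with mem := Function.update s.mem i n }

/-- `Exec W p s t s'`: on a machine whose words hold the numbers below `W`, the program `p`, started
in the state `s`, halts in the state `s'` after exactly `t` steps. Every instruction and every
evaluation of a test is one step. A machine that would have to produce a number which does not fit
into a word is stuck, and then there is no halting run. -/
inductive Exec (W : ℕ) : Program → State → ℕ → State → Prop
  | skip (s : State) : Exec W .skip s 1 s
  | const (s : State) (x n : ℕ) (h : n < W) : Exec W (.const x n) s 1 (s.setReg x n)
  | copy (s : State) (x y : ℕ) : Exec W (.copy x y) s 1 (s.setReg x (s.reg y))
  | add (s : State) (x y z : ℕ) (h : s.reg y + s.reg z < W) :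
      Exec W (.add x y z) s 1 (s.setReg x (s.reg y + s.reg z))
  | sub (s : State) (x y z : ℕ) : Exec W (.sub x y z) s 1 (s.setReg x (s.reg y - s.reg z))
  | load (s : State) (x y : ℕ) : Exec W (.load x y) s 1 (s.setReg x (s.mem (s.reg y)))
  | store (s : State) (x y : ℕ) : Exec W (.store x y) s 1 (s.setMem (s.reg x) (s.reg y))
  | seq {p q : Program} {s s₁ s₂ : State} {t₁ t₂ : ℕ} :
      Exec W p s t₁ s₁ → Exec W q s₁ t₂ s₂ → Exec W (.seq p q) s (t₁ + t₂) s₂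
  | ite_true {b : Test} {p q : Program} {s s' : State} {t : ℕ} :
      b.Holds s → Exec W p s t s' → Exec W (.ite b p q) s (1 + t) s'
  | ite_false {b : Test} {p q : Program} {s s' : State} {t : ℕ} :
      ¬ b.Holds s → Exec W q s t s' → Exec W (.ite b p q) s (1 + t) s'
  | while_true {b : Test} {p : Program} {s s₁ s₂ : State} {t₁ t₂ : ℕ} :
      b.Holds s → Exec W p s t₁ s₁ → Exec W (.while b p) s₁ t₂ s₂ →
        Exec W (.while b p) s (1 + t₁ + t₂) s₂
  | while_false {b : Test} {p : Program} {s : State} :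
      ¬ b.Holds s → Exec W (.while b p) s 1 s

/-- The initial state: the input in the memory cells `0, …, w.length - 1`, and zero elsewhere. -/
def State.initial (w : List ℕ) : State where
  reg := fun _ => 0
  mem := fun i => w.getD i 0

/-! ### Input and output format -/

/-- `L` lists the classes of `c`, each class once, and each class as a list of its elements. -/
def Classification.IsListing {n : ℕ} (c : Classification (Fin n)) (L : List (List (Fin n))) :
    Prop :=
  (∀ l ∈ L, l.Nodup) ∧ (L.map List.toFinset).Nodup ∧ (L.map List.toFinset).toFinset = c.classes

/-- The data of a vertex: its quota, the number of its classes, and for each class the quota, the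
number of elements, and the elements. -/
def Classification.block {n : ℕ} (c : Classification (Fin n)) (L : List (List (Fin n))) :
    List ℕ :=
  c.quota :: L.length ::
    L.flatMap fun l => c.classQuota l.toFinset :: l.length :: l.map fun i => (i : ℕ)

/-- `w` is an encoding of `I`. Applicants and posts are given by their numbers. The word `w` consists
of the numbers of applicants, of posts and of edges; the entries of the preference lists in any
order, each as a triple (applicant, post, rank); a table with a pointer for each applicant and then
for each post to the data of this vertex; and the data of the vertices. The order in which classes
and their elements are listed is arbitrary. -/
def IsEncoding {nA nP : ℕ} (I : Instance (Fin nA) (Fin nP)) (w : List ℕ) : Prop :=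
  ∃ (es : List (Fin nA × Fin nP)) (LA : Fin nA → List (List (Fin nP)))
    (LP : Fin nP → List (List (Fin nA))),
    es.Nodup ∧ es.toFinset = I.edges ∧
    (∀ a, (I.clA a).IsListing (LA a)) ∧ (∀ p, (I.clP p).IsListing (LP p)) ∧
    let blocks : List (List ℕ) :=
      (List.ofFn fun a => (I.clA a).block (LA a)) ++ (List.ofFn fun p => (I.clP p).block (LP p))
    w = [nA, nP, es.length] ++
      (es.flatMap fun e => [(e.1 : ℕ), (e.2 : ℕ), I.rank e]) ++
      ((List.range (nA + nP)).map fun u =>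
        3 + 3 * es.length + (nA + nP) + ((blocks.take u).flatten).length) ++
      blocks.flatten

/-- In the state `s`, register `0` points to the output, which is the matching `M`: the number of its
edges, followed by the edges in any order, each once, as pairs (applicant, post). -/
def State.Outputs {nA nP : ℕ} (s : State) (M : Finset (Fin nA × Fin nP)) : Prop :=
  ∃ l : List (Fin nA × Fin nP), l.Nodup ∧ l.toFinset = M ∧
    s.mem (s.reg 0) = l.length ∧
    ∀ (i : ℕ) (h : i < l.length),
      s.mem (s.reg 0 + 1 + 2 * i) = ((l[i]).1 : ℕ) ∧
      s.mem (s.reg 0 + 2 + 2 * i) = ((l[i]).2 : ℕ)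

end CRMM

/-! A laminar classification is a tree: the vertex is the root, the classes are ordered by
inclusion, and each edge hangs below the smallest class that contains it. Put the trees of the
applicants between a source and the edges, the trees of the posts between the edges and a sink, and
let the arc above a node have the quota of its vertex or class as capacity. Each edge then
determines a path from source to sink, feasible matchings give flows that obey the capacities, and
conversely such a flow is determined by its values on the edges (`flow_eq_load`). A laminar family
on d elements has O(d) members (`card_laminar_le`), so for m edges the network has O(m) nodes and
arcs, however long the encoding is.

Ranks are admitted one at a time. For rank k the flow is augmented along residual paths that use
edges of rank at most k and no frozen arc. When none is left, let S be the set of nodes that the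
search reaches. Counting the load over this cut (`sum_crossing`, `Settled.step`) shows that, among
the matchings optimal for the smaller ranks, the current one has the most edges of rank at most k.
Moreover the matchings that do equally well are those with the same loads on the frozen arcs, the
same load on every crossing arc of rank at most k, and no edge of larger rank except edges that
leave S. All these arcs are frozen. `Settled` is the invariant: having the current loads on the
frozen arcs is the same as being optimal so far.

A phase either sends a unit of flow or closes a rank (`phase_spec`). The flow value is at most m,
and so are the ranks, because ties are nonempty and disjoint; hence 2 m phases suffice
(`PhaseInv.optimal`), each a breadth-first search in O(m) steps. A tree node is inserted in O(m)
steps by a scan of all edges. If larger classes come first, the edges of a new class all hang at one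
node, which becomes the parent (`IsForest.attach`). Vertices without edges are never looked at.

The algorithm is written in a language of bounded loops with explicit semantics and cost, which is
translated to the word RAM with a constant loss of time (`Cmd.exec_compile`). Sums and numbers that
are read are capped at a bound `B` for the input addresses, so values never exceed `B` plus the
running time. `prelude` finds `B` from the last pointer of the input. -/

set_option linter.constructorNameAsVariable false

namespace CRMM

/-! ### A language of bounded loops -/

/-- The variables of the loop programs. -/
inductive Var
  | m | nA | N | N2 | T | nx | one | zr | i | j | h | k | x | y | z | c | v | ptr | base | bp | nc
  | kc | no | sz | qh | qt | a | cnt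
  deriving DecidableEq

/-- The arrays of the loop programs. -/
inductive Arr
  | ea | ep | rk | res | src | dst | snA | snP | mark | cq | csz | cptr | cv | ord | rev | un | fst
  | nxt | vis | qu | pa | dd
  deriving DecidableEq

theorem Var.ctorIdx_inj {x y : Var} (h : x.ctorIdx = y.ctorIdx) : x = y := by
  have key : ∀ x : Var, Var.ofNat x.ctorIdx = x := by intro x; cases x <;> rfl
  rw [← key x, ← key y, h]

theorem Arr.ctorIdx_inj {x y : Arr} (h : x.ctorIdx = y.ctorIdx) : x = y := by
  have key : ∀ x : Arr, Arr.ofNat x.ctorIdx = x := by intro x; cases x <;> rfl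
  rw [← key x, ← key y, h]

theorem Arr.ctorIdx_lt (x : Arr) : x.ctorIdx < 32 := by cases x <;> decide

/-- A state of a loop program: the variables, the arrays, and the memory that holds the input. -/
@[ext]
structure Store where
  v : Var → ℕ
  a : Arr → ℕ → ℕ
  l : ℕ → ℕ

/-- Loop programs. The number of passes through a loop is determined when it is entered. -/
inductive Cmd
  | skip
  | zero (x : Var)
  | copy (x y : Var)
  | succ (x : Var)
  | pred (x : Var)
  | add (x y z : Var)
  | get (x : Var) (r : Arr) (y : Var)
  | put (r : Arr) (x y : Var)
  | read (x y : Var)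
  | write (x y : Var)
  | seq (p q : Cmd)
  | iflt (x y : Var) (p q : Cmd)
  | ifeq (x y : Var) (p q : Cmd)
  | loop (x : Var) (p : Cmd)

infixr:60 " ;; " => Cmd.seq

/-- Assignment to a variable. -/
def Store.setV (σ : Store) (x : Var) (n : ℕ) : Store := { σ with v := Function.update σ.v x n }

/-- Assignment to an array entry. -/
def Store.setA (σ : Store) (r : Arr) (i n : ℕ) : Store :=
  { σ with a := Function.update σ.a r (Function.update (σ.a r) i n) }

/-- Assignment to a cell of the input memory. -/
def Store.setL (σ : Store) (i n : ℕ) : Store := { σ with l := Function.update σ.l i n }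

/-- The effect of a loop program, where the input memory has the addresses below `B`. -/
def Cmd.eval (B : ℕ) : Cmd → Store → Store
  | skip, σ => σ
  | zero x, σ => σ.setV x 0
  | copy x y, σ => σ.setV x (σ.v y)
  | succ x, σ => σ.setV x (σ.v x + 1)
  | pred x, σ => σ.setV x (σ.v x - 1)
  | add x y z, σ => σ.setV x (min (σ.v y + σ.v z) B)
  | get x r y, σ => σ.setV x (σ.a r (σ.v y))
  | put r x y, σ => σ.setA r (σ.v x) (σ.v y)
  | read x y, σ => σ.setV x (if σ.v y < B then min (σ.l (σ.v y)) B else 0)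
  | write x y, σ => if σ.v x < B then σ.setL (σ.v x) (σ.v y) else σ
  | seq p q, σ => q.eval B (p.eval B σ)
  | iflt x y p q, σ => if σ.v x < σ.v y then p.eval B σ else q.eval B σ
  | ifeq x y p q, σ => if σ.v x = σ.v y then p.eval B σ else q.eval B σ
  | loop x p, σ => (p.eval B)^[σ.v x] σ

/-- The number of steps of a loop program. -/
def Cmd.cost (B : ℕ) : Cmd → Store → ℕ
  | seq p q, σ => p.cost B σ + q.cost B (p.eval B σ)
  | iflt x y p q, σ => 1 + if σ.v x < σ.v y then p.cost B σ else q.cost B σ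
  | ifeq x y p q, σ => 1 + if σ.v x = σ.v y then p.cost B σ else q.cost B σ
  | loop x p, σ => 1 + ∑ i ∈ Finset.range (σ.v x), (1 + p.cost B ((p.eval B)^[i] σ))
  | _, _ => 1

/-! ### Translation to the word RAM -/

/-- The register of a variable. -/
def Var.reg (x : Var) : ℕ := 6 + 2 * x.ctorIdx

/-- Compute in register `3` the address of the entry of `r` with the index in register `y`. -/
def addrProg (r : Arr) (y : ℕ) : Program :=
  .seq (.copy 3 y) <| .seq (.add 3 3 3) <| .seq (.add 3 3 3) <| .seq (.add 3 3 3) <|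
    .seq (.add 3 3 3) <| .seq (.add 3 3 3) <| .seq (.add 3 3 2) <|
      .seq (.const 4 r.ctorIdx) (.add 3 3 4)

/-- The translation; `d` is the depth of the surrounding loops. Register `0` holds `0`, register `1`
holds `1`, register `2` holds `B`. -/
def Cmd.compile : Cmd → ℕ → Program
  | skip, _ => .skip
  | zero x, _ => .const x.reg 0
  | copy x y, _ => .copy x.reg y.reg
  | succ x, _ => .add x.reg x.reg 1
  | pred x, _ => .sub x.reg x.reg 1
  | add x y z, _ => .seq (.add 3 y.reg z.reg) (.ite (.lt 2 3) (.copy x.reg 2) (.copy x.reg 3))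
  | get x r y, _ => .seq (addrProg r y.reg) (.load x.reg 3)
  | put r x y, _ => .seq (addrProg r x.reg) (.store 3 y.reg)
  | read x y, _ =>
      .ite (.lt y.reg 2) (.seq (.load 3 y.reg) (.ite (.lt 2 3) (.copy x.reg 2) (.copy x.reg 3)))
        (.const x.reg 0)
  | write x y, _ => .ite (.lt x.reg 2) (.store x.reg y.reg) .skip
  | seq p q, d => .seq (p.compile d) (q.compile d)
  | iflt x y p q, d => .ite (.lt x.reg y.reg) (p.compile d) (q.compile d)
  | ifeq x y p q, d => .ite (.eq x.reg y.reg) (p.compile d) (q.compile d)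
  | loop x p, d =>
      .seq (.copy (7 + 2 * d) x.reg)
        (.while (.lt 0 (7 + 2 * d))
          (.seq (p.compile (d + 1)) (.sub (7 + 2 * d) (7 + 2 * d) 1)))

/-- The machine state `s` represents the state `σ` of a loop program. -/
structure Represents (B : ℕ) (σ : Store) (s : State) : Prop where
  reg0 : s.reg 0 = 0
  reg1 : s.reg 1 = 1
  reg2 : s.reg 2 = B
  var : ∀ x : Var, s.reg x.reg = σ.v x
  low : ∀ i < B, s.mem i = σ.l i
  arr : ∀ r i, s.mem (B + 32 * i + r.ctorIdx) = σ.a r i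

/-- All variables and array entries are at most `V`. -/
def Store.Bounded (σ : Store) (V : ℕ) : Prop := (∀ x, σ.v x ≤ V) ∧ ∀ r i, σ.a r i ≤ V

theorem Store.Bounded.mono {σ : Store} {V V' : ℕ} (h : σ.Bounded V) (hV : V ≤ V') :
    σ.Bounded V' :=
  ⟨fun x => (h.1 x).trans hV, fun r i => (h.2 r i).trans hV⟩

theorem Store.Bounded.setV {σ : Store} {V n : ℕ} (h : σ.Bounded V) (hn : n ≤ V) (x : Var) :
    (σ.setV x n).Bounded V := by
  refine ⟨fun y => ?_, h.2⟩
  by_cases e : y = x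
  · subst e; simpa [Store.setV] using hn
  · simpa [Store.setV, e] using h.1 y

theorem Store.Bounded.setA {σ : Store} {V n : ℕ} (h : σ.Bounded V) (hn : n ≤ V) (r : Arr) (i : ℕ) :
    (σ.setA r i n).Bounded V := by
  refine ⟨h.1, fun r' i' => ?_⟩
  by_cases e : r' = r
  · subst e
    by_cases e' : i' = i
    · subst e'; simpa [Store.setA] using hn
    · simpa [Store.setA, e'] using h.2 r' i'
  · simpa [Store.setA, e] using h.2 r' i'

theorem bounded_iterate {f : Store → Store} {g : Store → ℕ}
    (hf : ∀ σ V, σ.Bounded V → B ≤ V → (f σ).Bounded (V + g σ)) {σ : Store} {V : ℕ}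
    (h : σ.Bounded V) (hV : B ≤ V) (n : ℕ) :
    (f^[n] σ).Bounded (V + ∑ i ∈ Finset.range n, (1 + g (f^[i] σ))) := by
  induction n with
  | zero => simpa using h
  | succ n ih =>
    rw [Function.iterate_succ_apply', Finset.sum_range_succ]
    exact (hf _ _ ih (by omega)).mono (by omega)

/-- Sums and numbers read from the input are capped at `B`, so one step raises the largest value by
at most one. Hence the running time bounds all values, and large words exclude overflow. The input
memory needs no bound, since reading caps it. -/
theorem Cmd.eval_bounded {B : ℕ} (p : Cmd) : ∀ (σ : Store) (V : ℕ), σ.Bounded V → B ≤ V →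
    (p.eval B σ).Bounded (V + p.cost B σ) := by
  induction p with
  | skip => intro σ V h hV; exact h.mono (by omega)
  | zero x => intro σ V h hV; exact (h.mono (by omega)).setV (by omega) x
  | copy x y => intro σ V h hV; exact (h.mono (by omega)).setV (by have := h.1 y; omega) x
  | succ x =>
    intro σ V h hV
    exact (h.mono (by omega)).setV (by have := h.1 x; simp [cost]; omega) x
  | pred x => intro σ V h hV; exact (h.mono (by omega)).setV (by have := h.1 x; omega) x
  | add x y z => intro σ V h hV; exact (h.mono (by omega)).setV (by omega) x
  | get x r y => intro σ V h hV; exact (h.mono (by omega)).setV (by have := h.2 r (σ.v y); omega) x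
  | put r x y =>
    intro σ V h hV; exact (h.mono (by omega)).setA (by have := h.1 y; omega) r _
  | read x y =>
    intro σ V h hV
    refine (h.mono (by omega)).setV ?_ x
    split_ifs <;> omega
  | write x y =>
    intro σ V h hV
    simp only [eval]
    split_ifs
    · exact ⟨fun x => (h.1 x).trans (by omega), fun r i => (h.2 r i).trans (by omega)⟩
    · exact h.mono (by omega)
  | seq p q hp hq =>
    intro σ V h hV
    exact (hq _ _ (hp _ _ h hV) (by omega)).mono (by simp [cost]; omega)
  | iflt x y p q hp hq =>
    intro σ V h hV
    simp only [eval, cost]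
    split_ifs
    · exact (hp _ _ h hV).mono (by omega)
    · exact (hq _ _ h hV).mono (by omega)
  | ifeq x y p q hp hq =>
    intro σ V h hV
    simp only [eval, cost]
    split_ifs
    · exact (hp _ _ h hV).mono (by omega)
    · exact (hq _ _ h hV).mono (by omega)
  | loop x p hp =>
    intro σ V h hV
    simp only [eval, cost]
    exact (bounded_iterate hp h hV (σ.v x)).mono (by omega)

/-- Registers 3 to 5 are scratch and the odd ones from 7 on are loop counters, while the variables
live in the even registers from 6 on; such writes are invisible to the loop program. -/
theorem Represents.setReg_tmp {B : ℕ} {σ : Store} {s : State} (h : Represents B σ s) {k : ℕ}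
    (hk : 3 ≤ k) (hk' : k < 6 ∨ k % 2 = 1) (n : ℕ) : Represents B σ (s.setReg k n) := by
  obtain ⟨h0, h1, h2, h3, h4, h5⟩ := h
  refine ⟨?_, ?_, ?_, fun x => ?_, h4, h5⟩
  · simpa [State.setReg, Function.update_apply, show ¬ 0 = k by omega] using h0
  · simpa [State.setReg, Function.update_apply, show ¬ 1 = k by omega] using h1
  · simpa [State.setReg, Function.update_apply, show ¬ 2 = k by omega] using h2
  · have : ¬ x.reg = k := by simp only [Var.reg]; omega
    simpa [State.setReg, Function.update_apply, this] using h3 x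

theorem Represents.setVar {B : ℕ} {σ : Store} {s : State} (h : Represents B σ s) (x : Var)
    (n : ℕ) : Represents B (σ.setV x n) (s.setReg x.reg n) := by
  obtain ⟨h0, h1, h2, h3, h4, h5⟩ := h
  have e0 : ¬ 0 = x.reg := by simp only [Var.reg]; omega
  have e1 : ¬ 1 = x.reg := by simp only [Var.reg]; omega
  have e2 : ¬ 2 = x.reg := by simp only [Var.reg]; omega
  refine ⟨?_, ?_, ?_, fun y => ?_, h4, h5⟩
  · simpa [State.setReg, Function.update_apply, e0] using h0
  · simpa [State.setReg, Function.update_apply, e1] using h1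
  · simpa [State.setReg, Function.update_apply, e2] using h2
  · have : y.reg = x.reg ↔ y = x :=
      ⟨fun h => Var.ctorIdx_inj (by simp only [Var.reg] at h; omega), fun h => by rw [h]⟩
    simp only [State.setReg, Store.setV, Function.update_apply, this]
    split_ifs
    · rfl
    · exact h3 y

/-- The arrays are interleaved with period 32 from address `B` on. There are fewer than 32 of them,
so an address determines both the array and the index. -/
theorem Represents.setArr {B : ℕ} {σ : Store} {s : State} (h : Represents B σ s) (r : Arr)
    (i n : ℕ) : Represents B (σ.setA r i n) (s.setMem (B + 32 * i + r.ctorIdx) n) := by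
  obtain ⟨h0, h1, h2, h3, h4, h5⟩ := h
  refine ⟨h0, h1, h2, h3, fun i' hi' => ?_, fun r' i' => ?_⟩
  · simp only [State.setMem, Store.setA, Function.update_apply]
    rw [if_neg (by omega)]
    exact h4 i' hi'
  · have := r.ctorIdx_lt
    have := r'.ctorIdx_lt
    simp only [State.setMem, Store.setA, Function.update_apply]
    by_cases e : r' = r
    · subst e
      by_cases e' : i' = i
      · subst e'; simp
      · rw [if_neg (by omega)]; simp [e', h5]
    · have : r'.ctorIdx ≠ r.ctorIdx := fun h => e (Arr.ctorIdx_inj h)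
      rw [if_neg (by omega)]; simp [e, h5]

theorem Represents.setLow {B : ℕ} {σ : Store} {s : State} (h : Represents B σ s) {i : ℕ}
    (hi : i < B) (n : ℕ) : Represents B (σ.setL i n) (s.setMem i n) := by
  obtain ⟨h0, h1, h2, h3, h4, h5⟩ := h
  refine ⟨h0, h1, h2, h3, fun i' hi' => ?_, fun r' i' => ?_⟩
  · simp only [State.setMem, Store.setL, Function.update_apply]
    split_ifs
    · rfl
    · exact h4 i' hi'
  · simp only [State.setMem, Store.setL, Function.update_apply]
    rw [if_neg (by omega)]
    exact h5 r' i'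

/-- Two machine states agree on the counters of the loops of depth less than `d`. -/
def SameCounters (d : ℕ) (s s' : State) : Prop := ∀ e < d, s'.reg (7 + 2 * e) = s.reg (7 + 2 * e)

theorem SameCounters.trans {d : ℕ} {s s' s'' : State} (h : SameCounters d s s')
    (h' : SameCounters d s' s'') : SameCounters d s s'' :=
  fun e he => (h' e he).trans (h e he)

theorem SameCounters.setReg {d : ℕ} {s s' : State} (h : SameCounters d s s') {k : ℕ}
    (hk : k < 6 ∨ k % 2 = 0 ∨ 7 + 2 * d ≤ k) (n : ℕ) : SameCounters d s (s'.setReg k n) := by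
  intro e he
  simp only [State.setReg, Function.update_apply]
  rw [if_neg (by omega)]
  exact h e he

theorem SameCounters.setMem {d : ℕ} {s s' : State} (h : SameCounters d s s') (i n : ℕ) :
    SameCounters d s (s'.setMem i n) := h

theorem SameCounters.refl (d : ℕ) (s : State) : SameCounters d s s := fun _ _ => rfl

theorem State.setReg_reg_self (s : State) (k n : ℕ) : (s.setReg k n).reg k = n := by
  simp [State.setReg]

theorem State.setReg_reg_ne (s : State) {k k' : ℕ} (h : k' ≠ k) (n : ℕ) :
    (s.setReg k n).reg k' = s.reg k' := by
  simp [State.setReg, h]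

/-- There is no multiplication: a copy and five doublings produce 32 times the index, and three more
steps add `B` and the number of the array. -/
theorem exec_addr {B W : ℕ} {σ : Store} {s : State} (h : Represents B σ s) (r : Arr) (y : Var)
    (hW : B + 32 * σ.v y + 32 < W) (d : ℕ) :
    ∃ s', Exec W (addrProg r y.reg) s 9 s' ∧ Represents B σ s' ∧ SameCounters d s s' ∧
      s'.reg 3 = B + 32 * σ.v y + r.ctorIdx := by
  have hr := r.ctorIdx_lt
  set n := σ.v y with hn
  have dbl : ∀ (s₁ : State) (q : ℕ), Represents B σ s₁ → SameCounters d s s₁ → s₁.reg 3 = q →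
      q + q < W → ∃ s₂, Exec W (.add 3 3 3) s₁ 1 s₂ ∧ Represents B σ s₂ ∧ SameCounters d s s₂ ∧
        s₂.reg 3 = q + q := by
    intro s₁ q r₁ c₁ e₁ hq
    exact ⟨_, .add s₁ 3 3 3 (by rw [e₁]; exact hq), r₁.setReg_tmp (by norm_num) (by norm_num) _,
      c₁.setReg (by norm_num) _, by rw [State.setReg_reg_self, e₁]⟩
  obtain ⟨s₁, x₁, r₁, c₁, e₁⟩ : ∃ s₂, Exec W (.copy 3 y.reg) s 1 s₂ ∧ Represents B σ s₂ ∧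
      SameCounters d s s₂ ∧ s₂.reg 3 = n :=
    ⟨_, .copy s 3 y.reg, h.setReg_tmp (by norm_num) (by norm_num) _,
      (SameCounters.refl d s).setReg (by norm_num) _, by rw [State.setReg_reg_self, h.var]⟩
  obtain ⟨s₂, x₂, r₂, c₂, e₂⟩ := dbl s₁ _ r₁ c₁ e₁ (by omega)
  obtain ⟨s₃, x₃, r₃, c₃, e₃⟩ := dbl s₂ _ r₂ c₂ e₂ (by omega)
  obtain ⟨s₄, x₄, r₄, c₄, e₄⟩ := dbl s₃ _ r₃ c₃ e₃ (by omega)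
  obtain ⟨s₅, x₅, r₅, c₅, e₅⟩ := dbl s₄ _ r₄ c₄ e₄ (by omega)
  obtain ⟨s₆, x₆, r₆, c₆, e₆⟩ := dbl s₅ _ r₅ c₅ e₅ (by omega)
  have x₇ := Exec.add (W := W) s₆ 3 3 2 (by rw [e₆, r₆.reg2]; omega)
  have r₇ := r₆.setReg_tmp (k := 3) (by norm_num) (by norm_num) (s₆.reg 3 + s₆.reg 2)
  have c₇ := c₆.setReg (k := 3) (by norm_num) (s₆.reg 3 + s₆.reg 2)
  have e₇ := s₆.setReg_reg_self 3 (s₆.reg 3 + s₆.reg 2)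
  have x₈ := Exec.const (W := W) (s₆.setReg 3 (s₆.reg 3 + s₆.reg 2)) 4 r.ctorIdx (by omega)
  have r₈ := r₇.setReg_tmp (k := 4) (by norm_num) (by norm_num) r.ctorIdx
  have c₈ := c₇.setReg (k := 4) (by norm_num) r.ctorIdx
  have e₈ := (State.setReg_reg_ne (s₆.setReg 3 (s₆.reg 3 + s₆.reg 2)) (k := 4) (k' := 3)
    (by norm_num) r.ctorIdx).trans e₇
  have e₈' := State.setReg_reg_self (s₆.setReg 3 (s₆.reg 3 + s₆.reg 2)) 4 r.ctorIdx
  refine ⟨_, .seq x₁ (.seq x₂ (.seq x₃ (.seq x₄ (.seq x₅ (.seq x₆ (.seq x₇ (.seq x₈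
    (.add _ 3 3 4 ?_)))))))), ?_, ?_, ?_⟩
  · rw [e₈, e₈', e₆, r₆.reg2]; omega
  · exact r₈.setReg_tmp (by norm_num) (by norm_num) _
  · exact c₈.setReg (by norm_num) _
  · rw [State.setReg_reg_self, e₈, e₈', e₆, r₆.reg2]; omega

theorem exec_capped {B W : ℕ} {σ : Store} {s : State} (h : Represents B σ s) (x : Var) (d : ℕ) :
    ∃ s', Exec W (.ite (.lt 2 3) (.copy x.reg 2) (.copy x.reg 3)) s (1 + 1) s' ∧
      Represents B (σ.setV x (min (s.reg 3) B)) s' ∧ SameCounters d s s' := by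
  by_cases hlt : B < s.reg 3
  · refine ⟨_, .ite_true (by simpa [Test.Holds, h.reg2] using hlt) (.copy s _ _), ?_, ?_⟩
    · rw [h.reg2, min_eq_right hlt.le]; exact h.setVar x B
    · exact (SameCounters.refl d s).setReg (by simp [Var.reg]) _
  · refine ⟨_, .ite_false (by simpa [Test.Holds, h.reg2] using hlt) (.copy s _ _), ?_, ?_⟩
    · rw [min_eq_left (not_lt.1 hlt)]; exact h.setVar x _
    · exact (SameCounters.refl d s).setReg (by simp [Var.reg]) _

theorem Var.reg_free (x : Var) (d : ℕ) :
    x.reg < 6 ∨ x.reg % 2 = 0 ∨ 7 + 2 * d ≤ x.reg := by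
  simp [Var.reg]

/-- The translation simulates the loop program. -/
theorem Cmd.exec_compile {B W : ℕ} (hB : 1 ≤ B) (p : Cmd) :
    ∀ (σ : Store) (s : State) (V d : ℕ), Represents B σ s → σ.Bounded V → B ≤ V →
      33 * (V + p.cost B σ) + 33 < W →
      ∃ (t : ℕ) (s' : State), Exec W (p.compile d) s t s' ∧ t ≤ 10 * p.cost B σ ∧
        Represents B (p.eval B σ) s' ∧ SameCounters d s s' := by
  induction p with
  | skip => intro σ s V d h _ _ _; exact ⟨1, s, .skip s, by simp [cost], h, .refl d s⟩
  | zero x =>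
    intro σ s V d h _ _ _
    exact ⟨1, _, .const s _ 0 (by omega), by simp [cost], h.setVar x 0,
      (SameCounters.refl d s).setReg (x.reg_free d) _⟩
  | copy x y =>
    intro σ s V d h _ _ _
    refine ⟨1, _, .copy s _ _, by simp [cost], ?_, (SameCounters.refl d s).setReg (x.reg_free d) _⟩
    rw [h.var]; exact h.setVar x _
  | succ x =>
    intro σ s V d h hb _ _
    have := hb.1 x
    refine ⟨1, _, .add s _ _ _ (by rw [h.var, h.reg1]; omega), by simp [cost], ?_,
      (SameCounters.refl d s).setReg (x.reg_free d) _⟩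
    rw [h.var, h.reg1]; exact h.setVar x _
  | pred x =>
    intro σ s V d h _ _ _
    refine ⟨1, _, .sub s _ _ _, by simp [cost], ?_, (SameCounters.refl d s).setReg (x.reg_free d) _⟩
    rw [h.var, h.reg1]; exact h.setVar x _
  | add x y z =>
    intro σ s V d h hb _ _
    have hy := hb.1 y
    have hz := hb.1 z
    have h₁ := h.setReg_tmp (k := 3) (by norm_num) (by norm_num) (s.reg y.reg + s.reg z.reg)
    obtain ⟨s', x', r', c'⟩ := exec_capped (W := W) h₁ x d
    refine ⟨_, s', .seq (.add s _ _ _ (by rw [h.var, h.var]; omega)) x', by simp [cost], ?_,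
      ((SameCounters.refl d s).setReg (by norm_num) _).trans c'⟩
    rw [State.setReg_reg_self, h.var, h.var] at r'
    exact r'
  | get x r y =>
    intro σ s V d h hb _ _
    have hy := hb.1 y
    -- Index and `B` are at most `V`, so `B + 32 * index + 32` is at most `33 * V + 32`; this is the
    -- origin of the constant 33.
    obtain ⟨s₁, x₁, r₁, c₁, e₁⟩ := exec_addr (W := W) h r y (by omega) d
    refine ⟨_, _, .seq x₁ (.load s₁ _ _), by simp [cost], ?_, c₁.setReg (x.reg_free d) _⟩
    rw [e₁, r₁.arr]
    exact r₁.setVar x _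
  | put r x y =>
    intro σ s V d h hb _ _
    have hy := hb.1 x
    obtain ⟨s₁, x₁, r₁, c₁, e₁⟩ := exec_addr (W := W) h r x (by omega) d
    refine ⟨_, _, .seq x₁ (.store s₁ _ _), by simp [cost], ?_, c₁.setMem _ _⟩
    rw [e₁, r₁.var]
    exact r₁.setArr r _ _
  | read x y =>
    intro σ s V d h hb _ _
    simp only [eval]
    by_cases hlt : σ.v y < B
    · have h₁ := h.setReg_tmp (k := 3) (by norm_num) (by norm_num) (s.mem (s.reg y.reg))
      obtain ⟨s', x', r', c'⟩ := exec_capped (W := W) h₁ x d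
      refine ⟨_, s', .ite_true (by simpa [Test.Holds, h.reg2, h.var] using hlt)
        (.seq (.load s _ _) x'), by simp [cost], ?_,
        ((SameCounters.refl d s).setReg (by norm_num) _).trans c'⟩
      rw [State.setReg_reg_self, h.var, h.low _ hlt] at r'
      simpa [hlt] using r'
    · refine ⟨_, _, .ite_false (by simpa [Test.Holds, h.reg2, h.var] using hlt)
        (.const s _ 0 (by omega)), by simp [cost], ?_,
        (SameCounters.refl d s).setReg (x.reg_free d) _⟩
      simpa [hlt] using h.setVar x 0
  | write x y =>
    intro σ s V d h hb _ _
    simp only [eval]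
    by_cases hlt : σ.v x < B
    · refine ⟨_, _, .ite_true (by simpa [Test.Holds, h.reg2, h.var] using hlt) (.store s _ _),
        by simp [cost], ?_, (SameCounters.refl d s).setMem _ _⟩
      rw [h.var, h.var]
      simpa [hlt] using h.setLow hlt _
    · refine ⟨_, _, .ite_false (by simpa [Test.Holds, h.reg2, h.var] using hlt) (.skip s),
        by simp [cost], ?_, .refl d s⟩
      simpa [hlt] using h
  | seq p q hp hq =>
    intro σ s V d h hb hV hW
    simp only [cost] at hW
    obtain ⟨t₁, s₁, x₁, l₁, r₁, c₁⟩ := hp σ s V d h hb hV (by omega)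
    obtain ⟨t₂, s₂, x₂, l₂, r₂, c₂⟩ := hq _ s₁ (V + p.cost B σ) d r₁ (p.eval_bounded σ V hb hV)
      (by omega) (by omega)
    exact ⟨_, s₂, .seq x₁ x₂, by simp only [cost]; omega, r₂, c₁.trans c₂⟩
  | iflt x y p q hp hq =>
    intro σ s V d h hb hV hW
    simp only [cost, eval] at hW ⊢
    by_cases hlt : σ.v x < σ.v y
    · rw [if_pos hlt] at hW ⊢
      obtain ⟨t₁, s₁, x₁, l₁, r₁, c₁⟩ := hp σ s V d h hb hV (by omega)
      exact ⟨_, s₁, .ite_true (by simpa [Test.Holds, h.var] using hlt) x₁, by omega,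
        by simpa [hlt] using r₁, c₁⟩
    · rw [if_neg hlt] at hW ⊢
      obtain ⟨t₁, s₁, x₁, l₁, r₁, c₁⟩ := hq σ s V d h hb hV (by omega)
      exact ⟨_, s₁, .ite_false (by simpa [Test.Holds, h.var] using hlt) x₁, by omega,
        by simpa [hlt] using r₁, c₁⟩
  | ifeq x y p q hp hq =>
    intro σ s V d h hb hV hW
    simp only [cost, eval] at hW ⊢
    by_cases hlt : σ.v x = σ.v y
    · rw [if_pos hlt] at hW ⊢
      obtain ⟨t₁, s₁, x₁, l₁, r₁, c₁⟩ := hp σ s V d h hb hV (by omega)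
      exact ⟨_, s₁, .ite_true (by simpa [Test.Holds, h.var] using hlt) x₁, by omega,
        by simpa [hlt] using r₁, c₁⟩
    · rw [if_neg hlt] at hW ⊢
      obtain ⟨t₁, s₁, x₁, l₁, r₁, c₁⟩ := hq σ s V d h hb hV (by omega)
      exact ⟨_, s₁, .ite_false (by simpa [Test.Holds, h.var] using hlt) x₁, by omega,
        by simpa [hlt] using r₁, c₁⟩
  | loop x p hp =>
    intro σ s V d h hb hV hW
    -- Induction on the content of the counter. The body is compiled for depth `d + 1` and so
    -- preserves this counter, while it is free to change the variable that gave the number of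
    -- passes.
    have key : ∀ (n : ℕ) (σ : Store) (s : State) (V : ℕ), Represents B σ s → σ.Bounded V → B ≤ V →
        s.reg (7 + 2 * d) = n →
        33 * (V + ∑ i ∈ Finset.range n, (1 + p.cost B ((p.eval B)^[i] σ))) + 33 < W →
        ∃ (t : ℕ) (s' : State), Exec W (.while (.lt 0 (7 + 2 * d))
          (.seq (p.compile (d + 1)) (.sub (7 + 2 * d) (7 + 2 * d) 1))) s t s' ∧
          t ≤ 1 + 10 * ∑ i ∈ Finset.range n, (1 + p.cost B ((p.eval B)^[i] σ)) ∧
          Represents B ((p.eval B)^[n] σ) s' ∧ SameCounters d s s' := by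
      intro n
      induction n with
      | zero =>
        intro σ s V h hb hV hn hW
        exact ⟨1, s, .while_false (by simp [Test.Holds, hn, h.reg0]), by omega, h, .refl d s⟩
      | succ n ih =>
        intro σ s V h hb hV hn hW
        rw [Finset.sum_range_succ'] at hW ⊢
        simp only [Function.iterate_zero, id_eq, Function.iterate_succ_apply] at hW ⊢
        obtain ⟨t₁, s₁, x₁, l₁, r₁, c₁⟩ := hp σ s V (d + 1) h hb hV (by omega)
        have hc₁ := c₁ d (by omega)
        have r₂ := r₁.setReg_tmp (k := 7 + 2 * d) (by omega) (by omega)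
          (s₁.reg (7 + 2 * d) - s₁.reg 1)
        obtain ⟨t₃, s₃, x₃, l₃, r₃, c₃⟩ := ih _ _ (V + p.cost B σ) r₂ (p.eval_bounded σ V hb hV)
          (by omega) (by rw [State.setReg_reg_self, hc₁, hn, r₁.reg1]; omega) (by omega)
        refine ⟨_, s₃, .while_true (by simp [Test.Holds, hn, h.reg0]) (.seq x₁ (.sub s₁ _ _ _)) x₃,
          by omega, r₃, ?_⟩
        refine SameCounters.trans (s' := s₁) (fun e he => c₁ e (by omega)) ?_
        exact ((SameCounters.refl d s₁).setReg (by omega) _).trans c₃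
    have r₁ := h.setReg_tmp (k := 7 + 2 * d) (by omega) (by omega) (s.reg x.reg)
    simp only [cost] at hW
    obtain ⟨t₂, s₂, x₂, l₂, r₂, c₂⟩ := key (σ.v x) σ _ V r₁ hb hV
      (by rw [State.setReg_reg_self, h.var]) (by omega)
    exact ⟨_, s₂, .seq (.copy s _ _) x₂, by simp only [cost]; omega, r₂,
      ((SameCounters.refl d s).setReg (by omega) _).trans c₂⟩

end CRMM
namespace CRMM

/-! ### Rules for loop programs -/

/-- The variables that a program may change. -/
def Cmd.wv : Cmd → List Var
  | zero x | copy x _ | succ x | pred x | add x _ _ | get x _ _ | read x _ => [x]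
  | seq p q | iflt _ _ p q | ifeq _ _ p q => p.wv ++ q.wv
  | loop _ p => p.wv
  | _ => []

/-- The arrays that a program may change. -/
def Cmd.wa : Cmd → List Arr
  | put r _ _ => [r]
  | seq p q | iflt _ _ p q | ifeq _ _ p q => p.wa ++ q.wa
  | loop _ p => p.wa
  | _ => []

/-- Whether a program may change the input memory. -/
def Cmd.wl : Cmd → Bool
  | write _ _ => true
  | seq p q | iflt _ _ p q | ifeq _ _ p q => p.wl || q.wl
  | loop _ p => p.wl
  | _ => false

/-- `τ` differs from `σ` only where `p` may change it. -/
structure Frame (p : Cmd) (σ τ : Store) : Prop where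
  v : ∀ x ∉ p.wv, τ.v x = σ.v x
  a : ∀ r ∉ p.wa, τ.a r = σ.a r
  l : p.wl = false → τ.l = σ.l

theorem Frame.refl (p : Cmd) (σ : Store) : Frame p σ σ := ⟨fun _ _ => rfl, fun _ _ => rfl, fun _ => rfl⟩

theorem Frame.trans {p : Cmd} {σ τ υ : Store} (h : Frame p σ τ) (h' : Frame p τ υ) :
    Frame p σ υ :=
  ⟨fun x hx => (h'.v x hx).trans (h.v x hx), fun r hr => (h'.a r hr).trans (h.a r hr),
    fun hl => (h'.l hl).trans (h.l hl)⟩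

theorem Frame.mono {p q : Cmd} {σ τ : Store} (h : Frame p σ τ) (hv : ∀ x ∈ p.wv, x ∈ q.wv)
    (ha : ∀ r ∈ p.wa, r ∈ q.wa) (hl : q.wl = false → p.wl = false) : Frame q σ τ :=
  ⟨fun x hx => h.v x fun h' => hx (hv x h'), fun r hr => h.a r fun h' => hr (ha r h'),
    fun h' => h.l (hl h')⟩

theorem frame_setV (p : Cmd) (σ : Store) {x : Var} (h : x ∈ p.wv) (n : ℕ) : Frame p σ (σ.setV x n) := by
  refine ⟨fun y hy => ?_, fun _ _ => rfl, fun _ => rfl⟩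
  have : y ≠ x := fun e => hy (e ▸ h)
  simp [Store.setV, this]

/-- Specifications are combined with this syntactic fact, so that invariants need not list what a
program leaves alone; membership in the lists is settled by `decide` or `simp`. -/
theorem Cmd.frame (B : ℕ) (p : Cmd) : ∀ σ, Frame p σ (p.eval B σ) := by
  induction p with
  | skip => intro σ; exact .refl _ _
  | zero x => intro σ; exact frame_setV _ σ (by simp [wv]) _
  | copy x y => intro σ; exact frame_setV _ σ (by simp [wv]) _
  | succ x => intro σ; exact frame_setV _ σ (by simp [wv]) _
  | pred x => intro σ; exact frame_setV _ σ (by simp [wv]) _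
  | add x y z => intro σ; exact frame_setV _ σ (by simp [wv]) _
  | get x r y => intro σ; exact frame_setV _ σ (by simp [wv]) _
  | read x y => intro σ; exact frame_setV _ σ (by simp [wv]) _
  | put r x y =>
    intro σ
    refine ⟨fun _ _ => rfl, fun r' hr' => ?_, fun _ => rfl⟩
    have : r' ≠ r := by simpa [wa] using hr'
    simp [eval, Store.setA, this]
  | write x y =>
    intro σ
    refine ⟨fun x _ => ?_, fun r _ => ?_, fun h => by simp [wl] at h⟩ <;>
    · simp only [eval]; split_ifs <;> rfl
  | seq p q hp hq =>
    intro σ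
    exact ((hp σ).mono (by simp +contextual [wv]) (by simp +contextual [wa])
      (by simp +contextual [wl])).trans ((hq _).mono (by simp +contextual [wv])
      (by simp +contextual [wa]) (by simp +contextual [wl]))
  | iflt x y p q hp hq =>
    intro σ
    simp only [eval]
    split_ifs
    · exact (hp σ).mono (by simp +contextual [wv]) (by simp +contextual [wa])
        (by simp +contextual [wl])
    · exact (hq σ).mono (by simp +contextual [wv]) (by simp +contextual [wa])
        (by simp +contextual [wl])
  | ifeq x y p q hp hq =>
    intro σ
    simp only [eval]
    split_ifs
    · exact (hp σ).mono (by simp +contextual [wv]) (by simp +contextual [wa])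
        (by simp +contextual [wl])
    · exact (hq σ).mono (by simp +contextual [wv]) (by simp +contextual [wa])
        (by simp +contextual [wl])
  | loop x p hp =>
    intro σ
    have : ∀ n, Frame p σ ((p.eval B)^[n] σ) := by
      intro n
      induction n with
      | zero => exact .refl _ _
      | succ n ih => rw [Function.iterate_succ_apply']; exact ih.trans (hp _)
    exact (this _).mono (fun _ h => h) (fun _ h => h) (fun h => h)

/-- Started in `σ`, the program takes at most `n` steps and ends in a state that satisfies `Q`. -/
def Cmd.Runs (B : ℕ) (p : Cmd) (σ : Store) (n : ℕ) (Q : Store → Prop) : Prop :=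
  p.cost B σ ≤ n ∧ Q (p.eval B σ)

variable {B : ℕ} {p q : Cmd} {σ : Store} {n n' : ℕ} {Q Q' : Store → Prop}

theorem Cmd.Runs.conseq (h : p.Runs B σ n Q) (hn : n ≤ n')
    (hQ : ∀ τ, Frame p σ τ → Q τ → Q' τ) : p.Runs B σ n' Q' :=
  ⟨h.1.trans hn, hQ _ (p.frame B σ) h.2⟩

theorem Cmd.Runs.seq (h : p.Runs B σ n fun τ => q.Runs B τ n' Q) : (p ;; q).Runs B σ (n + n') Q :=
  ⟨Nat.add_le_add h.1 h.2.1, h.2.2⟩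

/-- A loop-free program. -/
def Cmd.loopFree : Cmd → Bool
  | loop _ _ => false
  | Cmd.seq p q | iflt _ _ p q | ifeq _ _ p q => p.loopFree && q.loopFree
  | _ => true

/-- The number of instructions and tests of a program. -/
def Cmd.size : Cmd → ℕ
  | Cmd.seq p q => p.size + q.size
  | iflt _ _ p q | ifeq _ _ p q => 1 + (p.size + q.size)
  | loop _ p => 1 + p.size
  | _ => 1

/-- Without loops every instruction is executed at most once, so the time is bounded by a number
independent of the state; only loops have to be counted by hand. -/
theorem Cmd.cost_le_size (B : ℕ) (p : Cmd) (h : p.loopFree) : ∀ σ, p.cost B σ ≤ p.size := by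
  induction p with
  | seq p q hp hq =>
    intro σ
    simp only [loopFree, Bool.and_eq_true] at h
    exact Nat.add_le_add (hp h.1 σ) (hq h.2 _)
  | iflt x y p q hp hq =>
    intro σ
    simp only [loopFree, Bool.and_eq_true] at h
    have := hp h.1 σ
    have := hq h.2 σ
    simp only [cost, size]
    split_ifs <;> omega
  | ifeq x y p q hp hq =>
    intro σ
    simp only [loopFree, Bool.and_eq_true] at h
    have := hp h.1 σ
    have := hq h.2 σ
    simp only [cost, size]
    split_ifs <;> omega
  | loop x p hp => simp [loopFree] at h
  | _ => intro σ; simp [cost, size]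

theorem Cmd.runs_loopFree (h : p.loopFree) (hQ : Q (p.eval B σ)) : p.Runs B σ p.size Q :=
  ⟨p.cost_le_size B h σ, hQ⟩

/-- The rule for loops, with an invariant that may depend on the number of passes made. -/
theorem Cmd.runs_loop {x : Var} (I : ℕ → Store → Prop) (n : ℕ) (h0 : I 0 σ)
    (hs : ∀ i < σ.v x, ∀ τ, Frame p σ τ → I i τ → p.Runs B τ n (I (i + 1))) :
    (loop x p).Runs B σ (1 + σ.v x * (1 + n)) (I (σ.v x)) := by
  have key : ∀ i ≤ σ.v x, I i ((p.eval B)^[i] σ) ∧ Frame p σ ((p.eval B)^[i] σ) := by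
    intro i
    induction i with
    | zero => intro _; exact ⟨h0, .refl _ _⟩
    | succ i ih =>
      intro hi
      obtain ⟨h1, h2⟩ := ih (by omega)
      rw [Function.iterate_succ_apply']
      exact ⟨(hs i (by omega) _ h2 h1).2, h2.trans (p.frame B _)⟩
  refine ⟨?_, (key _ le_rfl).1⟩
  simp only [cost]
  refine Nat.add_le_add_left ?_ 1
  refine (Finset.sum_le_card_nsmul _ _ (1 + n) fun i hi => ?_).trans (by simp)
  have hi := Finset.mem_range.1 hi
  obtain ⟨h1, h2⟩ := key i hi.le
  exact Nat.add_le_add_left (hs i hi _ h2 h1).1 1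

theorem Cmd.runs_ifeq {x y : Var} (hp : σ.v x = σ.v y → p.Runs B σ n Q)
    (hq : ¬ σ.v x = σ.v y → q.Runs B σ n Q) : (ifeq x y p q).Runs B σ (1 + n) Q := by
  by_cases h : σ.v x = σ.v y
  · simpa [Runs, cost, eval, h] using hp h
  · simpa [Runs, cost, eval, h] using hq h

end CRMM
namespace CRMM

/-! ### The algorithm -/

namespace Alg

open Cmd Var Arr

/-- Read the table of the edges. Edge `j` becomes the arc `j`, from the source `m` to the sink `T`
for the time being. -/
def readEdge : Cmd :=
  read y ptr ;; put ea i y ;; succ ptr ;; read y ptr ;; put ep i y ;; succ ptr ;;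
  read y ptr ;; put rk i y ;; succ ptr ;; put res i one ;; put src i m ;; put dst i T ;; succ i

/-- Node `m` is the source, node `T = m + 1` the sink, and `nx = m + 2` the first node of the trees.
Cell 0 holds the number of applicants, cell 2 the number of edges, and the triples start at cell 3.
-/
def readHeader : Cmd :=
  zero i ;; read nA i ;; zero one ;; succ one ;; zero zr ;; succ i ;; succ i ;; read m i ;;
  copy T m ;; succ T ;; copy nx T ;; succ nx ;; copy ptr i ;; succ ptr ;; zero i

def readEdges : Cmd :=
  readHeader ;; loop m readEdge ;; copy base ptr

/-- Insert the node `nx` for the set of the edges at the vertex `v` whose other ends are marked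
with `nx`. -/
def attachStep (V O R : Arr) : Cmd :=
  get y V j ;;
  ifeq y v
    (get y O j ;; get y mark y ;;
      ifeq y nx (get y R j ;; put R nx y ;; put R j nx) skip)
    skip ;;
  succ j

/-- Arc `nx` belongs to node `nx`: its end in `R'` is the node itself, its end in `R` the parent. In
the intended use all edges of the set have the same entry in `R` beforehand, so any of them may
supply the parent. -/
def attach (V O R R' : Arr) : Cmd :=
  put R' nx nx ;; zero j ;; loop m (attachStep V O R) ;; succ nx

/-- Mark the other ends of the edges at `v`. -/
def markStep (V O : Arr) : Cmd :=
  get y V j ;; ifeq y v (get y O j ;; put mark y nx) skip ;; succ j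

/-- Enter a class into the table of classes. -/
def classStep : Cmd :=
  read y bp ;; put cq kc y ;; succ bp ;; read y bp ;; put csz kc y ;; succ bp ;; put cptr kc bp ;;
  put cv kc v ;; succ kc ;; add bp bp y

/-- Treat a vertex when it is met for the first time. -/
def newVertex (V O sn R R' : Arr) : Cmd :=
  put sn v one ;; add bp base v ;; read bp bp ;; read y bp ;; put res nx y ;; zero j ;;
  loop m (markStep V O) ;; attach V O R R' ;; succ bp ;; read nc bp ;; succ bp ;; loop nc classStep

/-- The flags `sn` are zero in fresh memory and need no initialization, so vertices without edges
cost no time at all. -/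
def rootStep (V O sn R R' : Arr) : Cmd :=
  get v V i ;; get y sn v ;; iflt y one (newVertex V O sn R R') skip ;; succ i

/-- Sort the classes by decreasing size. -/
def sortStep : Cmd := get y csz i ;; ifeq y sz (put ord no i ;; succ no) skip ;; succ i

/-- One scan of the table for each size from `m` down to 1. Empty classes are left out, since they
restrict nothing. -/
def sort : Cmd := zero no ;; copy sz m ;; loop m (zero i ;; loop kc sortStep ;; pred sz)

/-- Insert the node of a class. -/
def elemStep : Cmd := read y bp ;; put mark y nx ;; succ bp

def nodeStep (V O R R' : Arr) : Cmd :=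
  get c ord i ;; get v cv c ;; get bp cptr c ;; get sz csz c ;; get y cq c ;; put res nx y ;;
  loop sz elemStep ;; attach V O R R' ;; succ i

/-- Build the trees of the vertices of one side. -/
def side (V O sn R R' : Arr) : Cmd :=
  zero kc ;; zero i ;; loop m (rootStep V O sn R R') ;; sort ;; zero i ;;
  loop no (nodeStep V O R R')

/-- Add the reversed arcs. -/
def reverseStep : Cmd :=
  get y src i ;; put dst h y ;; get y dst i ;; put src h y ;; put rev i h ;; put rev h i ;;
  put un i i ;; put un h i ;; succ i ;; succ h

/-- Build the adjacency lists. -/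
def adjStep : Cmd := get y src h ;; get z fst y ;; put nxt h z ;; succ h ;; put fst y h

/-- Arc `N + e` is the reversal of arc `e`, and its residual capacity is the flow on `e`. -/
def network : Cmd :=
  copy N nx ;; copy h N ;; zero i ;; loop N reverseStep ;; copy N2 h ;; zero h ;; loop N2 adjStep

/-- One step of the search for an augmenting path. -/
def visit : Cmd := put vis y one ;; put pa y h ;; put qu qt y ;; succ qt

/-- `un` sends both directions of an arc to the arc itself, so that rank and freezing are stored
once. -/
def tryArc : Cmd :=
  get y un h ;; get z dd y ;;
  ifeq z one skip
    (get z rk y ;;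
      iflt k z skip
        (get z res h ;;
          iflt zr z (get y dst h ;; get z vis y ;; ifeq z one skip visit) skip))

/-- `a` is one more than the number of the arc to be examined next, and zero when the list of the
current node is exhausted. A step examines an arc, takes a node from the queue, or idles. -/
def searchStep : Cmd :=
  iflt zr a
    (copy h a ;; pred h ;; get a nxt h ;; tryArc)
    (iflt qh qt (get y qu qh ;; succ qh ;; get a fst y) skip)

def clearStep : Cmd := put vis i zr ;; succ i

/-- Each of the `2 N` residual arcs is examined at most once and each of the `N` nodes is taken at
most once, so `3 N + 1` steps are enough. -/
def search : Cmd :=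
  zero i ;; loop N clearStep ;;
  put vis m one ;; put qu zr m ;; zero qh ;; zero qt ;; succ qt ;; zero a ;;
  loop N2 searchStep ;; loop N searchStep ;; searchStep

/-- Augment along the path that was found. -/
def augmentStep : Cmd :=
  ifeq y m skip
    (get h pa y ;; get z res h ;; pred z ;; put res h z ;; get h rev h ;; get z res h ;; succ z ;;
      put res h z ;; get y dst h)

/-- The path is followed backwards from the sink; surplus passes idle at the source. -/
def augment : Cmd := copy y T ;; loop N augmentStep

/-- Exclude the arcs whose flow is determined from now on. -/
def freezeStep : Cmd :=
  get y src i ;; get y vis y ;; get z dst i ;; get z vis z ;; get c rk i ;;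
  iflt k c (iflt z y skip (put dd i one)) (ifeq y z skip (put dd i one)) ;; succ i

def freeze : Cmd := zero i ;; loop N freezeStep ;; succ k

def phase : Cmd := search ;; get y vis T ;; ifeq y one augment freeze

/-- Write the matching. -/
def outStep : Cmd :=
  get y res h ;;
  iflt zr y
    (get y ea j ;; write ptr y ;; succ ptr ;; get y ep j ;; write ptr y ;; succ ptr ;; succ cnt)
    skip ;;
  succ j ;; succ h

/-- The input is no longer needed, so the matching overwrites it from address 0 on; register 0,
which has to point to the output, holds 0. -/
def output : Cmd :=
  zero cnt ;; copy ptr one ;; zero j ;; copy h N ;; loop m outStep ;; write zr cnt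

/-- There are `2 m` phases: at most `m` of them augment, so at least `m` close a rank. -/
def main : Cmd :=
  readEdges ;; side ea ep snA src dst ;; copy base ptr ;; add base base nA ;;
  side ep ea snP dst src ;; network ;; zero k ;; succ k ;; loop m phase ;; loop m phase ;; output

end Alg

end CRMM
namespace CRMM

/-! ### Flows -/

open Classical in
/-- The number of edges of `M` whose path uses the arc `e`. -/
noncomputable def load (on : ℕ → ℕ → Prop) (M : Finset ℕ) (e : ℕ) : ℕ := (M.filter (on e)).card

/-- The net flow into the node `x`. -/
def netIn (N : ℕ) (tl hd : ℕ → ℕ) (f : ℕ → ℕ) (x : ℕ) : ℤ :=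
  ∑ e ∈ Finset.range N, (f e : ℤ) * ((if hd e = x then 1 else 0) - if tl e = x then 1 else 0)

open Classical in
/-- A network with source `m` and sink `m + 1` in which each edge `j < m` determines a path from the
source to the sink; `on e j` says that this path uses the arc `e`. The first `m` arcs are the edges
themselves, and two arcs are unused. Each other arc `x` connects the node `x` with a smaller one. -/
structure IsNet (m N : ℕ) (tl hd cp : ℕ → ℕ) (on : ℕ → ℕ → Prop) : Prop where
  le : m + 2 ≤ N
  on_edge : ∀ e < m, ∀ j < m, on e j ↔ e = j
  cp_edge : ∀ j < m, cp j = 1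
  dummy : ∀ e, m ≤ e → e < m + 2 → cp e = 0 ∧ ∀ j < m, ¬ on e j
  tele : ∀ j < m, ∀ φ : ℕ → ℤ,
    ∑ e ∈ Finset.range N, (if on e j then φ (hd e) - φ (tl e) else 0) = φ (m + 1) - φ m
  tree : ∀ x, m + 2 ≤ x → x < N → (hd x = x ∧ tl x < x) ∨ (tl x = x ∧ hd x < x)

/-- The edge sets that obey all capacities. -/
def Feas (m N : ℕ) (cp : ℕ → ℕ) (on : ℕ → ℕ → Prop) (M : Finset ℕ) : Prop :=
  M ⊆ Finset.range m ∧ ∀ e < N, load on M e ≤ cp e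

variable {m N : ℕ} {tl hd cp rk : ℕ → ℕ} {on : ℕ → ℕ → Prop}

/-- Exchange the sums and telescope along each path. With the indicator of a node as potential this
is conservation; with the indicator of the complement of a cut it is the value of the flow over the
cut. -/
theorem sum_load_mul (hN : IsNet m N tl hd cp on) {M : Finset ℕ} (hM : M ⊆ Finset.range m)
    (φ : ℕ → ℤ) :
    ∑ e ∈ Finset.range N, (load on M e : ℤ) * (φ (hd e) - φ (tl e)) =
      M.card * (φ (m + 1) - φ m) := by
  classical
  have h1 : ∀ e, (load on M e : ℤ) * (φ (hd e) - φ (tl e)) =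
      ∑ j ∈ M, if on e j then φ (hd e) - φ (tl e) else 0 := by
    intro e
    rw [← Finset.sum_filter, Finset.sum_const, nsmul_eq_mul]
    simp only [load]
  simp only [h1]
  rw [Finset.sum_comm, Finset.sum_congr rfl fun j hj => ?_]
  · rw [Finset.sum_const, nsmul_eq_mul]
  · rw [← hN.tele j (Finset.mem_range.1 (hM hj)) φ]

theorem netIn_load (hN : IsNet m N tl hd cp on) {M : Finset ℕ} (hM : M ⊆ Finset.range m) (x : ℕ) :
    netIn N tl hd (load on M) x =
      M.card * ((if m + 1 = x then 1 else 0) - if m = x then 1 else 0) :=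
  sum_load_mul hN hM fun y => if y = x then 1 else 0

theorem load_edge (hN : IsNet m N tl hd cp on) {M : Finset ℕ} (hM : M ⊆ Finset.range m) {e : ℕ}
    (he : e < m) : load on M e = if e ∈ M then 1 else 0 := by
  classical
  have : M.filter (on e) = if e ∈ M then {e} else ∅ := by
    ext j
    constructor
    · intro hj
      obtain ⟨h1, h2⟩ := Finset.mem_filter.1 hj
      have := (hN.on_edge e he j (Finset.mem_range.1 (hM h1))).1 h2
      subst this
      simp [h1]
    · intro hj
      by_cases h : e ∈ M
      · simp only [h, if_true, Finset.mem_singleton] at hj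
        subst hj
        exact Finset.mem_filter.2 ⟨h, (hN.on_edge _ he _ he).2 rfl⟩
      · simp [h] at hj
  have h2 : load on M e = (if e ∈ M then {e} else ∅ : Finset ℕ).card := by
    rw [← this]; simp only [load]
  rw [h2]
  split_ifs <;> rfl

theorem load_dummy (hN : IsNet m N tl hd cp on) {M : Finset ℕ} (hM : M ⊆ Finset.range m) {e : ℕ}
    (he : m ≤ e) (he' : e < m + 2) : load on M e = 0 := by
  classical
  simp only [load, Finset.card_eq_zero, Finset.filter_eq_empty_iff]
  exact fun j hj => (hN.dummy e he he').2 j (Finset.mem_range.1 (hM hj))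

/-- The edges that carry flow. -/
def support (m : ℕ) (f : ℕ → ℕ) : Finset ℕ := (Finset.range m).filter fun j => 0 < f j

theorem support_subset (m : ℕ) (f : ℕ → ℕ) : support m f ⊆ Finset.range m :=
  Finset.filter_subset _ _

/-- A flow is determined by the flow on the edges. -/
theorem flow_eq_load (hN : IsNet m N tl hd cp on) {f : ℕ → ℕ} (hf : ∀ e < N, f e ≤ cp e)
    (hc : ∀ x, m + 2 ≤ x → netIn N tl hd f x = 0) : ∀ e < N, f e = load on (support m f) e := by
  set M := support m f with hM
  have hMs : M ⊆ Finset.range m := support_subset m f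
  have h1 : ∀ e < m + 2, f e = load on M e := by
    intro e he
    have hle := hN.le
    have h := hf e (by omega)
    by_cases hem : e < m
    · rw [hN.cp_edge e hem] at h
      rw [load_edge hN hMs hem]
      simp only [hM, support, Finset.mem_filter, Finset.mem_range, hem, true_and]
      split_ifs <;> omega
    · rw [(hN.dummy e (by omega) he).1] at h
      rw [load_dummy hN hMs (by omega) he]
      omega
  -- Induction from the largest node downwards. At node `x` only the flow on arc `x` is still
  -- unknown: tree arcs with smaller numbers do not touch `x`, and those with larger numbers are
  -- already treated.
  have h2 : ∀ d x, m + 2 ≤ x → x < N → N ≤ x + d → f x = load on M x := by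
    intro d
    induction d with
    | zero => intro x _ hx hd; omega
    | succ d ih =>
      intro x hx hxN hd'
      have e1 := hc x hx
      have e2 := netIn_load hN hMs x
      rw [if_neg (by omega), if_neg (by omega)] at e2
      have e3 : ∑ e ∈ Finset.range N, ((f e : ℤ) - load on M e) *
          ((if hd e = x then 1 else 0) - if tl e = x then 1 else 0) = 0 := by
        simp only [sub_mul, Finset.sum_sub_distrib]
        simp only [netIn] at e1 e2
        rw [e1, e2]; simp
      rw [Finset.sum_eq_single_of_mem x (Finset.mem_range.2 hxN)] at e3
      · rcases hN.tree x hx hxN with ⟨h3, h4⟩ | ⟨h3, h4⟩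
        · rw [if_pos h3, if_neg (by omega)] at e3
          omega
        · rw [if_neg (by omega), if_pos h3] at e3
          omega
      · intro e he hex
        have heN := Finset.mem_range.1 he
        by_cases hem : e < m + 2
        · rw [h1 e hem]; simp
        · rcases lt_or_gt_of_ne hex with hlt | hgt
          · rcases hN.tree e (by omega) heN with ⟨h3, h4⟩ | ⟨h3, h4⟩ <;>
            · rw [if_neg (by omega), if_neg (by omega)]; simp
          · rw [ih e (by omega) heN (by omega)]; simp
  intro e he
  by_cases hem : e < m + 2
  · exact h1 e hem
  · exact h2 N e (by omega) he (by omega)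

/-! ### Ranks, optimality and the cut argument. -/

/-- The number of edges of rank at most `k`. -/
def upTo (rk : ℕ → ℕ) (M : Finset ℕ) (k : ℕ) : ℕ := (M.filter fun j => rk j ≤ k).card

/-- `M` is not lexicographically worse than `M'` as far as the ranks up to `k` are concerned. -/
def NotWorse (rk : ℕ → ℕ) (k : ℕ) (M M' : Finset ℕ) : Prop :=
  (∀ i ≤ k, upTo rk M i = upTo rk M' i) ∨
    ∃ i ≤ k, (∀ i' < i, upTo rk M i' = upTo rk M' i') ∧ upTo rk M' i < upTo rk M i

/-- The arcs of `D` are those whose load is the same in all matchings that are optimal for the ranks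
up to `k`, such as `M`, and a matching that has these loads is optimal. -/
structure Settled (m N : ℕ) (cp rk : ℕ → ℕ) (on : ℕ → ℕ → Prop) (k : ℕ) (D : ℕ → Prop)
    (M : Finset ℕ) : Prop where
  feas : Feas m N cp on M
  sound : ∀ M', Feas m N cp on M' → (∀ e < N, D e → load on M' e = load on M e) →
    ∀ i ≤ k, upTo rk M' i = upTo rk M i
  complete : ∀ M', Feas m N cp on M' → NotWorse rk k M' M →
    ∀ e < N, D e → load on M' e = load on M e

/-- This covers augmentation, which never changes the flow on a frozen arc. By `sound`, equal loads
on `D` already give equal counts for the ranks up to `k`. -/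
theorem Settled.congr {k : ℕ} {D : ℕ → Prop} {M M' : Finset ℕ} (h : Settled m N cp rk on k D M)
    (hM' : Feas m N cp on M') (hD : ∀ e < N, D e → load on M' e = load on M e) :
    Settled m N cp rk on k D M' := by
  have h1 := h.sound M' hM' hD
  refine ⟨hM', fun M'' hf ha i hi => ?_, fun M'' hf hw e he hDe => ?_⟩
  · rw [h1 i hi]
    exact h.sound M'' hf (fun e he hDe => (ha e he hDe).trans (hD e he hDe)) i hi
  · rw [hD e he hDe]
    refine h.complete M'' hf ?_ e he hDe
    rcases hw with hw | ⟨i, hi, hw, hlt⟩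
    · exact .inl fun i hi => (hw i hi).trans (h1 i hi)
    · exact .inr ⟨i, hi, fun i' hi' => (hw i' hi').trans (h1 i' (by omega)),
        (h1 i hi) ▸ hlt⟩

theorem settled_zero {M : Finset ℕ} (hM : Feas m N cp on M) (hrk : ∀ j < m, 1 ≤ rk j) :
    Settled m N cp rk on 0 (fun _ => False) M := by
  have : ∀ M', Feas m N cp on M' → upTo rk M' 0 = 0 := by
    intro M' h
    simp only [upTo, Finset.card_eq_zero, Finset.filter_eq_empty_iff]
    intro j hj
    have := hrk j (Finset.mem_range.1 (h.1 hj))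
    omega
  refine ⟨hM, fun M' h _ i hi => ?_, fun _ _ _ _ _ h => h.elim⟩
  obtain rfl : i = 0 := by omega
  rw [this M' h, this M hM]

/-- `1` if the arc `e` leaves `S`, `-1` if it enters `S`. -/
def crossing (tl hd : ℕ → ℕ) (S : ℕ → Bool) (e : ℕ) : ℤ :=
  (if S (hd e) then 0 else 1) - if S (tl e) then 0 else 1

theorem crossing_le (tl hd : ℕ → ℕ) (S : ℕ → Bool) (e : ℕ) : crossing tl hd S e ≤ 1 := by
  simp only [crossing]; split_ifs <;> omega

/-- Each path leaves `S` once more than it enters it, so the net load over the cut is `M.card`. Arcs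
of rank above `k` are edges; moving their share to the right turns their number into the sum of the
defects `1 - crossing`, which are nonnegative. -/
theorem sum_crossing (hN : IsNet m N tl hd cp on) (hrk : ∀ e, m ≤ e → rk e = 0) {S : ℕ → Bool}
    (hs : S m = true) (ht : S (m + 1) = false) {M : Finset ℕ} (hM : M ⊆ Finset.range m) (k : ℕ) :
    ∑ e ∈ (Finset.range N).filter (fun e => rk e ≤ k), (load on M e : ℤ) * crossing tl hd S e =
      upTo rk M k + ∑ e ∈ M.filter (fun e => ¬ rk e ≤ k), (1 - crossing tl hd S e) := by
  have h := sum_load_mul hN hM fun y => if S y then 0 else 1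
  simp only [hs, ht] at h
  rw [← Finset.sum_filter_add_sum_filter_not _ fun e => rk e ≤ k] at h
  have h2 : ∑ e ∈ (Finset.range N).filter (fun e => ¬ rk e ≤ k),
      (load on M e : ℤ) * crossing tl hd S e =
      ∑ e ∈ M.filter (fun e => ¬ rk e ≤ k), crossing tl hd S e := by
    symm
    refine Finset.sum_subset_zero_on_sdiff ?_ ?_ ?_
    · intro e he
      have := Finset.mem_range.1 (hM (Finset.mem_filter.1 he).1)
      have := hN.le
      exact Finset.mem_filter.2 ⟨Finset.mem_range.2 (by omega), (Finset.mem_filter.1 he).2⟩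
    · intro e he
      simp only [Finset.mem_sdiff, Finset.mem_filter, Finset.mem_range] at he
      have hem : e < m := by
        by_contra hem
        have := hrk e (by omega)
        omega
      rw [load_edge hN hM hem, if_neg (fun h' => he.2 ⟨h', he.1.2⟩)]
      simp
    · intro e he
      have heM := (Finset.mem_filter.1 he).1
      rw [load_edge hN hM (Finset.mem_range.1 (hM heM)), if_pos heM]
      simp
  have h3 := Finset.card_filter_add_card_filter_not (s := M) fun e => rk e ≤ k
  have h4 : ∑ e ∈ M.filter (fun e => ¬ rk e ≤ k), (1 - crossing tl hd S e) =
      (M.filter fun e => ¬ rk e ≤ k).card -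
        ∑ e ∈ M.filter (fun e => ¬ rk e ≤ k), crossing tl hd S e := by
    simp [Finset.sum_sub_distrib]
  simp only [crossing] at h2 h4 ⊢
  simp only [Bool.false_eq_true, if_true, if_false] at h
  rw [h2] at h
  rw [h4, upTo]
  have h3' : ((M.filter fun e => rk e ≤ k).card : ℤ) + (M.filter fun e => ¬ rk e ≤ k).card =
      M.card := by exact_mod_cast h3
  linarith

/-- When no augmenting path is left for the rank `k + 1`, the set `S` of the nodes that can be reached
from the source shows which further arcs are determined. -/
theorem Settled.step (hN : IsNet m N tl hd cp on) (hrk : ∀ e, m ≤ e → rk e = 0) {k : ℕ}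
    {D D' : ℕ → Prop} {M : Finset ℕ} (h : Settled m N cp rk on k D M)
    (hk : ∀ j ∈ M, rk j ≤ k + 1) {S : ℕ → Bool} (hs : S m = true) (ht : S (m + 1) = false)
    (hfw : ∀ e < N, ¬ D e → rk e ≤ k + 1 → S (tl e) = true → S (hd e) = false →
      load on M e = cp e)
    (hbw : ∀ e < N, ¬ D e → rk e ≤ k + 1 → S (tl e) = false → S (hd e) = true →
      load on M e = 0)
    (hD' : ∀ e, D' e ↔ D e ∨ (rk e ≤ k + 1 ∧ S (tl e) ≠ S (hd e)) ∨
      (k + 1 < rk e ∧ ¬ (S (tl e) = true ∧ S (hd e) = false))) :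
    Settled m N cp rk on (k + 1) D' M := by
  have hMm := h.feas.1
  -- As `M` has no edge of rank above `k + 1`, its load over the cut is just its number of edges of
  -- rank at most `k + 1`. For another matching the load exceeds that number by the sum of the
  -- defects.
  have hM0 := sum_crossing hN hrk hs ht hMm (k + 1)
  rw [Finset.filter_eq_empty_iff.2 (fun j hj => not_not.2 (hk j hj)), Finset.sum_empty,
    add_zero] at hM0
  have hχ : ∀ e, k + 1 < rk e → ¬ D' e → crossing tl hd S e = 1 := by
    intro e he hd'
    rw [hD'] at hd'
    push Not at hd'
    have := hd'.2.2 he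
    simp [crossing, this]
  have hχ' : ∀ e, k + 1 < rk e → crossing tl hd S e = 1 → S (tl e) = true ∧ S (hd e) = false := by
    intro e _ h1
    simp only [crossing] at h1
    split_ifs at h1 <;> simp_all
  have hz : ∀ e < N, k + 1 < rk e → load on M e = 0 := by
    intro e he hr
    have hem : e < m := by
      by_contra hem
      have := hrk e (by omega)
      omega
    rw [load_edge hN hMm hem, if_neg]
    intro heM
    have := hk e heM
    omega
  have hmem : ∀ M', M' ⊆ Finset.range m → ∀ e ∈ M', e < N ∧ load on M' e = 1 := by
    intro M' hM' e he
    have h1 := Finset.mem_range.1 (hM' he)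
    have := hN.le
    exact ⟨by omega, by rw [load_edge hN hM' h1, if_pos he]⟩
  refine ⟨h.feas, fun M' hf ha => ?_, fun M' hf hw => ?_⟩
  · have hD : ∀ e < N, D e → load on M' e = load on M e :=
      fun e he hd' => ha e he ((hD' e).2 (.inl hd'))
    have h1 := h.sound M' hf hD
    have hM1 := sum_crossing hN hrk hs ht hf.1 (k + 1)
    have e1 : ∑ e ∈ (Finset.range N).filter (fun e => rk e ≤ k + 1),
        (load on M' e : ℤ) * crossing tl hd S e =
        ∑ e ∈ (Finset.range N).filter (fun e => rk e ≤ k + 1),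
        (load on M e : ℤ) * crossing tl hd S e := by
      refine Finset.sum_congr rfl fun e he => ?_
      simp only [Finset.mem_filter, Finset.mem_range] at he
      by_cases hc : S (tl e) = S (hd e)
      · simp [crossing, hc]
      · rw [ha e he.1 ((hD' e).2 (.inr (.inl ⟨he.2, hc⟩)))]
    -- `M` has load 0 on the edges of rank above `k + 1`, so those used by `M'` cannot lie in `D'`;
    -- hence they leave `S` and have no defect.
    have e2 : ∑ e ∈ M'.filter (fun e => ¬ rk e ≤ k + 1), (1 - crossing tl hd S e) = 0 := by
      refine Finset.sum_eq_zero fun e he => ?_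
      simp only [Finset.mem_filter, not_le] at he
      obtain ⟨heN, hl⟩ := hmem M' hf.1 e he.1
      rw [hχ e he.2]
      · simp
      · intro hd'
        have := ha e heN hd'
        rw [hz e heN he.2] at this
        omega
    have h2 : upTo rk M' (k + 1) = upTo rk M (k + 1) := by
      have : (upTo rk M' (k + 1) : ℤ) = upTo rk M (k + 1) := by linarith
      exact_mod_cast this
    intro i hi
    rcases Nat.lt_or_ge i (k + 1) with hlt | hge
    · exact h1 i (by omega)
    · rw [show i = k + 1 by omega]; exact h2
  · have hw' : NotWorse rk k M' M := by
      rcases hw with hw | ⟨i, hi, hw, hlt⟩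
      · exact .inl fun i hi => hw i (by omega)
      · rcases Nat.lt_or_ge i (k + 1) with h1 | h1
        · exact .inr ⟨i, by omega, hw, hlt⟩
        · exact .inl fun i' hi' => hw i' (by omega)
    have hD := h.complete M' hf hw'
    have h1 := h.sound M' hf hD
    have h2 : upTo rk M (k + 1) ≤ upTo rk M' (k + 1) := by
      rcases hw with hw | ⟨i, hi, hw, hlt⟩
      · exact (hw _ le_rfl).ge
      · rcases Nat.lt_or_ge i (k + 1) with h3 | h3
        · have := h1 i (by omega); omega
        · rw [show k + 1 = i by omega]; exact hlt.le
    have hM1 := sum_crossing hN hrk hs ht hf.1 (k + 1)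
    -- Outside `D`, the arcs that leave `S` are saturated by `M` and those that enter it are empty,
    -- so no feasible matching has a larger signed load on any of them.
    have e1 : ∀ e ∈ (Finset.range N).filter (fun e => rk e ≤ k + 1),
        (load on M' e : ℤ) * crossing tl hd S e ≤ (load on M e : ℤ) * crossing tl hd S e := by
      intro e he
      simp only [Finset.mem_filter, Finset.mem_range] at he
      by_cases hDe : D e
      · rw [hD e he.1 hDe]
      · have hb := hf.2 e he.1
        by_cases ha : S (tl e) = true <;> by_cases hb' : S (hd e) = true
        · simp [crossing, ha, hb']
        · have := hfw e he.1 hDe he.2 ha (by simpa using hb')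
          simp only [crossing, ha, hb', if_true]
          simp only [Bool.false_eq_true, if_false]
          omega
        · have := hbw e he.1 hDe he.2 (by simpa using ha) hb'
          simp only [crossing, ha, hb', if_true]
          simp only [Bool.false_eq_true, if_false]
          omega
        · simp [crossing, ha, hb']
    have e2 : ∀ e ∈ M'.filter (fun e => ¬ rk e ≤ k + 1), 0 ≤ 1 - crossing tl hd S e :=
      fun e _ => by have := crossing_le tl hd S e; omega
    have e3 := Finset.sum_le_sum e1
    have e4 := Finset.sum_nonneg e2
    have h2' : (upTo rk M (k + 1) : ℤ) ≤ upTo rk M' (k + 1) := by exact_mod_cast h2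
    -- `M'` has at least as many edges of rank at most `k + 1` as `M`, so the inequalities are
    -- equalities term by term: all defects vanish, and the loads on the crossing arcs coincide.
    have e5 := (Finset.sum_eq_zero_iff_of_nonneg e2).1 (by linarith)
    have e6 := (Finset.sum_eq_sum_iff_of_le e1).1 (by linarith)
    intro e he hd'
    rcases (hD' e).1 hd' with hd' | ⟨hr, hc⟩ | ⟨hr, hc⟩
    · exact hD e he hd'
    · have := e6 e (Finset.mem_filter.2 ⟨Finset.mem_range.2 he, hr⟩)
      have hne : crossing tl hd S e ≠ 0 := by
        simp only [crossing]
        split_ifs <;> simp_all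
      exact_mod_cast mul_right_cancel₀ hne this
    · rw [hz e he hr]
      have hem : e < m := by
        by_contra hem
        have := hrk e (by omega)
        omega
      rw [load_edge hN hf.1 hem, if_neg]
      intro heM
      have := e5 e (Finset.mem_filter.2 ⟨heM, by omega⟩)
      exact hc (hχ' e hr (by linarith))

end CRMM
namespace CRMM

/-! ### Breadth-first search -/

/-- The invariant of the search from `s` in a graph with `N` nodes and `H` arcs, of which those with
`ok` may be used. The visited nodes stand in the queue `q`; those before `qh` have been taken from it,
and the arcs from the last of them that are not below `a` have been examined. -/
structure SearchInv (src dst nxt fst : ℕ → ℕ) (ok : ℕ → Prop) (s N H : ℕ) (q vis pa : ℕ → ℕ)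
    (a qh qt i : ℕ) : Prop where
  bin : ∀ x < N, vis x = 0 ∨ vis x = 1
  mem : ∀ j < qt, q j < N ∧ vis (q j) = 1
  inj : ∀ j < qt, ∀ j' < qt, q j = q j' → j = j'
  surj : ∀ x < N, vis x = 1 → ∃ j < qt, q j = x
  start : q 0 = s ∧ 1 ≤ qt
  par : ∀ j, 0 < j → j < qt → pa (q j) < H ∧ ok (pa (q j)) ∧ dst (pa (q j)) = q j ∧
    ∃ j' < j, src (pa (q j)) = q j'
  le : qh ≤ qt
  cur : a ≠ 0 → 0 < qh ∧ src (a - 1) = q (qh - 1) ∧ a ≤ H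
  closed : ∀ j < qh, ∀ h < H, src h = q j → (j + 1 = qh → a ≤ h) → ok h → vis (dst h) = 1
  progress : (∃ F : Finset ℕ, F ⊆ Finset.range H ∧ i ≤ qh + F.card ∧
    ∀ h ∈ F, ∃ j < qh, src h = q j ∧ (j + 1 = qh → a ≤ h)) ∨ (a = 0 ∧ qh = qt)

/-- The lists of the arcs that leave a node: `fst u` and `nxt h` are one more than the number of the
next arc, or zero. -/
structure IsAdj (src nxt fst : ℕ → ℕ) (H : ℕ) : Prop where
  fst_le : ∀ u, fst u ≤ H
  fst_src : ∀ u, fst u ≠ 0 → src (fst u - 1) = u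
  fst_max : ∀ h < H, h < fst (src h)
  nxt_le : ∀ h < H, nxt h ≤ h
  nxt_src : ∀ h < H, nxt h ≠ 0 → src (nxt h - 1) = src h
  nxt_max : ∀ h < H, ∀ h' < h, src h' = src h → h' < nxt h

section

variable {src dst nxt fst : ℕ → ℕ} {ok : ℕ → Prop} {s N H : ℕ} {q vis pa : ℕ → ℕ}
  {a qh qt i : ℕ}

theorem SearchInv.pop (hadj : IsAdj src nxt fst H)
    (h : SearchInv src dst nxt fst ok s N H q vis pa a qh qt i) (ha : a = 0) (hq : qh < qt) :
    SearchInv src dst nxt fst ok s N H q vis pa (fst (q qh)) (qh + 1) qt (i + 1) := by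
  refine { h with le := hq, cur := fun h1 => ⟨by omega, ?_, hadj.fst_le _⟩, closed := ?_,
                  progress := ?_ }
  · simpa using hadj.fst_src _ h1
  · intro j hj h' hh' hs hle
    rcases Nat.lt_or_ge j qh with h1 | h1
    · exact h.closed j h1 h' hh' hs fun _ => by omega
    · obtain rfl : j = qh := by omega
      have := hle rfl
      have := hadj.fst_max h' hh'
      rw [hs] at this
      omega
  · rcases h.progress with ⟨F, hF, hi, hm⟩ | ⟨_, h2⟩
    · refine .inl ⟨F, hF, by omega, fun h' hh' => ?_⟩
      obtain ⟨j, hj, hs, hl⟩ := hm h' hh'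
      exact ⟨j, by omega, hs, fun h3 => by omega⟩
    · omega

theorem SearchInv.done (h : SearchInv src dst nxt fst ok s N H q vis pa a qh qt i) (ha : a = 0)
    (hq : ¬ qh < qt) : SearchInv src dst nxt fst ok s N H q vis pa a qh qt (i + 1) :=
  { h with progress := .inr ⟨ha, by have := h.le; omega⟩ }

/-- The adjacency lists run through the arcs in decreasing order, so the single number `a` separates
the examined arcs of the current node from the others. -/
theorem SearchInv.next (hadj : IsAdj src nxt fst H)
    (h : SearchInv src dst nxt fst ok s N H q vis pa a qh qt i) (ha : 0 < a)
    (hv : ok (a - 1) → vis (dst (a - 1)) = 1) :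
    SearchInv src dst nxt fst ok s N H q vis pa (nxt (a - 1)) qh qt (i + 1) := by
  obtain ⟨h1, h2, h3⟩ := h.cur (by omega)
  have hle := hadj.nxt_le (a - 1) (by omega)
  refine { h with cur := fun h4 => ⟨h1, ?_, by omega⟩, closed := ?_, progress := ?_ }
  · rw [hadj.nxt_src (a - 1) (by omega) h4, h2]
  · intro j hj h' hh' hs hl ho
    rcases Nat.lt_or_ge h' a with h4 | h4
    · by_cases h5 : j + 1 = qh
      · have h6 := hl h5
        obtain rfl : j = qh - 1 := by omega
        rcases Nat.lt_or_ge h' (a - 1) with h7 | h7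
        · have := hadj.nxt_max (a - 1) (by omega) h' h7 (by rw [hs, h2])
          omega
        · obtain rfl : h' = a - 1 := by omega
          exact hv ho
      · exact h.closed j hj h' hh' hs (fun h6 => absurd h6 h5) ho
    · exact h.closed j hj h' hh' hs (fun _ => h4) ho
  · rcases h.progress with ⟨F, hF, hi, hm⟩ | ⟨h4, _⟩
    · have hn : a - 1 ∉ F := by
        intro h4
        obtain ⟨j, hj, hs, hl⟩ := hm _ h4
        have := h.inj j (by have := h.le; omega) (qh - 1) (by have := h.le; omega)
          (by rw [← hs, h2])
        have := hl (by omega)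
        omega
      refine .inl ⟨insert (a - 1) F, ?_, ?_, ?_⟩
      · intro h' hh'
        rcases Finset.mem_insert.1 hh' with rfl | hh'
        · exact Finset.mem_range.2 (by omega)
        · exact hF hh'
      · rw [Finset.card_insert_of_notMem hn]; omega
      · intro h' hh'
        rcases Finset.mem_insert.1 hh' with rfl | hh'
        · exact ⟨qh - 1, by omega, h2, fun _ => hle⟩
        · obtain ⟨j, hj, hs, hl⟩ := hm _ hh'
          exact ⟨j, hj, hs, fun h5 => by have := hl h5; omega⟩
    · omega

theorem SearchInv.visit (h : SearchInv src dst nxt fst ok s N H q vis pa a qh qt i)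
    (ha : 0 < a) (hok : ok (a - 1)) (hd : dst (a - 1) < N) (hv : vis (dst (a - 1)) ≠ 1) :
    SearchInv src dst nxt fst ok s N H (Function.update q qt (dst (a - 1)))
      (Function.update vis (dst (a - 1)) 1) (Function.update pa (dst (a - 1)) (a - 1)) a qh (qt + 1)
      i := by
  obtain ⟨h1, h2, h3⟩ := h.cur (by omega)
  have hle := h.le
  set x := dst (a - 1) with hx
  have hq : ∀ j < qt, Function.update q qt x j = q j := fun j hj =>
    Function.update_of_ne (by omega) _ _
  have hqt : Function.update q qt x qt = x := Function.update_self ..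
  have hne : ∀ j < qt, q j ≠ x := fun j hj e => hv (e ▸ (h.mem j hj).2)
  have hvis : ∀ y, vis y = 1 → Function.update vis x 1 y = 1 := by
    intro y hy
    by_cases e : y = x
    · rw [e, Function.update_self]
    · rwa [Function.update_of_ne e]
  refine ⟨?_, ?_, ?_, ?_, ?_, ?_, by omega, ?_, ?_, ?_⟩
  · intro y hy
    by_cases e : y = x
    · rw [e, Function.update_self]; exact .inr rfl
    · rw [Function.update_of_ne e]; exact h.bin y hy
  · intro j hj
    rcases Nat.lt_or_ge j qt with h4 | h4
    · rw [hq j h4]; exact ⟨(h.mem j h4).1, hvis _ (h.mem j h4).2⟩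
    · rw [show j = qt by omega, hqt]; exact ⟨hd, Function.update_self ..⟩
  · intro j hj j' hj' e
    rcases Nat.lt_or_ge j qt with h4 | h4 <;> rcases Nat.lt_or_ge j' qt with h5 | h5
    · rw [hq j h4, hq j' h5] at e; exact h.inj j h4 j' h5 e
    · rw [hq j h4, show j' = qt by omega, hqt] at e; exact absurd e (hne j h4)
    · rw [hq j' h5, show j = qt by omega, hqt] at e; exact absurd e.symm (hne j' h5)
    · omega
  · intro y hy hy'
    by_cases e : y = x
    · exact ⟨qt, by omega, by rw [hqt, e]⟩
    · rw [Function.update_of_ne e] at hy'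
      obtain ⟨j, hj, e'⟩ := h.surj y hy hy'
      exact ⟨j, by omega, by rw [hq j hj, e']⟩
  · have := h.start.2
    exact ⟨by rw [hq 0 (by omega)]; exact h.start.1, by omega⟩
  · intro j hj hj'
    rcases Nat.lt_or_ge j qt with h4 | h4
    · rw [hq j h4, Function.update_of_ne (hne j h4)]
      obtain ⟨p1, p2, p3, j', p4, p5⟩ := h.par j hj h4
      exact ⟨p1, p2, p3, j', p4, by rw [hq j' (by omega), p5]⟩
    · rw [show j = qt by omega, hqt, Function.update_self]
      exact ⟨by omega, hok, rfl, qh - 1, by omega, by rw [hq _ (by omega), h2]⟩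
  · intro _
    exact ⟨h1, by rw [hq _ (by omega), h2], h3⟩
  · intro j hj h' hh' hs hl ho
    rw [hq j (by omega)] at hs
    exact hvis _ (h.closed j hj h' hh' hs hl ho)
  · rcases h.progress with ⟨F, hF, hi, hm⟩ | ⟨h4, _⟩
    · refine .inl ⟨F, hF, hi, fun h' hh' => ?_⟩
      obtain ⟨j, hj, hs, hl⟩ := hm _ hh'
      exact ⟨j, hj, by rw [hq j (by omega), hs], hl⟩
    · omega

/-- The result of the search: `vis` marks the nodes that can be reached from `s`, and the arcs `pa`
lead to them along paths on which `d` increases. -/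
structure Searched (src dst : ℕ → ℕ) (ok : ℕ → Prop) (s N H : ℕ) (vis pa d : ℕ → ℕ) : Prop where
  start : vis s = 1
  bin : ∀ x < N, vis x = 0 ∨ vis x = 1
  closed : ∀ h < H, src h < N → vis (src h) = 1 → ok h → vis (dst h) = 1
  lt : ∀ x < N, vis x = 1 → d x < N
  par : ∀ x < N, vis x = 1 → x ≠ s → pa x < H ∧ ok (pa x) ∧ dst (pa x) = x ∧
    src (pa x) < N ∧ vis (src (pa x)) = 1 ∧ d (src (pa x)) < d x

/-- Every step before the end takes a node or examines a new arc, so after more than `H + N` steps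
the search is over. The function `d` is the position in the queue: it increases along parent arcs,
which is all that augmentation needs, and is not the length of a path. -/
theorem SearchInv.searched (h : SearchInv src dst nxt fst ok s N H q vis pa a qh qt i)
    (hi : H + N < i) : ∃ d, Searched src dst ok s N H vis pa d := by
  have hqt : qt ≤ N := by
    have := Finset.card_le_card_of_injOn (s := Finset.range qt) (t := Finset.range N) q
      (fun j hj => Finset.mem_coe.2 (Finset.mem_range.2 (h.mem j (Finset.mem_range.1 hj)).1))
      (fun j hj j' hj' e => h.inj j (Finset.mem_range.1 hj) j' (Finset.mem_range.1 hj') e)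
    simpa using this
  obtain ⟨ha, hq⟩ : a = 0 ∧ qh = qt := by
    rcases h.progress with ⟨F, hF, hi', _⟩ | h'
    · have := Finset.card_le_card hF
      rw [Finset.card_range] at this
      have := h.le
      omega
    · exact h'
  have hd : ∀ x, ∃ j, x < N → vis x = 1 → j < qt ∧ q j = x := by
    intro x
    by_cases hx : x < N ∧ vis x = 1
    · obtain ⟨j, h1, h2⟩ := h.surj x hx.1 hx.2
      exact ⟨j, fun _ _ => ⟨h1, h2⟩⟩
    · exact ⟨0, fun h1 h2 => absurd ⟨h1, h2⟩ hx⟩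
  choose d hd using hd
  have hdq : ∀ j < qt, d (q j) = j := by
    intro j hj
    obtain ⟨h1, h2⟩ := h.mem j hj
    obtain ⟨h3, h4⟩ := hd _ h1 h2
    exact h.inj _ h3 _ hj h4
  refine ⟨d, ?_, h.bin, ?_, ?_, ?_⟩
  · rw [← h.start.1]; exact (h.mem 0 h.start.2).2
  · intro h' hh' hs hv ho
    obtain ⟨j, hj, e⟩ := h.surj _ hs hv
    exact h.closed j (by omega) h' hh' e.symm (fun _ => by omega) ho
  · intro x hx hv
    have := (hd x hx hv).1
    omega
  · intro x hx hv hne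
    obtain ⟨h1, h2⟩ := hd x hx hv
    have h3 : 0 < d x := by
      rcases Nat.eq_zero_or_pos (d x) with e | e
      · rw [e, h.start.1] at h2; exact absurd h2.symm hne
      · exact e
    obtain ⟨p1, p2, p3, j', p4, p5⟩ := h.par _ h3 h1
    rw [h2] at p1 p2 p3 p5
    have hj' : j' < qt := by omega
    exact ⟨p1, p2, p3, by rw [p5]; exact (h.mem j' hj').1, by rw [p5]; exact (h.mem j' hj').2,
      by rw [p5, hdq j' hj']; exact p4⟩

end

/-! ### The main loop -/

open Cmd

attribute [local simp] eval Store.setV Store.setA Store.setL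

/-- The tables that describe the network in the state `σ`; they are not changed by the main loop. -/
structure Prepared (m N : ℕ) (tl hd rk : ℕ → ℕ) (σ : Store) : Prop where
  vm : σ.v .m = m
  vT : σ.v .T = m + 1
  vN : σ.v .N = N
  vN2 : σ.v .N2 = N + N
  one : σ.v .one = 1
  zr : σ.v .zr = 0
  le : m + 2 ≤ N
  tl_lt : ∀ e < N, tl e < N
  hd_lt : ∀ e < N, hd e < N
  src_fwd : ∀ e < N, σ.a .src e = tl e
  dst_fwd : ∀ e < N, σ.a .dst e = hd e
  src_bwd : ∀ e < N, σ.a .src (N + e) = hd e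
  dst_bwd : ∀ e < N, σ.a .dst (N + e) = tl e
  rev_fwd : ∀ e < N, σ.a .rev e = N + e
  rev_bwd : ∀ e < N, σ.a .rev (N + e) = e
  un_fwd : ∀ e < N, σ.a .un e = e
  un_bwd : ∀ e < N, σ.a .un (N + e) = e
  rk : ∀ e < N, σ.a .rk e = rk e
  adj : IsAdj (σ.a .src) (σ.a .nxt) (σ.a .fst) (N + N)

theorem Prepared.of_frame {m N : ℕ} {tl hd rk : ℕ → ℕ} {σ τ : Store}
    (h : Prepared m N tl hd rk σ) {p : Cmd} (hf : Frame p σ τ)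
    (hv : ∀ x ∈ p.wv, x ∉ [Var.m, .T, .N, .N2, .one, .zr])
    (ha : ∀ r ∈ p.wa, r ∉ [Arr.src, .dst, .rev, .un, .rk, .nxt, .fst]) :
    Prepared m N tl hd rk τ := by
  have v : ∀ x ∈ [Var.m, .T, .N, .N2, .one, .zr], τ.v x = σ.v x :=
    fun x hx => hf.v x fun h' => hv x h' hx
  have a : ∀ r ∈ [Arr.src, .dst, .rev, .un, .rk, .nxt, .fst], τ.a r = σ.a r :=
    fun r hr => hf.a r fun h' => ha r h' hr
  simp only [List.mem_cons, List.not_mem_nil, or_false, forall_eq_or_imp, forall_eq] at v a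
  obtain ⟨v1, v2, v3, v4, v5, v6⟩ := v
  obtain ⟨a1, a2, a3, a4, a5, a6, a7⟩ := a
  constructor <;> (try simp only [v1, v2, v3, v4, v5, v6, a1, a2, a3, a4, a5, a6, a7])
  exacts [h.vm, h.vT, h.vN, h.vN2, h.one, h.zr, h.le, h.tl_lt, h.hd_lt, h.src_fwd, h.dst_fwd,
    h.src_bwd, h.dst_bwd, h.rev_fwd, h.rev_bwd, h.un_fwd, h.un_bwd, h.rk, h.adj]

/-- A residual arc that may be used in the phase `k`. -/
def UsableArc (dd un rk res : ℕ → ℕ) (k h : ℕ) : Prop :=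
  dd (un h) ≠ 1 ∧ rk (un h) ≤ k ∧ 0 < res h

/-- The residual arcs that may be used in the state `σ`. -/
def Usable (σ : Store) : ℕ → Prop :=
  UsableArc (σ.a .dd) (σ.a .un) (σ.a .rk) (σ.a .res) (σ.v .k)

theorem Prepared.dst_lt {m N : ℕ} {tl hd rk : ℕ → ℕ} {σ : Store} (h : Prepared m N tl hd rk σ)
    {e : ℕ} (he : e < N + N) : σ.a .dst e < N := by
  rcases Nat.lt_or_ge e N with h1 | h1
  · rw [h.dst_fwd e h1]; exact h.hd_lt e h1
  · obtain ⟨e', rfl⟩ := Nat.exists_eq_add_of_le h1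
    rw [h.dst_bwd e' (by omega)]; exact h.tl_lt e' (by omega)

/-- The state of the search in `τ`. -/
def SearchState (m N : ℕ) (i : ℕ) (τ : Store) : Prop :=
  SearchInv (τ.a .src) (τ.a .dst) (τ.a .nxt) (τ.a .fst) (Usable τ) m N (N + N) (τ.a .qu) (τ.a .vis)
    (τ.a .pa) (τ.v .a) (τ.v .qh) (τ.v .qt) i

theorem searchStep_spec {B m N : ℕ} {tl hd rk : ℕ → ℕ} {σ : Store} {i : ℕ}
    (hp : Prepared m N tl hd rk σ) (h : SearchState m N i σ) :
    Alg.searchStep.Runs B σ Alg.searchStep.size (SearchState m N (i + 1)) := by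
  refine runs_loopFree rfl ?_
  have hone := hp.one
  have hzr := hp.zr
  by_cases h1 : 0 < σ.v .a
  · have hlt : σ.v .a - 1 < N + N := by have := (h.cur (by omega)).2.2; omega
    by_cases h2 : σ.a .dd (σ.a .un (σ.v .a - 1)) = 1
    · have := h.next hp.adj h1 fun ho => absurd h2 ho.1
      simpa [Alg.searchStep, Alg.tryArc, SearchState, hone, hzr, h1, h2, Usable] using this
    by_cases h3 : σ.v .k < σ.a .rk (σ.a .un (σ.v .a - 1))
    · have := h.next hp.adj h1 fun ho => absurd ho.2.1 (by omega)
      simpa [Alg.searchStep, Alg.tryArc, SearchState, hone, hzr, h1, h2, h3, Usable] using this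
    by_cases h4 : 0 < σ.a .res (σ.v .a - 1)
    · by_cases h5 : σ.a .vis (σ.a .dst (σ.v .a - 1)) = 1
      · have := h.next hp.adj h1 fun _ => h5
        simpa [Alg.searchStep, Alg.tryArc, SearchState, hone, hzr, h1, h2, h3, h4, h5, Usable]
          using this
      -- The new node is marked and queued first; only then does the arc count as examined.
      · have := (h.visit h1 ⟨h2, not_lt.1 h3, h4⟩ (hp.dst_lt hlt) h5).next hp.adj h1 fun _ =>
          Function.update_self ..
        simpa [Alg.searchStep, Alg.tryArc, Alg.visit, SearchState, hone, hzr, h1, h2, h3, h4, h5,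
          Usable] using this
    · have := h.next hp.adj h1 fun ho => absurd ho.2.2 h4
      simpa [Alg.searchStep, Alg.tryArc, SearchState, hone, hzr, h1, h2, h3, h4, Usable] using this
  · by_cases h2 : σ.v .qh < σ.v .qt
    · have := h.pop hp.adj (by omega) h2
      simpa [Alg.searchStep, SearchState, hzr, h1, h2, Usable] using this
    · have := h.done (by omega) h2
      simpa [Alg.searchStep, SearchState, hzr, h1, h2, Usable] using this

theorem search_spec {B m N : ℕ} {tl hd rk : ℕ → ℕ} {σ : Store} (hp : Prepared m N tl hd rk σ) :
    Alg.search.Runs B σ (200 * (N + 1)) fun τ =>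
      ∃ d, Searched (τ.a .src) (τ.a .dst) (Usable τ) m N (N + N) (τ.a .vis) (τ.a .pa) d := by
  have hle := hp.le
  refine Runs.conseq (n := 1 + ((1 + N * (1 + Alg.clearStep.size)) + (1 + (1 + (1 + (1 + (1 + (1 +
    ((1 + (N + N) * (1 + Alg.searchStep.size)) + ((1 + N * (1 + Alg.searchStep.size)) +
    Alg.searchStep.size)))))))))) ?_ ?_ fun _ _ h => h
  swap
  · simp [Alg.searchStep, Alg.clearStep, Alg.tryArc, Alg.visit, size]
    ring_nf
    omega
  refine Runs.seq (runs_loopFree rfl ?_)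
  have hp0 : Prepared m N tl hd rk ((zero .i).eval B σ) :=
    hp.of_frame (frame B _ σ) (by decide) (by decide)
  refine Runs.seq (Runs.conseq (runs_loop (fun i τ => τ.v .i = i ∧ ∀ x < i, τ.a .vis x = 0)
    Alg.clearStep.size ⟨by simp, by simp⟩ ?_) (by rw [hp0.vN]) fun τ hf hI => ?_)
  · rintro i hi τ hf ⟨h1, h2⟩
    have hz : τ.v .zr = 0 := (hf.v _ (by decide)).trans hp0.zr
    refine runs_loopFree rfl ⟨by simp [Alg.clearStep, h1], fun x hx => ?_⟩
    by_cases hxi : x = i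
    · simp [Alg.clearStep, h1, hxi, hz]
    · simp [Alg.clearStep, h1, Function.update_of_ne hxi, h2 x (by omega)]
  rw [hp0.vN] at hI
  have hp1 := hp0.of_frame hf (by decide) (by decide)
  clear hp hp0 hf
  have e1 := hp1.one
  have e2 := hp1.zr
  have e3 := hp1.vm
  refine Runs.seq (runs_loopFree rfl ?_)
  refine Runs.seq (runs_loopFree rfl ?_)
  refine Runs.seq (runs_loopFree rfl ?_)
  refine Runs.seq (runs_loopFree rfl ?_)
  refine Runs.seq (runs_loopFree rfl ?_)
  refine Runs.seq (runs_loopFree rfl ?_)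
  generalize hυ : (zero .a).eval B _ = υ
  have hp2 : Prepared m N tl hd rk υ := by
    rw [← hυ]
    exact hp1.of_frame (p := put .vis .m .one ;; put .qu .zr .m ;; zero .qh ;; zero .qt ;;
      succ .qt ;; zero .a) (frame B _ τ) (by decide) (by decide)
  have h0 : SearchState m N 0 υ := by
    have hv : υ.a .vis = Function.update (τ.a .vis) m 1 := by rw [← hυ]; simp [e1, e3]
    have hq : υ.a .qu = Function.update (τ.a .qu) 0 m := by rw [← hυ]; simp [e2, e3]
    have hqh : υ.v .qh = 0 := by rw [← hυ]; simp
    have hqt : υ.v .qt = 1 := by rw [← hυ]; simp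
    have ha : υ.v .a = 0 := by rw [← hυ]; simp
    unfold SearchState
    rw [hv, hq, hqh, hqt, ha]
    refine ⟨fun x hx => ?_, fun j hj => ?_, by omega, fun x hx hv' => ⟨0, by omega, ?_⟩,
      ⟨by simp, le_rfl⟩, by omega, by omega, by omega, by omega,
      .inl ⟨∅, by simp, by simp, by simp⟩⟩
    · by_cases h : x = m
      · simp [h]
      · simp [Function.update_of_ne h, hI.2 x hx]
    · obtain rfl : j = 0 := by omega
      simp; omega
    · by_contra h
      simp only [Function.update_self] at h
      rw [Function.update_of_ne (Ne.symm h), hI.2 x hx] at hv'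
      omega
  clear hυ
  have body : ∀ (τ : Store) (i₀ : ℕ) (x : Var), Prepared m N tl hd rk τ → SearchState m N i₀ τ →
      (loop x Alg.searchStep).Runs B τ (1 + τ.v x * (1 + Alg.searchStep.size))
        fun τ' => Prepared m N tl hd rk τ' ∧ SearchState m N (i₀ + τ.v x) τ' := by
    intro τ i₀ x hp h
    refine runs_loop (fun i τ' => Prepared m N tl hd rk τ' ∧ SearchState m N (i₀ + i) τ') _
      ⟨hp, h⟩ ?_
    rintro i - τ' - ⟨h1, h2⟩
    exact (searchStep_spec h1 h2).conseq le_rfl fun υ hf h =>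
      ⟨h1.of_frame hf (by decide) (by decide), h⟩
  refine Runs.seq (Runs.conseq (body υ 0 _ hp2 h0) (by rw [hp2.vN2]) fun τ' _ h' => ?_)
  rw [hp2.vN2] at h'
  refine Runs.seq (Runs.conseq (body τ' _ _ h'.1 h'.2) (by rw [h'.1.vN]) fun τ'' _ h'' => ?_)
  rw [h'.1.vN] at h''
  refine (searchStep_spec h''.1 h''.2).conseq le_rfl fun _ _ h => ?_
  -- The number of steps is `2 N + N + 1`, one more than the numbers of residual arcs and nodes
  -- together.
  exact SearchInv.searched h (by omega)

end CRMM
-- Augmenting, freezing, and the invariant of a phase.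
namespace CRMM

open Cmd

attribute [local simp] eval Store.setV Store.setA Store.setL

theorem netIn_update {N : ℕ} (tl hd f : ℕ → ℕ) {e : ℕ} (he : e < N) (n x : ℕ) :
    netIn N tl hd (Function.update f e n) x = netIn N tl hd f x +
      ((n : ℤ) - f e) * ((if hd e = x then 1 else 0) - if tl e = x then 1 else 0) := by
  have h := Finset.mem_range.2 he
  simp only [netIn]
  rw [← Finset.add_sum_erase _ _ h, ← Finset.add_sum_erase _ _ h, Function.update_self,
    Finset.sum_congr rfl fun e' he' => by rw [Function.update_of_ne (Finset.ne_of_mem_erase he')]]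
  ring

theorem netIn_congr {N : ℕ} (tl hd : ℕ → ℕ) {f g : ℕ → ℕ} (h : ∀ e < N, f e = g e) (x : ℕ) :
    netIn N tl hd f x = netIn N tl hd g x :=
  Finset.sum_congr rfl fun e he => by rw [h e (Finset.mem_range.1 he)]

/-- Move a unit of residual capacity from the arc `h` to the arc `h'`. -/
def push (res : ℕ → ℕ) (h h' : ℕ) : ℕ → ℕ :=
  Function.update (Function.update res h (res h - 1)) h'
    (Function.update res h (res h - 1) h' + 1)

theorem push_of_ne {res : ℕ → ℕ} {h h' g : ℕ} (hg : g ≠ h) (hg' : g ≠ h') :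
    push res h h' g = res g := by
  simp [push, hg, hg']

theorem push_left {res : ℕ → ℕ} {h h' : ℕ} (hh : h ≠ h') : push res h h' h = res h - 1 := by
  simp [push, hh]

theorem push_right {res : ℕ → ℕ} {h h' : ℕ} (hh : h ≠ h') : push res h h' h' = res h' + 1 := by
  simp [push, hh.symm]

/-- The effect of a unit of flow sent through a residual arc. -/
theorem push_spec {m N : ℕ} {tl hd rk : ℕ → ℕ} {σ : Store} (hp : Prepared m N tl hd rk σ)
    {res : ℕ → ℕ} {h : ℕ} (hh : h < N + N) (hpos : 0 < res h) :
    σ.a .un h < N ∧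
    (∀ e < N, push res h (σ.a .rev h) e + push res h (σ.a .rev h) (N + e) = res e + res (N + e)) ∧
    (∀ e < N, e ≠ σ.a .un h → push res h (σ.a .rev h) (N + e) = res (N + e)) ∧
    (∀ g, g ≠ h → res g ≤ push res h (σ.a .rev h) g) ∧
    ∀ x, netIn N tl hd (fun e => push res h (σ.a .rev h) (N + e)) x =
      netIn N tl hd (fun e => res (N + e)) x +
        ((if σ.a .dst h = x then 1 else 0) - if σ.a .src h = x then 1 else 0) := by
  have hle : ∀ h', h' ≠ h → ∀ g, g ≠ h → res g ≤ push res h h' g := by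
    intro h' hne g hg
    by_cases hg' : g = h'
    · rw [hg', push_right (Ne.symm hne)]; omega
    · rw [push_of_ne hg hg']
  rcases Nat.lt_or_ge h N with h1 | h1
  · rw [hp.un_fwd h h1, hp.rev_fwd h h1, hp.dst_fwd h h1, hp.src_fwd h h1]
    refine ⟨h1, fun e he => ?_, fun e he hne => push_of_ne (by omega) (by omega),
      hle _ (by omega), fun x => ?_⟩
    · by_cases e1 : e = h
      · rw [e1, push_left (by omega), push_right (by omega)]; omega
      · rw [push_of_ne (by omega) (by omega), push_of_ne (by omega) (by omega)]
    · have : ∀ e < N, push res h (N + h) (N + e) =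
          Function.update (fun e => res (N + e)) h (res (N + h) + 1) e := by
        intro e he
        by_cases e1 : e = h
        · rw [e1, push_right (by omega), Function.update_self]
        · rw [push_of_ne (by omega) (by omega), Function.update_of_ne e1]
      rw [netIn_congr tl hd this, netIn_update tl hd _ h1]
      push_cast
      ring
  · obtain ⟨e', rfl⟩ := Nat.exists_eq_add_of_le h1
    have h2 : e' < N := by omega
    rw [hp.un_bwd e' h2, hp.rev_bwd e' h2, hp.dst_bwd e' h2, hp.src_bwd e' h2]
    refine ⟨h2, fun e he => ?_, fun e he hne => push_of_ne (by omega) (by omega),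
      hle _ (by omega), fun x => ?_⟩
    · by_cases e1 : e = e'
      · rw [e1, push_left (by omega), push_right (by omega)]; omega
      · rw [push_of_ne (by omega) (by omega), push_of_ne (by omega) (by omega)]
    · have : ∀ e < N, push res (N + e') e' (N + e) =
          Function.update (fun e => res (N + e)) e' (res (N + e') - 1) e := by
        intro e he
        by_cases e1 : e = e'
        · rw [e1, push_left (by omega), Function.update_self]
        · rw [push_of_ne (by omega) (by omega), Function.update_of_ne e1]
      rw [netIn_congr tl hd this, netIn_update tl hd _ h2]
      push_cast [Nat.one_le_iff_ne_zero.2 hpos.ne']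
      ring

theorem Prepared.src_dst_rev {m N : ℕ} {tl hd rk : ℕ → ℕ} {σ : Store}
    (hp : Prepared m N tl hd rk σ) {h : ℕ} (hh : h < N + N) :
    σ.a .dst (σ.a .rev h) = σ.a .src h := by
  rcases Nat.lt_or_ge h N with h1 | h1
  · rw [hp.rev_fwd h h1, hp.dst_bwd h h1, hp.src_fwd h h1]
  · obtain ⟨e, rfl⟩ := Nat.exists_eq_add_of_le h1
    rw [hp.rev_bwd e (by omega), hp.dst_fwd e (by omega), hp.src_bwd e (by omega)]

/-- The current flow. -/
def flow (N : ℕ) (σ : Store) (e : ℕ) : ℕ := σ.a .res (N + e)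

/-- Along the parents `d` decreases, so the source is reached within `N` passes. Meanwhile the net
inflow has changed in two places only: it is one larger at the sink and one smaller at the current
node `y`. Arcs that are frozen or have rank above `k` are not usable and keep their flow. -/
theorem augment_spec {B m N : ℕ} {tl hd rk d : ℕ → ℕ} {σ : Store} (hp : Prepared m N tl hd rk σ)
    (hs : Searched (σ.a .src) (σ.a .dst) (Usable σ) m N (N + N) (σ.a .vis) (σ.a .pa) d)
    (ht : σ.a .vis (m + 1) = 1) :
    Alg.augment.Runs B σ (100 * (N + 1)) fun τ =>
      (∀ e < N, τ.a .res e + τ.a .res (N + e) = σ.a .res e + σ.a .res (N + e)) ∧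
      (∀ e < N, (σ.a .dd e = 1 ∨ σ.v .k < rk e) → flow N τ e = flow N σ e) ∧
      ∀ x, netIn N tl hd (flow N τ) x = netIn N tl hd (flow N σ) x +
        ((if m + 1 = x then 1 else 0) - if m = x then 1 else 0) := by
  have hle := hp.le
  refine Runs.conseq (n := 1 + (1 + N * (1 + Alg.augmentStep.size))) ?_ ?_ fun _ _ h => h
  swap
  · simp [Alg.augmentStep, size]
    ring_nf
    omega
  refine Runs.seq (runs_loopFree rfl ?_)
  have hp0 := hp.of_frame (frame B (copy .y .T) σ) (by decide) (by decide)
  refine Runs.conseq (runs_loop (fun i τ => τ.v .y < N ∧ σ.a .vis (τ.v .y) = 1 ∧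
      (τ.v .y = m ∨ d (τ.v .y) + i < N) ∧
      (∀ x < N, σ.a .vis x = 1 → x ≠ m → d x ≤ d (τ.v .y) → 0 < τ.a .res (σ.a .pa x)) ∧
      (∀ e < N, τ.a .res e + τ.a .res (N + e) = σ.a .res e + σ.a .res (N + e)) ∧
      (∀ e < N, (σ.a .dd e = 1 ∨ σ.v .k < rk e) → flow N τ e = flow N σ e) ∧
      ∀ x, netIn N tl hd (flow N τ) x = netIn N tl hd (flow N σ) x +
        ((if m + 1 = x then 1 else 0) - if τ.v .y = x then 1 else 0))
    Alg.augmentStep.size ?_ ?_) (by rw [hp0.vN]) fun τ _ hI => ?_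
  · have hT := hp.vT
    have := hs.lt (m + 1) (by omega) ht
    refine ⟨?_, ?_, ?_, fun x hx hv hne _ => ?_, fun e _ => ?_, fun e _ _ => ?_, fun x => ?_⟩
    · simp [hT]; omega
    · simp [hT, ht]
    · simp [hT, this]
    · exact (hs.par x hx hv hne).2.1.2.2
    · simp
    · simp [flow]
    · have : flow N ((copy .y .T).eval B σ) = flow N σ := rfl
      rw [this]
      simp [hT]
  · rintro i - τ hf ⟨h1, h2, h3, h4, h5, h6, h7⟩
    refine runs_loopFree rfl ?_
    have fa : ∀ r, r ≠ Arr.res → τ.a r = σ.a r := fun r hr => by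
      rw [hf.a r (by simpa [Alg.augmentStep, wa] using hr)]; rfl
    have fm : τ.v .m = m := (hf.v _ (by decide)).trans hp0.vm
    by_cases hy : τ.v .y = m
    · have : Alg.augmentStep.eval B τ = τ := by simp [Alg.augmentStep, hy, fm]
      rw [this]
      exact ⟨h1, h2, .inl hy, h4, h5, h6, h7⟩
    · obtain ⟨q1, q2, q3, q4, q5, q6⟩ := hs.par _ h1 h2 hy
      have q7 := h4 _ h1 h2 hy le_rfl
      obtain ⟨s1, s2, s3, s4, s5⟩ := push_spec hp (res := τ.a .res) q1 q7
      have ey : (Alg.augmentStep.eval B τ).v .y = σ.a .src (σ.a .pa (τ.v .y)) := by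
        rw [← hp.src_dst_rev q1]
        simp [Alg.augmentStep, hy, fm, fa]
      have er : (Alg.augmentStep.eval B τ).a .res =
          push (τ.a .res) (σ.a .pa (τ.v .y)) (σ.a .rev (σ.a .pa (τ.v .y))) := by
        simp [Alg.augmentStep, hy, fm, fa, push]
      unfold flow at *
      rw [ey, er]
      refine ⟨q4, q5, .inr (by omega), fun x hx hv hne hd' => ?_, fun e he => ?_,
        fun e he hD => ?_, fun x => ?_⟩
      · have q8 := h4 x hx hv hne (by omega)
        -- Distinct nodes have distinct parent arcs, so the unit just sent does not lower the
        -- capacity of an arc that lies ahead.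
        have q9 : σ.a .pa x ≠ σ.a .pa (τ.v .y) := by
          intro h
          have := (hs.par x hx hv hne).2.2.1
          rw [h, q3] at this
          rw [← this] at hd'
          omega
        exact q8.trans_le (s4 _ q9)
      · rw [s2 e he, h5 e he]
      · rw [s3 e he ?_, h6 e he hD]
        rintro rfl
        rcases hD with hD | hD
        · exact q2.1 hD
        · have := q2.2.1
          rw [hp.rk _ s1] at this
          omega
      · rw [s5 x, h7 x, q3]
        ring
  · rw [hp0.vN] at hI
    obtain ⟨-, -, h3, -, h5, h6, h7⟩ := hI
    have hy : τ.v .y = m := by rcases h3 with h3 | h3 <;> omega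
    rw [hy] at h7
    exact ⟨h5, h6, h7⟩

/-- The condition is that of `Settled.step` for the set of visited nodes. An edge of rank above `k`
escapes being newly frozen only if it leads from a visited node to an unvisited one. -/
theorem freeze_spec {B m N : ℕ} {tl hd rk : ℕ → ℕ} {σ : Store} (hp : Prepared m N tl hd rk σ)
    (hv : ∀ x < N, σ.a .vis x = 0 ∨ σ.a .vis x = 1) :
    Alg.freeze.Runs B σ (100 * (N + 1)) fun τ => τ.v .k = σ.v .k + 1 ∧
      ∀ e < N, τ.a .dd e = 1 ↔ σ.a .dd e = 1 ∨
        (rk e ≤ σ.v .k ∧ decide (σ.a .vis (tl e) = 1) ≠ decide (σ.a .vis (hd e) = 1)) ∨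
        (σ.v .k < rk e ∧ ¬ (decide (σ.a .vis (tl e) = 1) = true ∧
          decide (σ.a .vis (hd e) = 1) = false)) := by
  refine Runs.conseq (n := 1 + ((1 + N * (1 + Alg.freezeStep.size)) + 1)) ?_ ?_ fun _ _ h => h
  swap
  · simp [Alg.freezeStep, size]
    ring_nf
    omega
  refine Runs.seq (runs_loopFree rfl ?_)
  have hp0 := hp.of_frame (frame B (zero .i) σ) (by decide) (by decide)
  refine Runs.seq (Runs.conseq (runs_loop (fun i τ => τ.v .i = i ∧
      (∀ e, i ≤ e → τ.a .dd e = σ.a .dd e) ∧ ∀ e < i, τ.a .dd e = 1 ↔ σ.a .dd e = 1 ∨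
        (rk e ≤ σ.v .k ∧ decide (σ.a .vis (tl e) = 1) ≠ decide (σ.a .vis (hd e) = 1)) ∨
        (σ.v .k < rk e ∧ ¬ (decide (σ.a .vis (tl e) = 1) = true ∧
          decide (σ.a .vis (hd e) = 1) = false)))
    Alg.freezeStep.size ?_ ?_) (by rw [hp0.vN]) fun τ hf hI => ?_)
  · exact ⟨rfl, fun _ _ => rfl, by omega⟩
  · rintro i hi τ hf ⟨h1, h2, h3⟩
    rw [hp0.vN] at hi
    have hp' := hp0.of_frame hf (by decide) (by decide)
    refine runs_loopFree rfl ?_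
    have ev : τ.a .vis = σ.a .vis := hf.a _ (by decide)
    have ek : τ.v .k = σ.v .k := hf.v _ (by decide)
    have e1 := hp'.src_fwd i hi
    have e2 := hp'.dst_fwd i hi
    have e3 := hp'.rk i hi
    have e4 := hp'.one
    obtain ⟨ei, hdd⟩ : (Alg.freezeStep.eval B τ).v .i = i + 1 ∧ (Alg.freezeStep.eval B τ).a .dd = if (rk i ≤ σ.v .k ∧
        decide (σ.a .vis (tl i) = 1) ≠ decide (σ.a .vis (hd i) = 1)) ∨
        (σ.v .k < rk i ∧ ¬ (decide (σ.a .vis (tl i) = 1) = true ∧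
          decide (σ.a .vis (hd i) = 1) = false)) then Function.update (τ.a .dd) i 1
        else τ.a .dd := by
      have v1 := hv _ (hp.tl_lt i hi)
      have v2 := hv _ (hp.hd_lt i hi)
      by_cases c1 : rk i ≤ σ.v .k
      · have c1' : ¬ σ.v .k < rk i := by omega
        rcases v1 with v1 | v1 <;> rcases v2 with v2 | v2 <;>
          simp [Alg.freezeStep, h1, ev, ek, e1, e2, e3, e4, c1, c1', v1, v2]
      · have c1' : σ.v .k < rk i := by omega
        rcases v1 with v1 | v1 <;> rcases v2 with v2 | v2 <;>
          simp [Alg.freezeStep, h1, ev, ek, e1, e2, e3, e4, c1, c1', v1, v2]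
    refine ⟨ei, fun e he => ?_, fun e he => ?_⟩
    · rw [hdd]
      split_ifs
      · rw [Function.update_of_ne (by omega), h2 e (by omega)]
      · exact h2 e (by omega)
    · by_cases hei : e = i
      · rw [hdd, hei, ← h2 i le_rfl]
        split_ifs with hc
        · simp only [Function.update_self, hc, or_true]
        · simp only [hc, or_false]
      · rw [← h3 e (by omega), hdd]
        split_ifs
        · rw [Function.update_of_ne hei]
        · rfl
  · rw [hp0.vN] at hI
    refine runs_loopFree rfl ⟨?_, hI.2.2⟩
    have : τ.v .k = σ.v .k := hf.v _ (by decide)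
    simp [this]

/-- The invariant of the main loop after `i` phases. -/
structure PhaseInv (m N : ℕ) (tl hd cp rk : ℕ → ℕ) (on : ℕ → ℕ → Prop) (i : ℕ) (σ : Store) :
    Prop where
  prep : Prepared m N tl hd rk σ
  pos : 1 ≤ σ.v .k
  cap : ∀ e < N, σ.a .res e + σ.a .res (N + e) = cp e
  cons : ∀ x, m + 2 ≤ x → netIn N tl hd (flow N σ) x = 0
  low : ∀ j < m, σ.v .k < rk j → flow N σ j = 0
  settled : Settled m N cp rk on (σ.v .k - 1) (fun e => σ.a .dd e = 1) (support m (flow N σ))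
  count : netIn N tl hd (flow N σ) (m + 1) + σ.v .k = i + 1

theorem Settled.mono_dead {m N : ℕ} {cp rk : ℕ → ℕ} {on : ℕ → ℕ → Prop} {k : ℕ} {D D' : ℕ → Prop}
    {M : Finset ℕ} (h : Settled m N cp rk on k D M) (hD : ∀ e < N, D e ↔ D' e) :
    Settled m N cp rk on k D' M :=
  ⟨h.feas, fun M' hf ha => h.sound M' hf fun e he hDe => ha e he ((hD e he).1 hDe),
    fun M' hf hw e he hDe => h.complete M' hf hw e he ((hD e he).2 hDe)⟩

/-- If the sink is reached, a unit is sent and the frozen arcs keep their loads; otherwise the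
visited nodes are the cut for `Settled.step`, and `k` grows. Either way the flow value plus `k`
grows by one. -/
theorem phase_spec {B m N : ℕ} {tl hd cp rk : ℕ → ℕ} {on : ℕ → ℕ → Prop}
    (hN : IsNet m N tl hd cp on) (hrk : ∀ e, m ≤ e → rk e = 0) {σ : Store} {i : ℕ}
    (h : PhaseInv m N tl hd cp rk on i σ) :
    Alg.phase.Runs B σ (400 * (N + 1)) (PhaseInv m N tl hd cp rk on (i + 1)) := by
  have hle := hN.le
  refine Runs.conseq (n := 200 * (N + 1) + (1 + (1 + 100 * (N + 1)))) ?_ (by omega)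
    fun _ _ h => h
  refine Runs.seq (Runs.conseq (search_spec h.prep) le_rfl fun τ hf hd' => ?_)
  obtain ⟨d, hd'⟩ := hd'
  have hp := h.prep.of_frame hf (by decide) (by decide)
  have er : τ.a .res = σ.a .res := hf.a _ (by decide)
  have ed : τ.a .dd = σ.a .dd := hf.a _ (by decide)
  have ek : τ.v .k = σ.v .k := hf.v _ (by decide)
  have h' : PhaseInv m N tl hd cp rk on i τ := by
    have ef : flow N τ = flow N σ := by unfold flow; rw [er]
    obtain ⟨g1, g2, g3, g4, g5, g6, g7⟩ := h
    refine ⟨hp, ?_, ?_, ?_, ?_, ?_, ?_⟩ <;> simp only [er, ed, ek, ef]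
    exacts [g2, g3, g4, g5, g6, g7]
  clear h hf er ed ek σ
  have hload : ∀ f : ℕ → ℕ, (∀ e < N, f e ≤ cp e) →
      (∀ x, m + 2 ≤ x → netIn N tl hd f x = 0) → Feas m N cp on (support m f) ∧
        ∀ e < N, load on (support m f) e = f e := by
    intro f hf hc
    have := flow_eq_load hN hf hc
    exact ⟨⟨support_subset m f, fun e he => by rw [← this e he]; exact hf e he⟩,
      fun e he => (this e he).symm⟩
  have hfl := hload (flow N τ) (fun e he => by have := h'.cap e he; unfold flow; omega) h'.cons
  refine Runs.seq (runs_loopFree rfl ?_)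
  have hp1 := hp.of_frame (frame B (get .y .vis .T) τ) (by decide) (by decide)
  have hT := hp.vT
  have h1 := hp.one
  refine runs_ifeq (fun hy => ?_) fun hy => ?_
  · have hvt : τ.a .vis (m + 1) = 1 := by simpa [hT, h1] using hy
    refine Runs.conseq (augment_spec hp1 (d := d) hd' hvt) le_rfl fun υ hf hQ => ?_
    obtain ⟨a1, a2, a3⟩ := hQ
    have hk : υ.v .k = τ.v .k := hf.v _ (by decide)
    have hdd : υ.a .dd = τ.a .dd := hf.a _ (by decide)
    have ef : flow N ((get .y .vis .T).eval B τ) = flow N τ := rfl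
    rw [ef] at a2 a3
    replace a1 : ∀ e < N, υ.a .res e + υ.a .res (N + e) = τ.a .res e + τ.a .res (N + e) := a1
    replace a2 : ∀ e < N, τ.a .dd e = 1 ∨ τ.v .k < rk e → flow N υ e = flow N τ e := a2
    have hcap : ∀ e < N, υ.a .res e + υ.a .res (N + e) = cp e := fun e he => by
      rw [a1 e he, h'.cap e he]
    have hcons : ∀ x, m + 2 ≤ x → netIn N tl hd (flow N υ) x = 0 := fun x hx => by
      rw [a3 x, h'.cons x hx, if_neg (by omega), if_neg (by omega)]; rfl
    have hfl' := hload (flow N υ) (fun e he => by have := hcap e he; unfold flow; omega) hcons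
    refine ⟨hp1.of_frame hf (by decide) (by decide), by rw [hk]; exact h'.pos, hcap, hcons,
      fun j hj hlt => ?_, ?_, ?_⟩
    · rw [hk] at hlt
      rw [a2 j (by omega) (.inr hlt)]
      exact h'.low j hj hlt
    · rw [hk, hdd]
      refine h'.settled.congr hfl'.1 fun e he hD => ?_
      rw [hfl'.2 e he, hfl.2 e he]
      exact a2 e he (.inl hD)
    · rw [a3, hk, if_pos rfl, if_neg (by omega)]
      have := h'.count
      push_cast
      linarith
  · have hvt : τ.a .vis (m + 1) ≠ 1 := by simpa [hT, h1] using hy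
    refine Runs.conseq (freeze_spec hp1 hd'.bin) le_rfl fun υ hf hQ => ?_
    obtain ⟨a1, a2⟩ := hQ
    replace a1 : υ.v .k = τ.v .k + 1 := a1
    have hr : υ.a .res = τ.a .res := hf.a _ (by decide)
    have ef : flow N υ = flow N τ := by unfold flow; rw [hr]
    have hpos := h'.pos
    refine ⟨hp1.of_frame hf (by decide) (by decide), by omega, ?_, ?_, ?_, ?_, ?_⟩
    · rw [hr]; exact h'.cap
    · rw [ef]; exact h'.cons
    · rw [ef]; intro j hj hlt; exact h'.low j hj (by omega)
    · rw [ef, a1, show τ.v .k + 1 - 1 = τ.v .k - 1 + 1 by omega]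
      refine Settled.mono_dead (D := fun e => τ.a .dd e = 1 ∨
        (rk e ≤ τ.v .k - 1 + 1 ∧ decide (τ.a .vis (tl e) = 1) ≠ decide (τ.a .vis (hd e) = 1)) ∨
        (τ.v .k - 1 + 1 < rk e ∧ ¬ (decide (τ.a .vis (tl e) = 1) = true ∧
          decide (τ.a .vis (hd e) = 1) = false))) ?_ ?_
      · rw [show τ.v .k - 1 + 1 = τ.v .k by omega]
        have := h'.settled.step hN hrk (S := fun x => decide (τ.a .vis x = 1)) (D' := fun e =>
          τ.a .dd e = 1 ∨
          (rk e ≤ τ.v .k ∧ decide (τ.a .vis (tl e) = 1) ≠ decide (τ.a .vis (hd e) = 1)) ∨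
          (τ.v .k < rk e ∧ ¬ (decide (τ.a .vis (tl e) = 1) = true ∧
            decide (τ.a .vis (hd e) = 1) = false))) ?_ (by simpa using hd'.start) (by simpa using hvt)
            ?_ ?_ ?_
        · rwa [show τ.v .k - 1 + 1 = τ.v .k by omega] at this
        · intro j hj
          obtain ⟨hj1, hj2⟩ := Finset.mem_filter.1 hj
          by_contra hlt
          have := h'.low j (Finset.mem_range.1 hj1) (by omega)
          omega
        -- If the arc were not saturated, the search would have followed it to its head.
        · intro e he hD hk h2 h3
          simp only [decide_eq_true_eq, decide_eq_false_iff_not] at h2 h3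
          rw [hfl.2 e he]
          have hc := h'.cap e he
          unfold flow
          by_contra hne
          refine h3 ?_
          rw [← hp.dst_fwd e he]
          refine hd'.closed e (by omega) (by rw [hp.src_fwd e he]; exact hp.tl_lt e he)
            (by rw [hp.src_fwd e he]; exact h2) ⟨?_, ?_, by omega⟩
          · rw [hp.un_fwd e he]; exact hD
          · rw [hp.un_fwd e he, hp.rk e he]; omega
        -- If the arc carried flow, its reversal `N + e` would have residual capacity, and the
        -- search would have followed that.
        · intro e he hD hk h2 h3
          simp only [decide_eq_true_eq, decide_eq_false_iff_not] at h2 h3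
          rw [hfl.2 e he]
          unfold flow
          by_contra hne
          refine h2 ?_
          rw [← hp.dst_bwd e he]
          refine hd'.closed (N + e) (by omega) (by rw [hp.src_bwd e he]; exact hp.hd_lt e he)
            (by rw [hp.src_bwd e he]; exact h3) ⟨?_, ?_, by omega⟩
          · rw [hp.un_bwd e he]; exact hD
          · rw [hp.un_bwd e he, hp.rk e he]; omega
        · intro e
          rw [show τ.v .k - 1 + 1 = τ.v .k by omega]
      · intro e he
        rw [a2 e he, show τ.v .k - 1 + 1 = τ.v .k by omega]
        rfl
    · rw [ef, a1]
      have := h'.count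
      push_cast
      linarith

end CRMM
namespace CRMM

open Cmd

attribute [local simp] eval Store.setV Store.setA Store.setL

/-! ### Building the trees -/

/-- The nodes from `lo` to `nx - 1`, with parents `R`, form a forest under `root`; for `j < m` the node
`R j` is the lowest one above the edge `j`. The predicate `S x j` says that `x` is above `j`. -/
structure IsForest (m lo nx root : ℕ) (R : ℕ → ℕ) (S : ℕ → ℕ → Prop) : Prop where
  tele : ∀ j < m, ∀ φ : ℕ → ℤ, ∀ P : ℕ → Prop, ∀ _ : DecidablePred P, (∀ x, P x ↔ S x j) →
    ∑ x ∈ Finset.Ico lo nx, (if P x then φ x - φ (R x) else 0) = φ (R j) - φ root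
  same : ∀ j < m, ∀ j' < m, (∀ x, lo ≤ x → x < nx → (S x j ↔ S x j')) → R j = R j'
  lt : ∀ x, lo ≤ x → x < nx → R x < x
  lt_edge : ∀ j < m, R j < nx

/-- A new node `nx` is inserted below the lowest nodes above a set `X` of edges. -/
theorem IsForest.attach {m lo nx root : ℕ} {R R₁ : ℕ → ℕ} {S : ℕ → ℕ → Prop} {X : ℕ → Prop}
    (h : IsForest m lo nx root R S) (hm : m ≤ lo) (hlo : lo ≤ nx)
    (hX : ∀ x, lo ≤ x → x < nx → (∀ j < m, X j → S x j) ∨ ∀ j < m, X j → ¬ S x j)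
    (hnew : ∃ j < m, X j ∧ R₁ nx = R j) (hin : ∀ j < m, X j → R₁ j = nx)
    (hout : ∀ y, y ≠ nx → ¬ (y < m ∧ X y) → R₁ y = R y) :
    IsForest m lo (nx + 1) root R₁ (Function.update S nx X) := by
  obtain ⟨j₀, hj₀, hXj₀, hR⟩ := hnew
  -- Every earlier node is above all edges in `X` or above none of them, so by `same` these edges
  -- have a common lowest node, which becomes the parent.
  have hcom : ∀ j < m, X j → R j = R j₀ := by
    intro j hj hXj
    refine h.same j hj j₀ hj₀ fun x hx hx' => ?_
    rcases hX x hx hx' with h1 | h1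
    · exact ⟨fun _ => h1 j₀ hj₀ hXj₀, fun _ => h1 j hj hXj⟩
    · exact ⟨fun h2 => absurd h2 (h1 j hj hXj), fun h2 => absurd h2 (h1 j₀ hj₀ hXj₀)⟩
  have hold : ∀ x, lo ≤ x → x < nx → R₁ x = R x :=
    fun x hx hx' => hout x (by omega) (fun h' => by omega)
  refine ⟨fun j hj φ P _ hP => ?_, fun j hj j' hj' hs => ?_, fun x hx hx' => ?_, fun j hj => ?_⟩
  · rw [Finset.sum_Ico_succ_top hlo]
    have e1 : ∑ x ∈ Finset.Ico lo nx, (if P x then φ x - φ (R₁ x) else 0) =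
        ∑ x ∈ Finset.Ico lo nx, (if P x then φ x - φ (R x) else 0) :=
      Finset.sum_congr rfl fun x hx => by
        have := Finset.mem_Ico.1 hx
        rw [hold x this.1 this.2]
    -- `S` and its update differ only at `nx`, which is outside the range of the sum. Quantifying
    -- `tele` over all predicates equivalent to `S` makes room for this correction and for any
    -- decidability instance.
    have e2 := h.tele j hj φ (fun x => x ≠ nx ∧ P x ∨ x = nx ∧ S x j)
      (Classical.decPred _) (fun x => by
        by_cases hx : x = nx
        · simp [hx]
        · have := hP x
          simp only [Function.update_of_ne hx] at this
          simp [hx, this])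
    have e3 : ∑ x ∈ Finset.Ico lo nx, (if P x then φ x - φ (R x) else 0) = φ (R j) - φ root := by
      rw [← e2]
      refine Finset.sum_congr rfl fun x hx => ?_
      have hx' : x ≠ nx := by have := Finset.mem_Ico.1 hx; omega
      simp [hx']
    have hPn := hP nx
    rw [Function.update_self] at hPn
    rw [e1, e3]
    by_cases hXj : X j
    · rw [if_pos (hPn.2 hXj), hin j hj hXj, hR, hcom j hj hXj]; ring
    · rw [if_neg (fun h' => hXj (hPn.1 h')), hout j (by omega) (fun h' => hXj h'.2)]; ring
  · have hXX := hs nx hlo (by omega)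
    simp only [Function.update_self] at hXX
    by_cases hXj : X j
    · rw [hin j hj hXj, hin j' hj' (hXX.1 hXj)]
    · have hXj' := fun h' => hXj (hXX.2 h')
      rw [hout j (by omega) (fun h' => hXj h'.2), hout j' (by omega) (fun h' => hXj' h'.2)]
      refine h.same j hj j' hj' fun x hx hx' => ?_
      have := hs x hx (by omega)
      rwa [Function.update_of_ne (by omega)] at this
  · by_cases e : x = nx
    · rw [e, hR]; exact h.lt_edge j₀ hj₀
    · rw [hold x hx (by omega)]; exact h.lt x hx (by omega)
  · by_cases hXj : X j
    · rw [hin j hj hXj]; omega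
    · rw [hout j (by omega) (fun h' => hXj h'.2)]
      have := h.lt_edge j hj
      omega

/-- The arrays for one of the two sides. -/
def IsSide (V O sn R R' : Arr) : Prop :=
  (V = .ea ∧ O = .ep ∧ sn = .snA ∧ R = .src ∧ R' = .dst) ∨
    (V = .ep ∧ O = .ea ∧ sn = .snP ∧ R = .dst ∧ R' = .src)

/-- The parent of `nx` is written anew for each edge of the set, always with the entry that the edge
had before the pass. Nothing more is claimed here; that these entries agree is shown in
`IsForest.attach`. -/
theorem attach_spec {B m nx : ℕ} {V O sn R R' : Arr} (hs : IsSide V O sn R R') {σ : Store}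
    (hm : σ.v .m = m) (hnx : σ.v .nx = nx) (hlt : m ≤ nx)
    (hX : ∃ j < m, σ.a V j = σ.v .v ∧ σ.a .mark (σ.a O j) = nx) :
    (Alg.attach V O R R').Runs B σ (20 * (m + 1)) fun τ => τ.v .nx = nx + 1 ∧
      τ.a R' = Function.update (σ.a R') nx nx ∧
      (∃ j < m, (σ.a V j = σ.v .v ∧ σ.a .mark (σ.a O j) = nx) ∧ τ.a R nx = σ.a R j) ∧
      (∀ j < m, (σ.a V j = σ.v .v ∧ σ.a .mark (σ.a O j) = nx) → τ.a R j = nx) ∧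
      ∀ y, y ≠ nx → ¬ (y < m ∧ σ.a V y = σ.v .v ∧ σ.a .mark (σ.a O y) = nx) →
        τ.a R y = σ.a R y := by
  refine Runs.conseq (n := 1 + (1 + ((1 + m * (1 + (Alg.attachStep V O R).size)) + 1))) ?_ ?_
    fun _ _ h => h
  swap
  · simp [Alg.attachStep, size]
    ring_nf
    omega
  refine Runs.seq (runs_loopFree rfl (Runs.seq (runs_loopFree rfl ?_)))
  generalize hυ : (zero .j).eval B ((put R' .nx .nx).eval B σ) = υ
  have hR'0 : υ.a R' = Function.update (σ.a R') nx nx := by rw [← hυ]; simp [hnx]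
  have ha0 : ∀ r, r ≠ R' → υ.a r = σ.a r := by
    intro r hr; rw [← hυ]; simp [Function.update_of_ne hr]
  have hv0 : ∀ x, x ≠ Var.j → υ.v x = σ.v x := by
    intro r hr; rw [← hυ]; simp [Function.update_of_ne hr]
  have hj0 : υ.v .j = 0 := by rw [← hυ]; simp
  have nVR' : V ≠ R' := by rcases hs with ⟨rfl, rfl, rfl, rfl, rfl⟩ | ⟨rfl, rfl, rfl, rfl, rfl⟩ <;> decide
  have nOR' : O ≠ R' := by rcases hs with ⟨rfl, rfl, rfl, rfl, rfl⟩ | ⟨rfl, rfl, rfl, rfl, rfl⟩ <;> decide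
  have nMR' : Arr.mark ≠ R' := by rcases hs with ⟨rfl, rfl, rfl, rfl, rfl⟩ | ⟨rfl, rfl, rfl, rfl, rfl⟩ <;> decide
  have nRR' : R ≠ R' := by rcases hs with ⟨rfl, rfl, rfl, rfl, rfl⟩ | ⟨rfl, rfl, rfl, rfl, rfl⟩ <;> decide
  have nVR : V ≠ R := by rcases hs with ⟨rfl, rfl, rfl, rfl, rfl⟩ | ⟨rfl, rfl, rfl, rfl, rfl⟩ <;> decide
  have nOR : O ≠ R := by rcases hs with ⟨rfl, rfl, rfl, rfl, rfl⟩ | ⟨rfl, rfl, rfl, rfl, rfl⟩ <;> decide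
  have nMR : Arr.mark ≠ R := by rcases hs with ⟨rfl, rfl, rfl, rfl, rfl⟩ | ⟨rfl, rfl, rfl, rfl, rfl⟩ <;> decide
  have hum : υ.v .m = m := (hv0 _ (by decide)).trans hm
  refine Runs.seq (Runs.conseq (runs_loop (fun i τ => τ.v .j = i ∧
      ((∃ j < i, σ.a V j = σ.v .v ∧ σ.a .mark (σ.a O j) = nx) →
        ∃ j < m, (σ.a V j = σ.v .v ∧ σ.a .mark (σ.a O j) = nx) ∧ τ.a R nx = σ.a R j) ∧
      (∀ j < i, (σ.a V j = σ.v .v ∧ σ.a .mark (σ.a O j) = nx) → τ.a R j = nx) ∧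
      ∀ y, y ≠ nx → ¬ (y < i ∧ σ.a V y = σ.v .v ∧ σ.a .mark (σ.a O y) = nx) →
        τ.a R y = σ.a R y) (Alg.attachStep V O R).size ?_ ?_) (by rw [hum]) fun τ hf hI => ?_)
  · exact ⟨hj0, fun ⟨j, hj, _⟩ => by omega, by omega, fun y _ _ => by rw [ha0 R nRR']⟩
  · rintro i hi τ hf ⟨h1, h2, h3, h4⟩
    rw [hum] at hi
    refine runs_loopFree rfl ?_
    have eV : τ.a V = σ.a V := (hf.a _ (by simpa [Alg.attachStep, wa] using nVR)).trans (ha0 _ nVR')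
    have eO : τ.a O = σ.a O := (hf.a _ (by simpa [Alg.attachStep, wa] using nOR)).trans (ha0 _ nOR')
    have eM : τ.a .mark = σ.a .mark :=
      (hf.a _ (by simpa [Alg.attachStep, wa] using nMR)).trans (ha0 _ nMR')
    have ev : τ.v .v = σ.v .v := (hf.v _ (by simp [Alg.attachStep, wv])).trans (hv0 _ (by decide))
    have en : τ.v .nx = nx := ((hf.v _ (by simp [Alg.attachStep, wv])).trans (hv0 _ (by decide))).trans hnx
    by_cases c : σ.a V i = σ.v .v ∧ σ.a .mark (σ.a O i) = nx
    · have ej : ((Alg.attachStep V O R).eval B τ).v .j = i + 1 := by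
        simp [Alg.attachStep, h1, eV, eO, eM, ev, en, c.1, c.2]
      have eR : ((Alg.attachStep V O R).eval B τ).a R =
          Function.update (Function.update (τ.a R) nx (τ.a R i)) i nx := by
        simp [Alg.attachStep, h1, eV, eO, eM, ev, en, c.1, c.2]
      have eRi : τ.a R i = σ.a R i := h4 i (by omega) (fun h => by omega)
      rw [ej, eR]
      refine ⟨rfl, fun _ => ⟨i, hi, c, ?_⟩, fun j hj hc => ?_, fun y hy hc => ?_⟩
      · rw [Function.update_of_ne (by omega), Function.update_self, eRi]
      · by_cases e : j = i
        · rw [e, Function.update_self]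
        · rw [Function.update_of_ne e, Function.update_of_ne (by omega)]
          exact h3 j (by omega) hc
      · have : y ≠ i := by rintro rfl; exact hc ⟨by omega, c⟩
        rw [Function.update_of_ne this, Function.update_of_ne hy]
        exact h4 y hy fun h => hc ⟨by omega, h.2⟩
    · obtain ⟨ej, eR⟩ : ((Alg.attachStep V O R).eval B τ).v .j = i + 1 ∧
          ((Alg.attachStep V O R).eval B τ).a R = τ.a R := by
        by_cases c1 : σ.a V i = σ.v .v
        · have c2 : σ.a .mark (σ.a O i) ≠ nx := fun h => c ⟨c1, h⟩
          simp [Alg.attachStep, h1, eV, eO, eM, ev, en, c1, c2]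
        · simp [Alg.attachStep, h1, eV, ev, c1]
      rw [ej, eR]
      refine ⟨rfl, fun ⟨j, hj, hc⟩ => ?_, fun j hj hc => ?_, fun y hy hc => ?_⟩
      · have : j ≠ i := by rintro rfl; exact c hc
        exact h2 ⟨j, by omega, hc⟩
      · have : j ≠ i := by rintro rfl; exact c hc
        exact h3 j (by omega) hc
      · exact h4 y hy fun h => hc ⟨by omega, h.2⟩
  · rw [hum] at hI
    obtain ⟨-, h2, h3, h4⟩ := hI
    have en : τ.v .nx = nx := ((hf.v _ (by simp [Alg.attachStep, wv])).trans (hv0 _ (by decide))).trans hnx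
    have eR' : τ.a R' = υ.a R' := hf.a _ (by
      simpa [Alg.attachStep, wa] using nRR'.symm)
    exact runs_loopFree rfl ⟨by simp [en], by simpa [hR'0] using eR', h2 hX, h3, h4⟩

end CRMM
-- The data of the vertices, the roots of the trees, and the table of classes.
namespace CRMM

open Cmd

attribute [local simp] eval Store.setV Store.setA Store.setL

/-- What the vertices of one side specify: their quotas, the number of their classes, and the position
in the memory, the quota, and the elements of each class. -/
structure Lists where
  q : ℕ → ℕ
  nc : ℕ → ℕ
  pos : ℕ → ℕ → ℕ
  cq : ℕ → ℕ → ℕ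
  cls : ℕ → ℕ → Finset ℕ

/-- The number of edges at the vertex `v`. -/
def deg (m : ℕ) (V : ℕ → ℕ) (v : ℕ) : ℕ := ((Finset.range m).filter fun j => V j = v).card

/-- The data of the vertices that have edges are found in the memory `l`; the table of pointers starts
at `base`. The edge `j` joins the vertex `V j` of this side and the vertex `O j`. -/
structure Lists.Valid (L : Lists) (B m base : ℕ) (l V O : ℕ → ℕ) : Prop where
  table_lt : ∀ j < m, base + V j < B
  ptr_lt : ∀ j < m, l (base + V j) + 1 < B
  q : ∀ j < m, l (l (base + V j)) = L.q (V j)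
  nc : ∀ j < m, l (l (base + V j) + 1) = L.nc (V j)
  nc_le : ∀ j < m, L.nc (V j) ≤ 2 * deg m V (V j) + 1
  nc_lt : ∀ j < m, L.nc (V j) ≤ B
  pos_zero : ∀ j < m, L.pos (V j) 0 = l (base + V j) + 2
  pos_succ : ∀ j < m, ∀ t < L.nc (V j),
    L.pos (V j) (t + 1) = L.pos (V j) t + 2 + (L.cls (V j) t).card
  pos_le : ∀ j < m, ∀ t ≤ L.nc (V j), L.pos (V j) t ≤ B
  cq : ∀ j < m, ∀ t < L.nc (V j), l (L.pos (V j) t) = L.cq (V j) t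
  card : ∀ j < m, ∀ t < L.nc (V j), l (L.pos (V j) t + 1) = (L.cls (V j) t).card
  elems : ∀ j < m, ∀ t < L.nc (V j), L.cls (V j) t =
    (Finset.range (L.cls (V j) t).card).image fun i => l (L.pos (V j) t + 2 + i)
  elem_le : ∀ j < m, ∀ t < L.nc (V j), ∀ p ∈ L.cls (V j) t, p ≤ B
  nbr : ∀ j < m, ∀ t < L.nc (V j), ∀ p ∈ L.cls (V j) t, ∃ j' < m, V j' = V j ∧ O j' = p
  laminar : ∀ j < m, ∀ t < L.nc (V j), ∀ t' < L.nc (V j),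
    L.cls (V j) t ⊆ L.cls (V j) t' ∨ L.cls (V j) t' ⊆ L.cls (V j) t ∨
      Disjoint (L.cls (V j) t) (L.cls (V j) t')

/-- The nodes from `lo` on have been built, starting from the state `σ`. -/
structure TreeState (m lo root : ℕ) (R R' : Arr) (σ : Store) (S : ℕ → ℕ → Prop) (τ : Store) :
    Prop where
  forest : IsForest m lo (τ.v .nx) root (τ.a R) S
  lo_le : lo ≤ τ.v .nx
  self : ∀ x, lo ≤ x → x < τ.v .nx → τ.a R' x = x
  res : ∀ y, y < lo ∨ τ.v .nx ≤ y → τ.a .res y = σ.a .res y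
  R : ∀ y, m ≤ y → y < lo ∨ τ.v .nx ≤ y → τ.a R y = σ.a R y
  R' : ∀ y, y < lo ∨ τ.v .nx ≤ y → τ.a R' y = σ.a R' y

/-- The effect of the program `attach` meets the combinatorial `IsForest.attach`. The only condition
on the new set is that each earlier node contains it or is disjoint from it. -/
theorem TreeState.insert {B m lo root q : ℕ} {V O sn R R' : Arr} (hs : IsSide V O sn R R')
    {σ τ υ : Store} {S : ℕ → ℕ → Prop} {X : ℕ → Prop}
    (h : TreeState m lo root R R' σ S τ) (hlo : m ≤ lo)
    (hm : υ.v .m = m) (hnx : υ.v .nx = τ.v .nx) (hR : υ.a R = τ.a R) (hR' : υ.a R' = τ.a R')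
    (hres : υ.a .res = Function.update (τ.a .res) (τ.v .nx) q)
    (hX : ∀ j < m, X j ↔ (υ.a V j = υ.v .v ∧ υ.a .mark (υ.a O j) = τ.v .nx)) (hne : ∃ j < m, X j)
    (hlam : ∀ x, lo ≤ x → x < τ.v .nx → (∀ j < m, X j → S x j) ∨ ∀ j < m, X j → ¬ S x j) :
    (Alg.attach V O R R').Runs B υ (20 * (m + 1)) fun ω =>
      TreeState m lo root R R' σ (Function.update S (τ.v .nx) X) ω ∧ ω.v .nx = τ.v .nx + 1 ∧
      ω.a .res = Function.update (τ.a .res) (τ.v .nx) q := by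
  have hle := h.lo_le
  have nR : Arr.res ≠ R := by
    rcases hs with ⟨rfl, rfl, rfl, rfl, rfl⟩ | ⟨rfl, rfl, rfl, rfl, rfl⟩ <;> decide
  have nR' : Arr.res ≠ R' := by
    rcases hs with ⟨rfl, rfl, rfl, rfl, rfl⟩ | ⟨rfl, rfl, rfl, rfl, rfl⟩ <;> decide
  obtain ⟨j, hj, hXj⟩ := hne
  refine (attach_spec hs hm hnx (by omega) ⟨j, hj, (hX j hj).1 hXj⟩).conseq le_rfl
    fun ω hf hQ => ?_
  obtain ⟨q1, q2, ⟨j', hj', hXj', q3⟩, q4, q5⟩ := hQ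
  have er : ω.a .res = υ.a .res := hf.a _ (by simp [Alg.attach, Alg.attachStep, wa, nR, nR'])
  rw [hR] at q3 q5
  rw [hR'] at q2
  refine ⟨⟨?_, by omega, fun x hx hx' => ?_, fun y hy => ?_, fun y hy hy' => ?_, fun y hy => ?_⟩,
    q1, er.trans hres⟩
  · rw [q1]
    refine h.forest.attach hlo hle hlam ⟨j', hj', (hX j' hj').2 hXj', q3⟩
      (fun j hj hXj => q4 j hj ((hX j hj).1 hXj)) fun y hy hn => q5 y hy fun hc =>
        hn ⟨hc.1, (hX y hc.1).2 hc.2⟩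
  · rw [q2]
    by_cases e : x = τ.v .nx
    · rw [e, Function.update_self]
    · rw [Function.update_of_ne e, h.self x hx (by omega)]
  · rw [er, hres, Function.update_of_ne (by omega)]
    exact h.res y (by omega)
  · rw [q5 y (by omega) (fun hc => by omega)]
    exact h.R y hy (by omega)
  · rw [q2, Function.update_of_ne (by omega)]
    exact h.R' y (by omega)

/-- The entry `c` of the table of classes describes the class `t` of the vertex `v`. -/
def Lists.Entry (L : Lists) (B : ℕ) (τ : Store) (c v t : ℕ) : Prop :=
  τ.a .cv c = v ∧ τ.a .cq c = min (L.cq v t) B ∧ τ.a .csz c = (L.cls v t).card ∧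
    τ.a .cptr c = L.pos v t + 2

/-- The vertices of the first `i` edges have been treated. -/
structure RootInv (L : Lists) (B m lo root : ℕ) (V O : ℕ → ℕ) (sn R R' : Arr) (σ : Store)
    (i : ℕ) (S : ℕ → ℕ → Prop) (τ : Store) : Prop where
  idx : τ.v .i = i
  tree : TreeState m lo root R R' σ S τ
  nx_le : τ.v .nx ≤ lo + i
  seen : ∀ j < i, τ.a sn (V j) = 1
  unseen : ∀ v, (∀ j < i, V j ≠ v) → τ.a sn v = 0
  mark : ∀ y, τ.a .mark y < τ.v .nx
  desc : ∀ x, lo ≤ x → x < τ.v .nx → ∃ j₀ < i, (∀ j < m, S x j ↔ V j = V j₀) ∧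
    τ.a .res x = min (L.q (V j₀)) B
  roots : ∀ j₀ < i, ∃ x, lo ≤ x ∧ x < τ.v .nx ∧ ∀ j < m, S x j ↔ V j = V j₀
  entry : ∀ c < τ.v .kc, ∃ j₀ < m, ∃ t < L.nc (V j₀), L.Entry B τ c (V j₀) t
  entries : ∀ j₀ < i, ∀ t < L.nc (V j₀), ∃ c < τ.v .kc, L.Entry B τ c (V j₀) t
  kc_le : τ.v .kc ≤ ∑ v ∈ (Finset.range i).image V, L.nc v

theorem deg_le (m : ℕ) (V : ℕ → ℕ) (v : ℕ) : deg m V v ≤ m :=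
  (Finset.card_filter_le _ _).trans (by simp)

/-- No earlier edge lies at this vertex, so no node built so far is above any of its edges. Marks
are node numbers below `nx`, so old marks never have to be erased. The classes are only recorded,
since they have to be sorted before insertion. -/
theorem newVertex_spec {L : Lists} {B m lo root i : ℕ} {V O sn R R' : Arr}
    (hs : IsSide V O sn R R') {σ τ : Store} {S : ℕ → ℕ → Prop}
    (hv : L.Valid B m (τ.v .base) τ.l (τ.a V) (τ.a O)) (hlo : m + 2 ≤ lo) (hi : i < m)
    (h : RootInv L B m lo root (τ.a V) (τ.a O) sn R R' σ i S τ)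
    (hm : τ.v .m = m) (h1 : τ.v .one = 1) (hvv : τ.v .v = τ.a V i)
    (hnew : ∀ j < i, τ.a V j ≠ τ.a V i) :
    (Alg.newVertex V O sn R R' ;; succ .i).Runs B τ (100 * (m + 1)) fun ω =>
      ∃ S', RootInv L B m lo root (τ.a V) (τ.a O) sn R R' σ (i + 1) S' ω := by
  set Vf := τ.a V with hVf
  set Of := τ.a O with hOf
  have hnc := hv.nc_le i hi
  have hdeg := deg_le m Vf (Vf i)
  have hk := h.tree.lo_le
  refine Runs.conseq (n := (1 + (1 + (1 + (1 + (1 + (1 + ((1 + m * (1 + (Alg.markStep V O).size)) +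
    (20 * (m + 1) + (1 + (1 + (1 + (1 + L.nc (Vf i) * (1 + Alg.classStep.size))))))))))))) + 1)
    ?_ ?_ fun _ _ h => h
  swap
  · simp [Alg.markStep, Alg.classStep, size]
    nlinarith
  have nV : V ≠ sn ∧ V ≠ .mark ∧ V ≠ .res ∧ V ≠ R ∧ V ≠ R' ∧ V ∉ [Arr.cq, .csz, .cptr, .cv] := by
    rcases hs with ⟨rfl, rfl, rfl, rfl, rfl⟩ | ⟨rfl, rfl, rfl, rfl, rfl⟩ <;> decide
  have nO : O ≠ sn ∧ O ≠ .mark ∧ O ≠ .res ∧ O ≠ R ∧ O ≠ R' ∧ O ∉ [Arr.cq, .csz, .cptr, .cv] := by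
    rcases hs with ⟨rfl, rfl, rfl, rfl, rfl⟩ | ⟨rfl, rfl, rfl, rfl, rfl⟩ <;> decide
  have nR : R ≠ sn ∧ R ≠ .mark ∧ R ≠ .res ∧ R ∉ [Arr.cq, .csz, .cptr, .cv] := by
    rcases hs with ⟨rfl, rfl, rfl, rfl, rfl⟩ | ⟨rfl, rfl, rfl, rfl, rfl⟩ <;> decide
  have nR' : R' ≠ sn ∧ R' ≠ .mark ∧ R' ≠ .res ∧ R' ∉ [Arr.cq, .csz, .cptr, .cv] := by
    rcases hs with ⟨rfl, rfl, rfl, rfl, rfl⟩ | ⟨rfl, rfl, rfl, rfl, rfl⟩ <;> decide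
  have nS : sn ≠ .mark ∧ sn ≠ .res ∧ sn ∉ [Arr.cq, .csz, .cptr, .cv] := by
    rcases hs with ⟨rfl, rfl, rfl, rfl, rfl⟩ | ⟨rfl, rfl, rfl, rfl, rfl⟩ <;> decide
  simp only [List.mem_cons, List.not_mem_nil, or_false, not_or] at nV nO nR nR' nS
  refine Runs.seq ?_
  unfold Alg.newVertex
  -- the block of the vertex is found and its quota is read
  refine Runs.seq (runs_loopFree rfl ?_)
  refine Runs.seq (runs_loopFree rfl ?_)
  refine Runs.seq (runs_loopFree rfl ?_)
  refine Runs.seq (runs_loopFree rfl ?_)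
  refine Runs.seq (runs_loopFree rfl ?_)
  refine Runs.seq (runs_loopFree rfl ?_)
  generalize hυ : (zero .j).eval B _ = υ
  have t1 := hv.table_lt i hi
  have t2 := hv.ptr_lt i hi
  have uv : ∀ x, x ≠ Var.bp → x ≠ .y → x ≠ .j → υ.v x = τ.v x := by
    intro x x1 x2 x3; rw [← hυ]; simp [Function.update_of_ne x1, Function.update_of_ne x2,
      Function.update_of_ne x3]
  have ubp : υ.v .bp = τ.l (τ.v .base + Vf i) := by
    rw [← hυ]
    have : min (τ.v .base + Vf i) B = τ.v .base + Vf i := min_eq_left t1.le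
    simp only [eval, Store.setV, Store.setA, hvv, this]
    simp [t1]
    omega
  have uj : υ.v .j = 0 := by rw [← hυ]; simp
  have ua : ∀ r, r ≠ sn → r ≠ .res → υ.a r = τ.a r := by
    intro r r1 r2; rw [← hυ]; simp [Function.update_of_ne r1, Function.update_of_ne r2]
  have ul : υ.l = τ.l := by rw [← hυ]; simp
  have usn : υ.a sn = Function.update (τ.a sn) (Vf i) 1 := by
    rw [← hυ]; simp [Function.update_of_ne nS.2.1, hvv, h1]
  have ures : υ.a .res = Function.update (τ.a .res) (τ.v .nx) (min (L.q (Vf i)) B) := by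
    rw [← hυ, ← hv.q i hi]
    have e1 : min (τ.v .base + Vf i) B = τ.v .base + Vf i := min_eq_left t1.le
    have e2 : min (τ.l (τ.v .base + Vf i)) B = τ.l (τ.v .base + Vf i) :=
      min_eq_left (by omega)
    have e3 : τ.l (τ.v .base + Vf i) < B := by omega
    simp [hvv, t1, e1, e2, e3, Function.update_of_ne nS.2.1.symm]
  clear hυ
  -- the other ends of its edges are marked
  have um : υ.v .m = m := (uv _ (by decide) (by decide) (by decide)).trans hm
  refine Runs.seq (Runs.conseq (runs_loop (fun t ω => ω.v .j = t ∧
      (∀ j < t, Vf j = Vf i → ω.a .mark (Of j) = τ.v .nx) ∧ ∀ y, ω.a .mark y ≤ τ.v .nx)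
      (Alg.markStep V O).size ⟨uj, by omega, fun y => by
        rw [ua _ nS.1.symm (by decide)]; exact (h.mark y).le⟩ ?_) (by rw [um]) fun ω hf hI => ?_)
  · rintro t ht ω hf ⟨w1, w2, w3⟩
    rw [um] at ht
    refine runs_loopFree rfl ?_
    have eV : ω.a V = Vf := (hf.a _ (by simp [Alg.markStep, wa, nV])).trans
      (ua _ nV.1 nV.2.2.1)
    have eO : ω.a O = Of := (hf.a _ (by simp [Alg.markStep, wa, nO])).trans
      (ua _ nO.1 nO.2.2.1)
    have ev : ω.v .v = Vf i := ((hf.v _ (by simp [Alg.markStep, wv])).trans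
      (uv _ (by decide) (by decide) (by decide))).trans hvv
    have en : ω.v .nx = τ.v .nx := (hf.v _ (by simp [Alg.markStep, wv])).trans
      (uv _ (by decide) (by decide) (by decide))
    by_cases c : Vf t = Vf i
    · have e1 : ((Alg.markStep V O).eval B ω).v .j = t + 1 := by
        simp [Alg.markStep, w1, eV, eO, ev, c]
      have e2 : ((Alg.markStep V O).eval B ω).a .mark =
          Function.update (ω.a .mark) (Of t) (τ.v .nx) := by
        simp [Alg.markStep, w1, eV, eO, ev, c, en]
      rw [e1, e2]
      refine ⟨rfl, fun j hj hc => ?_, fun y => ?_⟩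
      · by_cases e : Of j = Of t
        · rw [e, Function.update_self]
        · rw [Function.update_of_ne e]
          exact w2 j (by rcases Nat.lt_or_ge j t with h | h; exact h; exact absurd (by
            rw [show j = t by omega]) e) hc
      · by_cases e : y = Of t
        · rw [e, Function.update_self]
        · rw [Function.update_of_ne e]; exact w3 y
    · have e1 : ((Alg.markStep V O).eval B ω).v .j = t + 1 := by
        simp [Alg.markStep, w1, eV, ev, c]
      have e2 : ((Alg.markStep V O).eval B ω).a .mark = ω.a .mark := by
        simp [Alg.markStep, w1, eV, ev, c]
      rw [e1, e2]
      refine ⟨rfl, fun j hj hc => w2 j ?_ hc, w3⟩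
      have : j ≠ t := by rintro rfl; exact c hc
      omega
  rw [um] at hI
  obtain ⟨-, w2, w3⟩ := hI
  have wvv : ∀ x, x ≠ Var.bp → x ≠ .y → x ≠ .j → ω.v x = τ.v x := fun x x1 x2 x3 =>
    (hf.v _ (by simp [Alg.markStep, wv, x2, x3])).trans (uv x x1 x2 x3)
  have wbp : ω.v .bp = τ.l (τ.v .base + Vf i) := (hf.v _ (by simp [Alg.markStep, wv])).trans ubp
  have wl : ω.l = τ.l := (hf.l rfl).trans ul
  have wa' : ∀ r, r ≠ sn → r ≠ .res → r ≠ .mark → ω.a r = τ.a r := fun r r1 r2 r3 =>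
    (hf.a _ (by simp [Alg.markStep, wa, r3])).trans (ua r r1 r2)
  have wsn : ω.a sn = Function.update (τ.a sn) (Vf i) 1 :=
    (hf.a _ (by simp [Alg.markStep, wa, nS])).trans usn
  have wres : ω.a .res = Function.update (τ.a .res) (τ.v .nx) (min (L.q (Vf i)) B) :=
    (hf.a _ (by simp [Alg.markStep, wa])).trans ures
  clear hf uv ua ul um usn ures ubp uj υ
  -- the root is inserted
  refine Runs.seq (Runs.conseq (h.tree.insert hs (X := fun j => Vf j = Vf i) (by omega)
    ((wvv _ (by decide) (by decide) (by decide)).trans hm)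
    (wvv _ (by decide) (by decide) (by decide)) (wa' _ nR.1 nR.2.2.1 nR.2.1)
    (wa' _ nR'.1 nR'.2.2.1 nR'.2.1) wres (fun j hj => ?_) ⟨i, hi, rfl⟩ fun x hx hx' => ?_)
    le_rfl fun υ hf hQ => ?_)
  · rw [wa' _ nV.1 nV.2.2.1 nV.2.1, wa' _ nO.1 nO.2.2.1 nO.2.1,
      wvv _ (by decide) (by decide) (by decide), hvv]
    exact ⟨fun e => ⟨e, w2 j hj e⟩, fun e => e.1⟩
  · obtain ⟨j₀, hj₀, e1, -⟩ := h.desc x hx hx'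
    refine .inr fun j hj e2 e3 => hnew j₀ hj₀ ?_
    rw [← (e1 j hj).1 e3]
    exact e2
  obtain ⟨q1, q2, q3⟩ := hQ
  have uv : ∀ x, x ≠ Var.bp → x ≠ .y → x ≠ .j → x ≠ .nx → υ.v x = τ.v x := fun x x1 x2 x3 x4 =>
    (hf.v _ (by simp [Alg.attach, Alg.attachStep, wv, x2, x3, x4])).trans (wvv x x1 x2 x3)
  have ubp : υ.v .bp = τ.l (τ.v .base + Vf i) :=
    (hf.v _ (by simp [Alg.attach, Alg.attachStep, wv])).trans wbp
  have ul : υ.l = τ.l := (hf.l rfl).trans wl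
  have ua : ∀ r, r ≠ sn → r ≠ .res → r ≠ .mark → r ≠ R → r ≠ R' → υ.a r = τ.a r :=
    fun r r1 r2 r3 r4 r5 =>
    (hf.a _ (by simp [Alg.attach, Alg.attachStep, wa, r4, r5])).trans (wa' r r1 r2 r3)
  have usn : υ.a sn = Function.update (τ.a sn) (Vf i) 1 :=
    (hf.a _ (by simp [Alg.attach, Alg.attachStep, wa, nR.1.symm, nR'.1.symm])).trans wsn
  have umark : υ.a .mark = ω.a .mark :=
    hf.a _ (by simp [Alg.attach, Alg.attachStep, wa, nR.2.1.symm, nR'.2.1.symm])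
  rw [← umark] at w3
  clear hf wvv wbp wl wa' wsn wres w2 umark ω
  -- the classes are entered into the table
  refine Runs.seq (runs_loopFree rfl ?_)
  refine Runs.seq (runs_loopFree rfl ?_)
  refine Runs.seq (runs_loopFree rfl ?_)
  generalize hω : (succ .bp).eval B _ = ω
  have wnc : ω.v .nc = L.nc (Vf i) := by
    rw [← hω, ← hv.nc i hi]
    have := hv.nc_lt i hi
    rw [← hv.nc i hi] at this
    simp [ubp, t2, ul, this]
  have wbp : ω.v .bp = L.pos (Vf i) 0 := by
    rw [← hω, hv.pos_zero i hi]; simp [ubp]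
  have wv' : ∀ x, x ≠ Var.bp → x ≠ .nc → ω.v x = υ.v x := by
    intro x x1 x2; rw [← hω]; simp [Function.update_of_ne x1, Function.update_of_ne x2]
  have wa' : ω.a = υ.a := by rw [← hω]; simp
  have wl : ω.l = τ.l := by rw [← hω]; simpa using ul
  clear hω
  refine (runs_loop (fun t χ => χ.v .kc = τ.v .kc + t ∧ χ.v .bp = L.pos (Vf i) t ∧
      (∀ c < τ.v .kc, ∀ r ∈ [Arr.cq, .csz, .cptr, .cv], χ.a r c = τ.a r c) ∧
      ∀ t' < t, L.Entry B χ (τ.v .kc + t') (Vf i) t') Alg.classStep.size ?_ ?_).conseq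
      (by rw [wnc]) fun χ hf hI => ?_
  · refine ⟨?_, wbp, fun c _ r hr => ?_, by omega⟩
    · rw [wv' _ (by decide) (by decide), uv _ (by decide) (by decide) (by decide) (by decide)]; simp
    · rw [wa', ua r]
      · rintro rfl; exact nS.2.2 |> fun h => by simp_all
      · rintro rfl; simp at hr
      · rintro rfl; simp at hr
      · rintro rfl; simp_all
      · rintro rfl; simp_all
  · rintro t ht χ hf ⟨c1, c2, c3, c4⟩
    rw [wnc] at ht
    refine runs_loopFree rfl ?_
    have el : χ.l = τ.l := (hf.l rfl).trans wl
    have ev : χ.v .v = Vf i := by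
      rw [hf.v _ (by decide), wv' _ (by decide) (by decide),
        uv _ (by decide) (by decide) (by decide) (by decide), hvv]
    have p1 := hv.pos_succ i hi t ht
    have p2 := hv.pos_le i hi (t + 1) (by omega)
    have p3 := hv.cq i hi t ht
    have p4 := hv.card i hi t ht
    have g1 : L.pos (Vf i) t < B := by omega
    have g2 : L.pos (Vf i) t + 1 < B := by omega
    have g3 : min (L.cls (Vf i) t).card B = (L.cls (Vf i) t).card := min_eq_left (by omega)
    have g4 : min (L.pos (Vf i) t + 1 + 1 + (L.cls (Vf i) t).card) B =
      L.pos (Vf i) t + 1 + 1 + (L.cls (Vf i) t).card := min_eq_left (by omega)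
    have a1 : (Alg.classStep.eval B χ).v .kc = τ.v .kc + t + 1 := by
      simp [Alg.classStep, c1]
    have a2 : (Alg.classStep.eval B χ).v .bp = L.pos (Vf i) (t + 1) := by
      simp only [Alg.classStep, eval, Store.setV, Store.setA]
      simp [c2, el, p4, g2, g3, g4]
      omega
    have a3 : (Alg.classStep.eval B χ).a .cq =
        Function.update (χ.a .cq) (τ.v .kc + t) (min (L.cq (Vf i) t) B) := by
      simp [Alg.classStep, c1, c2, el, p3, g1]
    have a4 : (Alg.classStep.eval B χ).a .csz =
        Function.update (χ.a .csz) (τ.v .kc + t) (L.cls (Vf i) t).card := by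
      simp [Alg.classStep, c1, c2, el, p4, g2, g3]
    have a5 : (Alg.classStep.eval B χ).a .cptr =
        Function.update (χ.a .cptr) (τ.v .kc + t) (L.pos (Vf i) t + 2) := by
      simp [Alg.classStep, c1, c2]
    have a6 : (Alg.classStep.eval B χ).a .cv =
        Function.update (χ.a .cv) (τ.v .kc + t) (Vf i) := by
      simp [Alg.classStep, c1, ev]
    refine ⟨by rw [a1]; omega, a2, fun c hc r hr => ?_, fun t' ht' => ?_⟩
    · rw [← c3 c hc r hr]
      have : c ≠ τ.v .kc + t := by omega
      simp only [List.mem_cons, List.not_mem_nil, or_false] at hr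
      rcases hr with rfl | rfl | rfl | rfl
      · rw [a3, Function.update_of_ne this]
      · rw [a4, Function.update_of_ne this]
      · rw [a5, Function.update_of_ne this]
      · rw [a6, Function.update_of_ne this]
    · unfold Lists.Entry
      rw [a3, a4, a5, a6]
      by_cases e : t' = t
      · subst e; simp
      · have : τ.v .kc + t' ≠ τ.v .kc + t := by omega
        simp only [Function.update_of_ne this]
        exact c4 t' (by omega)
  rw [wnc] at hI
  obtain ⟨c1, c2, c3, c4⟩ := hI
  refine runs_loopFree rfl ?_
  have fv : ∀ x ∈ [Var.nx, .i], χ.v x = υ.v x := by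
    intro x hx
    simp only [List.mem_cons, List.not_mem_nil, or_false] at hx
    rw [hf.v, wv']
    all_goals rcases hx with rfl | rfl <;> decide
  have fnx := fv .nx (by simp)
  have fi := fv .i (by simp)
  have fa : ∀ r, r ∉ [Arr.cq, .csz, .cptr, .cv] → χ.a r = υ.a r := by
    intro r hr
    rw [hf.a, wa']
    intro h'
    simp only [Alg.classStep, wa, List.nil_append, List.append_nil, List.cons_append,
      List.mem_cons, List.not_mem_nil, or_false] at h'
    simp only [List.mem_cons, List.not_mem_nil, or_false] at hr
    tauto
  have fR := fa R (by simp [nR])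
  have fR' := fa R' (by simp [nR'])
  have fS := fa sn (by simp [nS])
  have fM := fa .mark (by decide)
  have fres := fa .res (by decide)
  have ui : υ.v .i = i := (uv _ (by decide) (by decide) (by decide) (by decide)).trans h.idx
  have hent : ∀ c < τ.v .kc, ∀ v t, L.Entry B τ c v t → L.Entry B χ c v t := by
    intro c hc v t he
    unfold Lists.Entry at he ⊢
    rwa [c3 c hc .cq (by simp), c3 c hc .csz (by simp), c3 c hc .cptr (by simp),
      c3 c hc .cv (by simp)]
  have hnl := h.nx_le
  refine ⟨Function.update S (τ.v .nx) fun j => Vf j = Vf i, by simp [fi, ui], ?_, ?_, ?_, ?_, ?_, ?_,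
    ?_, ?_, ?_, ?_⟩
  · obtain ⟨f1, f2, f3, f4, f5, f6⟩ := q1
    constructor <;> simp [fnx, fR, fR', fres]
    exacts [f1, f2, f3, f4, f5, f6]
  · simp [fnx, q2]; omega
  · intro j hj
    simp only [eval, Store.setV, fS, usn]
    by_cases e : Vf j = Vf i
    · rw [e, Function.update_self]
    · rw [Function.update_of_ne e]
      refine h.seen j ?_
      have : j ≠ i := by rintro rfl; exact e rfl
      omega
  · intro v hv'
    simp only [eval, Store.setV, fS, usn]
    rw [Function.update_of_ne (hv' i (by omega)).symm]
    exact h.unseen v fun j hj => hv' j (by omega)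
  · intro y
    simp [fM, fnx, q2]
    have := w3 y
    omega
  · intro x hx hx'
    simp [fnx, q2] at hx'
    simp only [eval, Store.setV, fres, q3]
    by_cases e : x = τ.v .nx
    · rw [e, Function.update_self, Function.update_self]
      exact ⟨i, by omega, fun j _ => Iff.rfl, rfl⟩
    · rw [Function.update_of_ne e, Function.update_of_ne e]
      obtain ⟨j₀, hj₀, h2, h3⟩ := h.desc x hx (by omega)
      exact ⟨j₀, by omega, h2, h3⟩
  · intro j₀ hj₀
    by_cases e : j₀ = i
    · exact ⟨τ.v .nx, hk, by simp [fnx, q2], fun j _ => by rw [Function.update_self, e]⟩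
    · obtain ⟨x, x1, x2, x3⟩ := h.roots j₀ (by omega)
      exact ⟨x, x1, by simp [fnx, q2]; omega, fun j hj => by
        rw [Function.update_of_ne (by omega)]; exact x3 j hj⟩
  · intro c hc
    simp [c1] at hc
    rcases Nat.lt_or_ge c (τ.v .kc) with hlt | hge
    · obtain ⟨j₀, hj₀, t, ht, he⟩ := h.entry c hlt
      exact ⟨j₀, hj₀, t, ht, hent c hlt _ _ he⟩
    · obtain ⟨t, rfl⟩ := Nat.exists_eq_add_of_le hge
      exact ⟨i, hi, t, by omega, c4 t (by omega)⟩
  · intro j₀ hj₀ t ht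
    by_cases e : j₀ = i
    · rw [e] at ht ⊢
      exact ⟨τ.v .kc + t, by simp [c1]; omega, c4 t ht⟩
    · obtain ⟨c, hc, he⟩ := h.entries j₀ (by omega) t ht
      exact ⟨c, by simp [c1]; omega, hent c hc _ _ he⟩
  · rw [Finset.range_add_one, Finset.image_insert, Finset.sum_insert]
    · have := h.kc_le
      simp [c1]
      omega
    · intro hmem
      obtain ⟨j, hj, e⟩ := Finset.mem_image.1 hmem
      exact hnew j (Finset.mem_range.1 hj) e

end CRMM
-- The loop over the edges that creates the roots, and sorting.
namespace CRMM

open Cmd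

attribute [local simp] eval Store.setV Store.setA Store.setL

/-- The continuation goes into both branches, so that a conditional and the increment of the index
after it can be treated as one unit. -/
theorem Cmd.runs_iflt_seq {B : ℕ} {p q r : Cmd} {σ : Store} {n : ℕ} {Q : Store → Prop} {x y : Var}
    (hp : σ.v x < σ.v y → (p ;; r).Runs B σ n Q)
    (hq : ¬ σ.v x < σ.v y → (q ;; r).Runs B σ n Q) :
    (iflt x y p q ;; r).Runs B σ (1 + n) Q := by
  by_cases h : σ.v x < σ.v y
  · have := hp h
    simp only [Runs, cost, eval, h, if_true] at this ⊢
    exact ⟨by omega, this.2⟩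
  · have := hq h
    simp only [Runs, cost, eval, h, if_false] at this ⊢
    exact ⟨by omega, this.2⟩

theorem TreeState.congr {m lo root : ℕ} {R R' : Arr} {σ : Store} {S : ℕ → ℕ → Prop} {τ τ' : Store}
    (h : TreeState m lo root R R' σ S τ) (hnx : τ'.v .nx = τ.v .nx) (hR : τ'.a R = τ.a R)
    (hR' : τ'.a R' = τ.a R') (hres : τ'.a .res = τ.a .res) :
    TreeState m lo root R R' σ S τ' := by
  obtain ⟨h1, h2, h3, h4, h5, h6⟩ := h
  constructor <;> simp only [hnx, hR, hR', hres] <;> assumption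

theorem RootInv.congr {L : Lists} {B m lo root : ℕ} {V O : ℕ → ℕ} {sn R R' : Arr} {σ : Store}
    {i : ℕ} {S : ℕ → ℕ → Prop} {τ τ' : Store} (h : RootInv L B m lo root V O sn R R' σ i S τ)
    (ha : τ'.a = τ.a) (hnx : τ'.v .nx = τ.v .nx) (hi : τ'.v .i = τ.v .i)
    (hkc : τ'.v .kc = τ.v .kc) : RootInv L B m lo root V O sn R R' σ i S τ' := by
  have he : ∀ c v t, L.Entry B τ' c v t ↔ L.Entry B τ c v t := by
    intro c v t; unfold Lists.Entry; rw [ha]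
  obtain ⟨h1, h2, h3, h4, h5, h6, h7, h8, h9, h10, h11⟩ := h
  refine ⟨by rw [hi, h1], h2.congr hnx (by rw [ha]) (by rw [ha]) (by rw [ha]), ?_, ?_, ?_, ?_, ?_, ?_,
    ?_, ?_, ?_⟩ <;> simp only [hnx, hkc, ha, he] <;> assumption

theorem roots_spec {L : Lists} {B m lo root : ℕ} {V O sn R R' : Arr} (hs : IsSide V O sn R R')
    {σ : Store} (hv : L.Valid B m (σ.v .base) σ.l (σ.a V) (σ.a O)) (hlo : m + 2 ≤ lo)
    (hm : σ.v .m = m) (h1 : σ.v .one = 1)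
    (h0 : RootInv L B m lo root (σ.a V) (σ.a O) sn R R' σ 0 (fun _ _ => False) σ) :
    (loop .m (Alg.rootStep V O sn R R')).Runs B σ (1 + m * (1 + 110 * (m + 1))) fun τ =>
      ∃ S, RootInv L B m lo root (σ.a V) (σ.a O) sn R R' σ m S τ := by
  have nVO : V ∉ (Alg.rootStep V O sn R R').wa ∧ O ∉ (Alg.rootStep V O sn R R').wa := by
    rcases hs with ⟨rfl, rfl, rfl, rfl, rfl⟩ | ⟨rfl, rfl, rfl, rfl, rfl⟩ <;> decide
  have nv : ∀ x ∈ [Var.m, .one, .base], x ∉ (Alg.rootStep V O sn R R').wv := by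
    rcases hs with ⟨rfl, rfl, rfl, rfl, rfl⟩ | ⟨rfl, rfl, rfl, rfl, rfl⟩ <;> decide
  refine (runs_loop (fun i τ => ∃ S, RootInv L B m lo root (σ.a V) (σ.a O) sn R R' σ i S τ)
    (110 * (m + 1)) ⟨_, h0⟩ ?_).conseq (by rw [hm]) fun τ _ h => by rwa [hm] at h
  rintro i hi τ hf ⟨S, h⟩
  rw [hm] at hi
  have eV : τ.a V = σ.a V := hf.a _ nVO.1
  have eO : τ.a O = σ.a O := hf.a _ nVO.2
  have em : τ.v .m = m := (hf.v _ (nv _ (by simp))).trans hm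
  have eone : τ.v .one = 1 := (hf.v _ (nv _ (by simp))).trans h1
  have ebase : τ.v .base = σ.v .base := hf.v _ (nv _ (by simp))
  have el : τ.l = σ.l := hf.l rfl
  refine Runs.conseq (n := 1 + (1 + (1 + 100 * (m + 1)))) ?_ (by omega) fun _ _ h => h
  refine Runs.seq (runs_loopFree rfl (Runs.seq (runs_loopFree rfl ?_)))
  generalize hυ : (get .y sn .v).eval B ((get .v V .i).eval B τ) = υ
  have uv : ∀ x, x ≠ Var.v → x ≠ .y → υ.v x = τ.v x := by
    intro x x1 x2; rw [← hυ]; simp [Function.update_of_ne x1, Function.update_of_ne x2]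
  have uvv : υ.v .v = σ.a V i := by rw [← hυ]; simp [h.idx, eV]
  have uy : υ.v .y = τ.a sn (σ.a V i) := by rw [← hυ]; simp [h.idx, eV]
  have ua : υ.a = τ.a := by rw [← hυ]; simp
  have ul : υ.l = σ.l := by rw [← hυ]; simpa using el
  have h' : RootInv L B m lo root (σ.a V) (σ.a O) sn R R' σ i S υ :=
    h.congr ua (uv _ (by decide) (by decide)) (uv _ (by decide) (by decide))
      (uv _ (by decide) (by decide))
  have uone : υ.v .one = 1 := (uv _ (by decide) (by decide)).trans eone
  have ubase : υ.v .base = σ.v .base := (uv _ (by decide) (by decide)).trans ebase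
  have uV : υ.a V = σ.a V := by rw [ua, eV]
  have uO : υ.a O = σ.a O := by rw [ua, eO]
  refine runs_iflt_seq (fun hlt => ?_) fun hge => ?_
  · rw [uone, uy] at hlt
    rw [← uV, ← uO] at h' ⊢
    refine newVertex_spec hs (by rw [ubase, ul, uV, uO]; exact hv) hlo hi h'
      ((uv _ (by decide) (by decide)).trans em) uone (by rw [uvv, uV]) fun j hj e => ?_
    have := h.seen j hj
    rw [← uV, e, uV] at this
    omega
  · rw [uone, uy] at hge
    -- The flag of a vertex can only have been set by an earlier edge at the same vertex.
    have hex : ∃ j < i, σ.a V j = σ.a V i := by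
      by_contra hne
      push Not at hne
      have := h.unseen _ hne
      omega
    obtain ⟨j₁, hj₁, e₁⟩ := hex
    refine (runs_loopFree (p := Cmd.skip ;; succ .i) rfl ?_).conseq (by simp [size]; omega)
      fun _ _ h => h
    have hlast : ∀ j, j < i + 1 → ∃ j' < i, σ.a V j' = σ.a V j := by
      intro j hj
      by_cases e : j = i
      · exact ⟨j₁, hj₁, by rw [e₁, e]⟩
      · exact ⟨j, by omega, rfl⟩
    have htr : TreeState m lo root R R' σ S ((Cmd.skip ;; succ .i).eval B υ) :=
      h'.tree.congr (by simp) rfl rfl rfl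
    obtain ⟨-, -, g3, g4, g5, g6, g7, g8, g9, g10, g11⟩ := h'
    refine ⟨S, by simp [(uv .i (by decide) (by decide)).trans h.idx], htr, ?_, ?_, ?_, ?_, ?_, ?_,
      ?_, ?_, ?_⟩
    · simp; omega
    · intro j hj
      obtain ⟨j', hj', e⟩ := hlast j hj
      rw [← e]; exact g4 j' hj'
    · intro v hv'
      exact g5 v fun j hj => hv' j (by omega)
    · simpa using g6
    · intro x hx hx'
      obtain ⟨j₀, hj₀, r⟩ := g7 x hx (by simpa using hx')
      exact ⟨j₀, by omega, r⟩
    · intro j hj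
      obtain ⟨j', hj', e⟩ := hlast j hj
      rw [← e]; simpa using g8 j' hj'
    · simpa [Lists.Entry] using g9
    · intro j hj t ht
      obtain ⟨j', hj', e⟩ := hlast j hj
      rw [← e] at ht ⊢
      simpa [Lists.Entry] using g10 j' hj' t ht
    · rw [Finset.range_add_one, Finset.image_insert, Finset.insert_eq_of_mem]
      · simpa using g11
      · exact Finset.mem_image.2 ⟨j₁, Finset.mem_range.2 hj₁, e₁⟩

/-- The total number of classes of the vertices that have edges. -/
theorem sum_nc_le {L : Lists} {B m base : ℕ} {l V O : ℕ → ℕ} (hv : L.Valid B m base l V O) :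
    ∑ v ∈ (Finset.range m).image V, L.nc v ≤ 3 * m := by
  have h1 : ∑ v ∈ (Finset.range m).image V, deg m V v = m := by
    have := Finset.card_eq_sum_card_image V (Finset.range m)
    rw [Finset.card_range] at this
    exact this.symm
  have h2 : ((Finset.range m).image V).card ≤ m := Finset.card_image_le.trans (by simp)
  calc ∑ v ∈ (Finset.range m).image V, L.nc v
      ≤ ∑ v ∈ (Finset.range m).image V, (2 * deg m V v + 1) := by
        refine Finset.sum_le_sum fun v hv' => ?_
        obtain ⟨j, hj, rfl⟩ := Finset.mem_image.1 hv'
        exact hv.nc_le j (Finset.mem_range.1 hj)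
    _ ≤ 3 * m := by
        rw [Finset.sum_add_distrib, ← Finset.mul_sum, h1]
        simp
        omega

/-! ### Sorting -/

/-- The first `n` entries of `ord` are the numbers with the property `P`, by decreasing key. -/
structure Sorted (P : ℕ → Prop) (key ord : ℕ → ℕ) (n : ℕ) : Prop where
  mem : ∀ p < n, P (ord p)
  anti : ∀ p' < n, ∀ p < p', key (ord p') ≤ key (ord p)
  inj : ∀ p < n, ∀ p' < n, ord p = ord p' → p = p'
  surj : ∀ c, P c → ∃ p < n, ord p = c

theorem Sorted.congr {P P' : ℕ → Prop} {key ord : ℕ → ℕ} {n : ℕ} (h : Sorted P key ord n)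
    (hP : ∀ c, P c ↔ P' c) : Sorted P' key ord n := by
  have : P = P' := funext fun c => propext (hP c)
  rwa [← this]

theorem Sorted.push {P P' : ℕ → Prop} {key ord : ℕ → ℕ} {n c₀ : ℕ} (h : Sorted P key ord n)
    (hc : ¬ P c₀) (hP : ∀ c, P' c ↔ P c ∨ c = c₀) (hk : ∀ c, P c → key c₀ ≤ key c) :
    Sorted P' key (Function.update ord n c₀) (n + 1) := by
  have hlt : ∀ p, p < n → Function.update ord n c₀ p = ord p := fun p hp =>
    Function.update_of_ne (by omega) _ _
  have heq : Function.update ord n c₀ n = c₀ := Function.update_self ..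
  refine ⟨fun p hp => ?_, fun p' hp' p hp => ?_, fun p hp p' hp' e => ?_, fun c hc' => ?_⟩
  · rcases Nat.lt_or_ge p n with h1 | h1
    · rw [hlt p h1]; exact (hP _).2 (.inl (h.mem p h1))
    · rw [show p = n by omega, heq]; exact (hP _).2 (.inr rfl)
  · rw [hlt p (by omega)]
    rcases Nat.lt_or_ge p' n with h1 | h1
    · rw [hlt p' h1]; exact h.anti p' h1 p hp
    · rw [show p' = n by omega, heq]; exact hk _ (h.mem p (by omega))
  · rcases Nat.lt_or_ge p n with h1 | h1 <;> rcases Nat.lt_or_ge p' n with h2 | h2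
    · rw [hlt p h1, hlt p' h2] at e; exact h.inj p h1 p' h2 e
    · rw [hlt p h1, show p' = n by omega, heq] at e
      exact absurd (h.mem p h1) (e ▸ hc)
    · rw [hlt p' h2, show p = n by omega, heq] at e
      exact absurd (h.mem p' h2) (e ▸ hc)
    · omega
  · rcases (hP c).1 hc' with h1 | h1
    · obtain ⟨p, hp, e⟩ := h.surj c h1
      exact ⟨p, by omega, by rw [hlt p hp, e]⟩
    · exact ⟨n, by omega, by rw [heq, h1]⟩

/-- After `u` passes the list contains the classes with sizes from `m - u + 1` to `m`; within a pass
it also has those of size `m - u` among the first `i` table entries. -/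
theorem sort_spec {B m K : ℕ} {σ : Store} (hm : σ.v .m = m) (hK : σ.v .kc = K) :
    Alg.sort.Runs B σ (20 * (m + 1) * (K + 1)) fun τ =>
      Sorted (fun c => c < K ∧ 1 ≤ σ.a .csz c ∧ σ.a .csz c ≤ m) (σ.a .csz) (τ.a .ord)
        (τ.v .no) := by
  refine Runs.conseq (n := 1 + (1 + (1 + m * (1 + (1 + ((1 + K * (1 + Alg.sortStep.size)) + 1))))))
    ?_ ?_ fun _ _ h => h
  swap
  · simp [Alg.sortStep, size]
    ring_nf
    nlinarith
  refine Runs.seq (runs_loopFree rfl (Runs.seq (runs_loopFree rfl ?_)))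
  refine (runs_loop (fun u τ => τ.v .sz = m - u ∧
    Sorted (fun c => c < K ∧ m - u + 1 ≤ σ.a .csz c ∧ σ.a .csz c ≤ m) (σ.a .csz) (τ.a .ord)
        (τ.v .no)) (1 + ((1 + K * (1 + Alg.sortStep.size)) + 1)) ?_ ?_).conseq (by simp [hm])
    fun τ _ h => ?_
  · refine ⟨by simp [hm], ?_⟩
    simp
    exact ⟨by omega, by omega, by omega, by omega⟩
  · rintro u hu τ hf ⟨h1, h2⟩
    simp [hm] at hu
    have e1 : τ.a .csz = σ.a .csz := by rw [hf.a _ (by decide)]; simp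
    have e2 : τ.v .kc = K := by rw [hf.v _ (by decide)]; simp [hK]
    refine Runs.seq (runs_loopFree rfl ?_)
    have e3 : ((zero .i).eval B τ).v .kc = K := by simp [e2]
    refine Runs.seq ((runs_loop (fun i υ => υ.v .i = i ∧ Sorted (fun c => c < K ∧
      (m - u + 1 ≤ σ.a .csz c ∨ σ.a .csz c = m - u ∧ c < i) ∧ σ.a .csz c ≤ m) (σ.a .csz)
      (υ.a .ord) (υ.v .no)) _ ⟨by simp, ?_⟩ ?_).conseq (by rw [e3]) fun υ hf' h => ?_)
    · simp only [eval, Store.setV]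
      simpa using h2
    · rintro i hi υ hf' ⟨h3, h4⟩
      rw [e3] at hi
      refine runs_loopFree rfl ?_
      have e4 : υ.a .csz = σ.a .csz := (hf'.a _ (by decide)).trans (by simpa using e1)
      have e5 : υ.v .sz = m - u := (hf'.v _ (by decide)).trans (by simpa using h1)
      by_cases c : σ.a .csz i = m - u
      · have e6 : (Alg.sortStep.eval B υ).v .i = i + 1 := by simp [Alg.sortStep, h3, e4, e5, c]
        have e7 : (Alg.sortStep.eval B υ).v .no = υ.v .no + 1 := by
          simp [Alg.sortStep, h3, e4, e5, c]
        have e8 : (Alg.sortStep.eval B υ).a .ord =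
            Function.update (υ.a .ord) (υ.v .no) i := by simp [Alg.sortStep, h3, e4, e5, c]
        rw [e6, e7, e8]
        refine ⟨rfl, h4.push (by omega) (fun c' => ?_) fun c' hc' => by omega⟩
        constructor
        · rintro ⟨a1, a2, a3⟩
          by_cases e : c' = i
          · exact .inr e
          · exact .inl ⟨a1, by omega, a3⟩
        · rintro (⟨a1, a2, a3⟩ | rfl)
          · exact ⟨a1, by omega, a3⟩
          · exact ⟨hi, by omega, by omega⟩
      · have e6 : (Alg.sortStep.eval B υ).v .i = i + 1 := by simp [Alg.sortStep, h3, e4, e5, c]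
        have e7 : (Alg.sortStep.eval B υ).v .no = υ.v .no := by
          simp [Alg.sortStep, h3, e4, e5, c]
        have e8 : (Alg.sortStep.eval B υ).a .ord = υ.a .ord := by
          simp [Alg.sortStep, h3, e4, e5, c]
        rw [e6, e7, e8]
        refine ⟨rfl, h4.congr fun c' => ?_⟩
        have : c' = i → σ.a .csz c' ≠ m - u := by rintro rfl; exact c
        constructor
        · rintro ⟨a1, a2, a3⟩; exact ⟨a1, by omega, a3⟩
        · rintro ⟨a1, a2, a3⟩
          refine ⟨a1, ?_, a3⟩
          by_cases e : c' = i
          · have := this e; omega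
          · omega
    · rw [e3] at h
      refine runs_loopFree rfl ?_
      have e5 : υ.v .sz = m - u := (hf'.v _ (by decide)).trans (by simpa using h1)
      refine ⟨by simp [e5]; omega, ?_⟩
      simp only [eval, Store.setV]
      have := h.2.congr (P' := fun c => c < K ∧ m - (u + 1) + 1 ≤ σ.a .csz c ∧ σ.a .csz c ≤ m)
        fun c => by omega
      simpa using this
  · simp only [eval, Store.setV] at h
    rw [show Function.update (Function.update σ.v .no 0) .sz
      ((Function.update σ.v .no 0) .m) .m = m by simp [hm]] at h
    simpa using h.2

end CRMM
-- Insertion of the classes below the roots.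
namespace CRMM

open Cmd

attribute [local simp] eval Store.setV Store.setA Store.setL

/-- The node `x` stands for the vertex of the edge `j₀`. -/
def Lists.IsRoot (L : Lists) (B m : ℕ) (V : ℕ → ℕ) (S : ℕ → ℕ → Prop) (τ : Store) (x j₀ : ℕ) : Prop :=
  (∀ j < m, S x j ↔ V j = V j₀) ∧ τ.a .res x = min (L.q (V j₀)) B

/-- The node `x` stands for the class `t` of the vertex of the edge `j₀`. -/
def Lists.IsClass (L : Lists) (B m : ℕ) (V O : ℕ → ℕ) (S : ℕ → ℕ → Prop) (τ : Store)
    (x j₀ t : ℕ) : Prop :=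
  (∀ j < m, S x j ↔ V j = V j₀ ∧ O j ∈ L.cls (V j₀) t) ∧ τ.a .res x = min (L.cq (V j₀) t) B

/-- The first `i` classes have been inserted. -/
structure NodeInv (L : Lists) (B m lo root : ℕ) (V O : ℕ → ℕ) (R R' : Arr) (σ ρ : Store)
    (i : ℕ) (S : ℕ → ℕ → Prop) (τ : Store) : Prop where
  idx : τ.v .i = i
  nx : τ.v .nx = ρ.v .nx + i
  tree : TreeState m lo root R R' σ S τ
  mark : ∀ y, τ.a .mark y < τ.v .nx
  desc : ∀ x, lo ≤ x → x < τ.v .nx → ∃ j₀ < m, L.IsRoot B m V S τ x j₀ ∨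
    ∃ t < L.nc (V j₀), L.IsClass B m V O S τ x j₀ t ∧
      ∃ p < i, (L.cls (V j₀) t).card = ρ.a .csz (ρ.a .ord p)
  roots : ∀ j₀ < m, ∃ x, lo ≤ x ∧ x < τ.v .nx ∧ L.IsRoot B m V S τ x j₀
  classes : ∀ p < i, ∀ j₀ < m, ∀ t < L.nc (V j₀), L.Entry B ρ (ρ.a .ord p) (V j₀) t →
    ∃ x, lo ≤ x ∧ x < τ.v .nx ∧ L.IsClass B m V O S τ x j₀ t

/-- An entry records a memory position and a size, and these determine the set. So it is harmless
that one entry may fit several pairs of an edge and an index of a class. -/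
theorem Lists.Entry.cls_eq {L : Lists} {B m base : ℕ} {l V O : ℕ → ℕ} {ρ : Store}
    (hv : L.Valid B m base l V O) {c j₁ t₁ j₂ t₂ : ℕ} (hj₁ : j₁ < m) (hj₂ : j₂ < m)
    (ht₁ : t₁ < L.nc (V j₁)) (ht₂ : t₂ < L.nc (V j₂)) (h₁ : L.Entry B ρ c (V j₁) t₁)
    (h₂ : L.Entry B ρ c (V j₂) t₂) :
    V j₁ = V j₂ ∧ L.cls (V j₁) t₁ = L.cls (V j₂) t₂ ∧
      min (L.cq (V j₁) t₁) B = min (L.cq (V j₂) t₂) B := by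
  obtain ⟨a1, a2, a3, a4⟩ := h₁
  obtain ⟨b1, b2, b3, b4⟩ := h₂
  refine ⟨a1.symm.trans b1, ?_, a2.symm.trans b2⟩
  rw [hv.elems j₁ hj₁ t₁ ht₁, hv.elems j₂ hj₂ t₂ ht₂, ← a3, ← b3, ← a4, ← b4]

theorem nodeStep_spec {L : Lists} {B m lo root i : ℕ} {V O sn R R' : Arr}
    (hs : IsSide V O sn R R') {σ ρ τ : Store} {S : ℕ → ℕ → Prop} {P : ℕ → Prop}
    (hv : L.Valid B m (τ.v .base) τ.l (τ.a V) (τ.a O)) (hlo : m + 2 ≤ lo)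
    (h : NodeInv L B m lo root (τ.a V) (τ.a O) R R' σ ρ i S τ)
    (hm : τ.v .m = m)
    (ha : ∀ r ∈ [Arr.ord, .cv, .cq, .csz, .cptr], τ.a r = ρ.a r)
    (hsort : Sorted P (ρ.a .csz) (ρ.a .ord) (ρ.v .no)) (hi : i < ρ.v .no)
    (hP : ∀ c, P c → 1 ≤ ρ.a .csz c ∧ ρ.a .csz c ≤ m ∧
      ∃ j₀ < m, ∃ t < L.nc (τ.a V j₀), L.Entry B ρ c (τ.a V j₀) t) :
    (Alg.nodeStep V O R R').Runs B τ (30 * (m + 1)) fun ω =>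
      ∃ S', NodeInv L B m lo root (τ.a V) (τ.a O) R R' σ ρ (i + 1) S' ω := by
  have hk := h.tree.lo_le
  obtain ⟨hc1, hcm, j₀, hj₀, t, ht, hE⟩ := hP _ (hsort.mem i hi)
  set c := ρ.a .ord i with hc
  set Vf := τ.a V with hVf
  set Of := τ.a O with hOf
  obtain ⟨e1, e2, e3, e4⟩ := id hE
  set X : Finset ℕ := L.cls (Vf j₀) t with hX
  have p1 := hv.pos_succ j₀ hj₀ t ht
  have p2 := hv.pos_le j₀ hj₀ (t + 1) (by omega)
  have nV : V ≠ .mark ∧ V ≠ .res ∧ V ≠ R ∧ V ≠ R' := by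
    rcases hs with ⟨rfl, rfl, rfl, rfl, rfl⟩ | ⟨rfl, rfl, rfl, rfl, rfl⟩ <;> decide
  have nO : O ≠ .mark ∧ O ≠ .res ∧ O ≠ R ∧ O ≠ R' := by
    rcases hs with ⟨rfl, rfl, rfl, rfl, rfl⟩ | ⟨rfl, rfl, rfl, rfl, rfl⟩ <;> decide
  have nR : R ≠ .mark ∧ R ≠ .res := by
    rcases hs with ⟨rfl, rfl, rfl, rfl, rfl⟩ | ⟨rfl, rfl, rfl, rfl, rfl⟩ <;> decide
  have nR' : R' ≠ .mark ∧ R' ≠ .res := by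
    rcases hs with ⟨rfl, rfl, rfl, rfl, rfl⟩ | ⟨rfl, rfl, rfl, rfl, rfl⟩ <;> decide
  refine Runs.conseq (n := 1 + (1 + (1 + (1 + (1 + (1 + ((1 + X.card * (1 + Alg.elemStep.size)) +
    (20 * (m + 1) + 1)))))))) ?_ ?_ fun _ _ h => h
  swap
  · simp [Alg.elemStep, size]
    omega
  unfold Alg.nodeStep
  refine Runs.seq (runs_loopFree rfl ?_)
  refine Runs.seq (runs_loopFree rfl ?_)
  refine Runs.seq (runs_loopFree rfl ?_)
  refine Runs.seq (runs_loopFree rfl ?_)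
  refine Runs.seq (runs_loopFree rfl ?_)
  refine Runs.seq (runs_loopFree rfl ?_)
  generalize hυ : (put .res .nx .y).eval B _ = υ
  have ho : τ.a .ord i = c := by rw [ha _ (by simp)]
  have uv : ∀ x ∈ [Var.nx, .i, .m], υ.v x = τ.v x := by
    intro x hx
    simp only [List.mem_cons, List.not_mem_nil, or_false] at hx
    rw [← hυ]; rcases hx with rfl | rfl | rfl <;> simp
  have uvv : υ.v .v = Vf j₀ := by
    rw [← hυ, ← e1, ← ha .cv (by simp)]; simp [h.idx, ho]
  have ubp : υ.v .bp = L.pos (Vf j₀) t + 2 := by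
    rw [← hυ, ← e4, ← ha .cptr (by simp)]; simp [h.idx, ho]
  have usz : υ.v .sz = X.card := by
    rw [← hυ, ← e3, ← ha .csz (by simp)]; simp [h.idx, ho]
  have ures : υ.a .res = Function.update (τ.a .res) (τ.v .nx) (min (L.cq (Vf j₀) t) B) := by
    rw [← hυ, ← e2, ← ha .cq (by simp)]; simp [h.idx, ho]
  have ua : ∀ r, r ≠ .res → υ.a r = τ.a r := by
    intro r r1; rw [← hυ]; simp [Function.update_of_ne r1]
  have ul : υ.l = τ.l := by rw [← hυ]; simp
  clear hυ
  -- the elements are marked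
  refine Runs.seq (Runs.conseq (runs_loop (fun u ω => ω.v .bp = L.pos (Vf j₀) t + 2 + u ∧
      (∀ y, ω.a .mark y ≤ τ.v .nx) ∧
      ∀ y, ω.a .mark y = τ.v .nx ↔ ∃ i < u, τ.l (L.pos (Vf j₀) t + 2 + i) = y)
      Alg.elemStep.size ⟨by simp [ubp], fun y => by rw [ua _ (by decide)]; exact (h.mark y).le,
        fun y => ?_⟩ ?_) (by rw [usz]) fun ω hf hI => ?_)
  · rw [ua _ (by decide)]
    have := h.mark y
    simp
    omega
  · rintro u hu ω hf ⟨w1, w2, w3⟩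
    rw [usz] at hu
    refine runs_loopFree rfl ?_
    have el : ω.l = τ.l := (hf.l rfl).trans ul
    have en : ω.v .nx = τ.v .nx := (hf.v _ (by decide)).trans (uv _ (by simp))
    have hmem : τ.l (L.pos (Vf j₀) t + 2 + u) ∈ X := by
      rw [hX, hv.elems j₀ hj₀ t ht]
      exact Finset.mem_image_of_mem _ (Finset.mem_range.2 hu)
    have g1 := hv.elem_le j₀ hj₀ t ht _ hmem
    have g2 : L.pos (Vf j₀) t + 2 + u < B := by rw [← hX] at p1; omega
    have a1 : (Alg.elemStep.eval B ω).v .bp = L.pos (Vf j₀) t + 2 + (u + 1) := by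
      simp [Alg.elemStep, w1]; omega
    have a2 : (Alg.elemStep.eval B ω).a .mark =
        Function.update (ω.a .mark) (τ.l (L.pos (Vf j₀) t + 2 + u)) (τ.v .nx) := by
      simp [Alg.elemStep, w1, el, en, g2, min_eq_left g1]
    rw [a1, a2]
    refine ⟨rfl, fun y => ?_, fun y => ?_⟩
    · by_cases e : y = τ.l (L.pos (Vf j₀) t + 2 + u)
      · rw [e, Function.update_self]
      · rw [Function.update_of_ne e]; exact w2 y
    · by_cases e : y = τ.l (L.pos (Vf j₀) t + 2 + u)
      · rw [e, Function.update_self]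
        simp only [true_iff]
        exact ⟨u, by omega, rfl⟩
      · rw [Function.update_of_ne e, w3 y]
        refine ⟨fun ⟨i, hi, e⟩ => ⟨i, by omega, e⟩, fun ⟨i, hi, e'⟩ => ⟨i, ?_, e'⟩⟩
        have : i ≠ u := by rintro rfl; exact e e'.symm
        omega
  rw [usz] at hI
  obtain ⟨-, w2, w3⟩ := hI
  have w4 : ∀ y, ω.a .mark y = τ.v .nx ↔ y ∈ X := by
    intro y
    have hX' := hv.elems j₀ hj₀ t ht
    rw [← hX] at hX'
    conv_rhs => rw [hX']
    rw [w3 y]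
    simp
  have wv' : ∀ x ∈ [Var.nx, .i, .m], ω.v x = τ.v x := by
    intro x hx
    rw [hf.v x, uv x hx]
    simp only [List.mem_cons, List.not_mem_nil, or_false] at hx
    rcases hx with rfl | rfl | rfl <;> decide
  have wvv : ω.v .v = Vf j₀ := (hf.v _ (by decide)).trans uvv
  have wres : ω.a .res = Function.update (τ.a .res) (τ.v .nx) (min (L.cq (Vf j₀) t) B) :=
    (hf.a _ (by decide)).trans ures
  have wa' : ∀ r, r ≠ .res → r ≠ .mark → ω.a r = τ.a r := fun r r1 r2 =>
    (hf.a _ (by simp [Alg.elemStep, wa, r2])).trans (ua r r1)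
  clear hf uv uvv ubp usz ures ua ul υ w3
  -- the node is inserted
  refine Runs.seq (Runs.conseq (h.tree.insert (B := B) hs
    (X := fun j => Vf j = Vf j₀ ∧ Of j ∈ X) (by omega)
    ((wv' _ (by simp)).trans hm) (wv' _ (by simp)) (wa' _ nR.2 nR.1)
    (wa' _ nR'.2 nR'.1) wres (fun j hj => ?_) ?_ fun x hx hx' => ?_)
    le_rfl fun υ hf hQ => ?_)
  · rw [wa' _ nV.2.1 nV.1, wa' _ nO.2.1 nO.1, wvv, w4]
  · have hne : X.Nonempty := Finset.card_pos.1 (by omega)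
    obtain ⟨p, hp⟩ := hne
    obtain ⟨j', hj', e5, e6⟩ := hv.nbr j₀ hj₀ t ht p hp
    exact ⟨j', hj', e5, e6 ▸ hp⟩
  -- Nodes of other vertices contain no edge of the class, and the root contains them all. An
  -- earlier class of the same vertex is at least as large, so by laminarity it contains the new one
  -- (possibly being equal to it) or is disjoint from it.
  · obtain ⟨j₁, hj₁, ⟨d1, -⟩ | ⟨t', ht', ⟨d1, -⟩, p', hp', d2⟩⟩ := h.desc x hx hx'
    · by_cases e : Vf j₁ = Vf j₀
      · exact .inl fun j hj hj' => (d1 j hj).2 (hj'.1.trans e.symm)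
      · exact .inr fun j hj hj' h' => e (((d1 j hj).1 h').symm.trans hj'.1)
    · by_cases e : Vf j₁ = Vf j₀
      · rw [e] at d1 d2 ht'
        have hcard : X.card ≤ (L.cls (Vf j₀) t').card := by
          rw [d2, ← e3]
          exact hsort.anti i hi p' hp'
        rcases hv.laminar j₀ hj₀ t ht t' ht' with hl | hl | hl
        · exact .inl fun j hj hj' => (d1 j hj).2 ⟨hj'.1, hl hj'.2⟩
        · have := Finset.eq_of_subset_of_card_le hl hcard
          exact .inl fun j hj hj' => (d1 j hj).2 ⟨hj'.1, by rw [this]; exact hj'.2⟩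
        · exact .inr fun j hj hj' h' =>
            Finset.disjoint_left.1 hl hj'.2 ((d1 j hj).1 h').2
      · exact .inr fun j hj hj' h' => e (((d1 j hj).1 h').1.symm.trans hj'.1)
  obtain ⟨q1, q2, q3⟩ := hQ
  have umark : υ.a .mark = ω.a .mark :=
    hf.a _ (by simp [Alg.attach, Alg.attachStep, wa, nR.1.symm, nR'.1.symm])
  have ui : υ.v .i = i := (hf.v _ (by simp [Alg.attach, Alg.attachStep, wv])).trans
    ((wv' _ (by simp)).trans h.idx)
  refine runs_loopFree rfl ⟨Function.update S (τ.v .nx) fun j => Vf j = Vf j₀ ∧ Of j ∈ X,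
    by simp [ui], by simp [q2, h.nx]; omega, q1.congr (by simp) rfl rfl rfl, fun y => ?_,
    fun x hx hx' => ?_, fun j₁ hj₁ => ?_, fun p hp j₁ hj₁ t₁ ht₁ hE₁ => ?_⟩
  · simp [q2, umark]
    have := w2 y
    omega
  · simp [q2] at hx'
    by_cases e : x = τ.v .nx
    · refine ⟨j₀, hj₀, .inr ⟨t, ht, ⟨fun j _ => ?_, ?_⟩, i, by omega, e3.symm⟩⟩
      · rw [e, Function.update_self]
      · simp only [eval, Store.setV, q3]
        rw [e, Function.update_self]
    · obtain ⟨j₁, hj₁, ⟨d1, d2⟩ | ⟨t', ht', ⟨d1, d3⟩, p', hp', d2⟩⟩ := h.desc x hx (by omega)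
      · refine ⟨j₁, hj₁, .inl ⟨?_, ?_⟩⟩
        · rwa [Function.update_of_ne e]
        · simp only [eval, Store.setV, q3]
          rwa [Function.update_of_ne e]
      · refine ⟨j₁, hj₁, .inr ⟨t', ht', ⟨?_, ?_⟩, p', by omega, d2⟩⟩
        · rwa [Function.update_of_ne e]
        · simp only [eval, Store.setV, q3]
          rwa [Function.update_of_ne e]
  · obtain ⟨x, x1, x2, x3, x4⟩ := h.roots j₁ hj₁
    refine ⟨x, x1, by simp [q2]; omega, ?_, ?_⟩
    · rwa [Function.update_of_ne (by omega)]
    · simp only [eval, Store.setV, q3]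
      rwa [Function.update_of_ne (by omega)]
  · by_cases e : p = i
    · subst e
      obtain ⟨f1, f2, f3⟩ := hE₁.cls_eq hv hj₁ hj₀ ht₁ ht hE
      refine ⟨τ.v .nx, hk, by simp [q2], fun j _ => ?_, ?_⟩
      · rw [Function.update_self, f2, f1]
      · simp only [eval, Store.setV, q3]
        rw [Function.update_self, f3]
    · obtain ⟨x, x1, x2, x3, x4⟩ := h.classes p (by omega) j₁ hj₁ t₁ ht₁ hE₁
      refine ⟨x, x1, by simp [q2]; omega, ?_, ?_⟩
      · rwa [Function.update_of_ne (by omega)]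
      · simp only [eval, Store.setV, q3]
        rwa [Function.update_of_ne (by omega)]

/-- The trees of one side have been built, starting from the state `σ`. -/
structure SideDone (L : Lists) (B m lo root : ℕ) (V O : ℕ → ℕ) (R R' : Arr) (σ : Store)
    (S : ℕ → ℕ → Prop) (τ : Store) : Prop where
  tree : TreeState m lo root R R' σ S τ
  nx_le : τ.v .nx ≤ lo + 4 * m
  mark : ∀ y, τ.a .mark y < τ.v .nx
  desc : ∀ x, lo ≤ x → x < τ.v .nx → ∃ j₀ < m, L.IsRoot B m V S τ x j₀ ∨
    ∃ t < L.nc (V j₀), L.IsClass B m V O S τ x j₀ t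
  roots : ∀ j₀ < m, ∃ x, lo ≤ x ∧ x < τ.v .nx ∧ L.IsRoot B m V S τ x j₀
  classes : ∀ j₀ < m, ∀ t < L.nc (V j₀), (L.cls (V j₀) t).Nonempty →
    ∃ x, lo ≤ x ∧ x < τ.v .nx ∧ L.IsClass B m V O S τ x j₀ t

theorem Sorted.le {P : ℕ → Prop} {key ord : ℕ → ℕ} {n K : ℕ} (h : Sorted P key ord n)
    (hP : ∀ c, P c → c < K) : n ≤ K := by
  have := Finset.card_le_card_of_injOn (s := Finset.range n) (t := Finset.range K) ord
    (fun p hp => by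
      have := hP _ (h.mem p (by simpa using hp))
      simpa using this)
    (fun p hp p' hp' e => h.inj p (by simpa using hp) p' (by simpa using hp') e)
  simpa using this

/-- There are at most `m` roots and `3 m` classes, each handled in O(m) steps, and sorting takes `m`
scans of a table with at most `3 m` entries; this is the quadratic bound. -/
theorem side_spec {L : Lists} {B m lo root : ℕ} {V O sn R R' : Arr} (hs : IsSide V O sn R R')
    {σ : Store} (hv : L.Valid B m (σ.v .base) σ.l (σ.a V) (σ.a O)) (hlo : m + 2 ≤ lo)
    (hm : σ.v .m = m) (h1 : σ.v .one = 1) (hnx : σ.v .nx = lo) (hsn : ∀ v, σ.a sn v = 0)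
    (hmark : ∀ y, σ.a .mark y < lo) (hR : ∀ j < m, σ.a R j = root) (hroot : root < lo) :
    (Alg.side V O sn R R').Runs B σ (400 * (m + 1) ^ 2) fun τ =>
      ∃ S, SideDone L B m lo root (σ.a V) (σ.a O) R R' σ S τ := by
  have nV : V ∉ (Alg.rootStep V O sn R R').wa ∧ V ∉ (Alg.nodeStep V O R R').wa ∧ V ≠ .ord := by
    rcases hs with ⟨rfl, rfl, rfl, rfl, rfl⟩ | ⟨rfl, rfl, rfl, rfl, rfl⟩ <;> decide
  have nO : O ∉ (Alg.rootStep V O sn R R').wa ∧ O ∉ (Alg.nodeStep V O R R').wa ∧ O ≠ .ord := by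
    rcases hs with ⟨rfl, rfl, rfl, rfl, rfl⟩ | ⟨rfl, rfl, rfl, rfl, rfl⟩ <;> decide
  have nR : R ≠ .ord ∧ R' ≠ .ord := by
    rcases hs with ⟨rfl, rfl, rfl, rfl, rfl⟩ | ⟨rfl, rfl, rfl, rfl, rfl⟩ <;> decide
  have nv : ∀ x ∈ [Var.m, .one, .base], x ∉ (Alg.rootStep V O sn R R').wv := by
    rcases hs with ⟨rfl, rfl, rfl, rfl, rfl⟩ | ⟨rfl, rfl, rfl, rfl, rfl⟩ <;> decide
  have nv' : ∀ x ∈ [Var.m, .one, .base], x ∉ (Alg.nodeStep V O R R').wv := by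
    rcases hs with ⟨rfl, rfl, rfl, rfl, rfl⟩ | ⟨rfl, rfl, rfl, rfl, rfl⟩ <;> decide
  have na : ∀ r ∈ [Arr.ord, .cv, .cq, .csz, .cptr], r ∉ (Alg.nodeStep V O R R').wa := by
    rcases hs with ⟨rfl, rfl, rfl, rfl, rfl⟩ | ⟨rfl, rfl, rfl, rfl, rfl⟩ <;> decide
  have hsum := sum_nc_le hv
  refine Runs.conseq (n := 1 + (1 + ((1 + m * (1 + 110 * (m + 1))) +
    (20 * (m + 1) * (3 * m + 1) + (1 + (1 + 3 * m * (1 + 30 * (m + 1)))))))) ?_ ?_ fun _ _ h => h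
  swap
  · nlinarith
  refine Runs.seq (runs_loopFree rfl (Runs.seq (runs_loopFree rfl ?_)))
  generalize hρ : (zero .i).eval B ((zero .kc).eval B σ) = ρ
  have ra : ρ.a = σ.a := by rw [← hρ]; simp
  have rl : ρ.l = σ.l := by rw [← hρ]; simp
  have ri : ρ.v .i = 0 := by rw [← hρ]; simp
  have rkc : ρ.v .kc = 0 := by rw [← hρ]; simp
  have rv : ∀ x ∈ [Var.m, .one, .base, .nx], ρ.v x = σ.v x := by
    intro x hx
    simp only [List.mem_cons, List.not_mem_nil, or_false] at hx
    rw [← hρ]; rcases hx with rfl | rfl | rfl | rfl <;> simp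
  clear hρ
  have htree : ∀ S τ, TreeState m lo root R R' ρ S τ → TreeState m lo root R R' σ S τ := by
    intro S τ ⟨h1, h2, h3, h4, h5, h6⟩
    rw [ra] at h4 h5 h6
    exact ⟨h1, h2, h3, h4, h5, h6⟩
  have h0 : RootInv L B m lo root (ρ.a V) (ρ.a O) sn R R' ρ 0 (fun _ _ => False) ρ := by
    have rnx : ρ.v .nx = lo := (rv _ (by simp)).trans hnx
    refine ⟨ri, ⟨⟨fun j hj φ P _ hP => ?_, fun j hj j' hj' _ => ?_, fun x hx hx' => ?_,
      fun j hj => ?_⟩, by omega, fun x hx hx' => by omega, fun _ _ => rfl, fun _ _ _ => rfl,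
      fun _ _ => rfl⟩, by omega, by omega, fun v _ => by rw [ra, hsn], fun y => ?_,
      fun x hx hx' => by omega, by omega, by omega, by omega, by simp [rkc]⟩
    · simp [rnx, ra, hR j hj]
    · rw [ra, hR j hj, hR j' hj']
    · omega
    · rw [ra, hR j hj, rnx]; exact hroot
    · rw [ra, rnx]; exact hmark y
  refine Runs.seq ((roots_spec hs (by rw [rv _ (by simp), rl, ra]; exact hv) hlo
    ((rv _ (by simp)).trans hm) ((rv _ (by simp)).trans h1) h0).conseq le_rfl
    fun τ hf ⟨S, h⟩ => ?_)
  rw [ra] at h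
  have tv : ∀ x ∈ [Var.m, .one, .base], τ.v x = σ.v x := by
    intro x hx
    rw [hf.v x (nv x hx)]
    exact rv x (by simp at hx ⊢; tauto)
  have tl : τ.l = σ.l := (hf.l rfl).trans rl
  have tV : τ.a V = σ.a V := (hf.a _ nV.1).trans (by rw [ra])
  have tO : τ.a O = σ.a O := (hf.a _ nO.1).trans (by rw [ra])
  have hkc : τ.v .kc ≤ 3 * m := h.kc_le.trans hsum
  clear hf h0 rl ri rkc rv
  refine Runs.seq ((sort_spec ((tv _ (by simp)).trans hm) rfl).conseq (by gcongr)
    fun υ hf hsort => ?_)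
  have uvm : ∀ x ∈ [Var.m, .one, .base, .nx], υ.v x = τ.v x := by
    intro x hx
    simp only [List.mem_cons, List.not_mem_nil, or_false] at hx
    rw [hf.v]
    rcases hx with rfl | rfl | rfl | rfl <;> decide
  have ua : ∀ r, r ≠ .ord → υ.a r = τ.a r := fun r hr => hf.a _ (by
    simpa [Alg.sort, Alg.sortStep, wa] using hr)
  have ul : υ.l = σ.l := (hf.l rfl).trans tl
  clear hf
  refine Runs.seq (runs_loopFree rfl ?_)
  generalize hχ : (zero .i).eval B υ = χ
  have cv : ∀ x, x ≠ Var.i → χ.v x = υ.v x := by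
    intro x hx; rw [← hχ]; simp [Function.update_of_ne hx]
  have ci : χ.v .i = 0 := by rw [← hχ]; simp
  have ca : χ.a = υ.a := by rw [← hχ]; simp
  have cl : χ.l = σ.l := by rw [← hχ]; simpa using ul
  clear hχ
  have hno : χ.v .no ≤ 3 * m := by
    rw [cv _ (by decide)]
    exact (hsort.le fun c hc => hc.1).trans hkc
  have cnx : χ.v .nx = τ.v .nx := (cv _ (by decide)).trans (uvm _ (by simp))
  rw [← cv _ (by decide), ← ca, ← ua .csz (by decide), ← ca] at hsort
  have ca' : ∀ r, r ≠ .ord → χ.a r = τ.a r := fun r hr => by rw [ca, ua r hr]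
  have cE : ∀ c v t, L.Entry B τ c v t → L.Entry B χ c v t := by
    intro c v t he
    unfold Lists.Entry
    rw [ca' _ (by decide), ca' _ (by decide), ca' _ (by decide), ca' _ (by decide)]
    exact he
  -- Classes consist of neighbours, so no size exceeds `m`, and sorting misses only the empty
  -- classes.
  have hcsz : ∀ j₀ < m, ∀ t < L.nc (σ.a V j₀), (L.cls (σ.a V j₀) t).card ≤ m := by
    intro j₀ hj₀ t ht
    have : L.cls (σ.a V j₀) t ⊆ (Finset.range m).image (σ.a O) := by
      intro p hp
      obtain ⟨j', hj', -, e⟩ := hv.nbr j₀ hj₀ t ht p hp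
      exact Finset.mem_image.2 ⟨j', Finset.mem_range.2 hj', e⟩
    exact (Finset.card_le_card this).trans (Finset.card_image_le.trans (by simp))
  refine (runs_loop (fun i ω => ∃ S, NodeInv L B m lo root (σ.a V) (σ.a O) R R' σ χ i S ω)
    (30 * (m + 1)) ⟨S, ?_⟩ ?_).conseq (by gcongr) fun ω hf ⟨S', hI⟩ => ?_
  · refine ⟨ci, by simp, (htree _ _ h.tree).congr cnx (ca' _ nR.1) (ca' _ nR.2)
      (ca' _ (by decide)), fun y => ?_, fun x hx hx' => ?_, fun j₀ hj₀ => ?_, by omega⟩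
    · rw [ca' _ (by decide), cnx]; exact h.mark y
    · rw [cnx] at hx'
      obtain ⟨j₀, hj₀, d1, d2⟩ := h.desc x hx hx'
      exact ⟨j₀, hj₀, .inl ⟨d1, by rw [ca' _ (by decide), d2]⟩⟩
    · obtain ⟨x, x1, x2, x3⟩ := h.roots j₀ hj₀
      refine ⟨x, x1, by rwa [cnx], x3, ?_⟩
      obtain ⟨j₁, hj₁, d1, d2⟩ := h.desc x x1 x2
      rw [ca' _ (by decide), d2, (d1 j₀ hj₀).1 ((x3 j₀ hj₀).2 rfl)]
  · rintro i hi ω hf ⟨S', hI⟩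
    have wV : ω.a V = σ.a V := (hf.a _ nV.2.1).trans ((ca' _ nV.2.2).trans tV)
    have wO : ω.a O = σ.a O := (hf.a _ nO.2.1).trans ((ca' _ nO.2.2).trans tO)
    have wl : ω.l = σ.l := (hf.l rfl).trans cl
    have wv' : ∀ x ∈ [Var.m, .base], ω.v x = σ.v x := by
      intro x hx
      have hx' : x ∈ [Var.m, .one, .base] := by simp at hx ⊢; tauto
      rw [hf.v x (nv' x hx'), cv x, uvm x, tv x hx']
      · simp at hx ⊢; tauto
      · simp at hx; rcases hx with rfl | rfl <;> decide
    rw [← wV, ← wO] at hI ⊢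
    refine nodeStep_spec hs (by rw [wl, wV, wO, wv' _ (by simp)]; exact hv) hlo hI
      ((wv' _ (by simp)).trans hm) (fun r hr => hf.a _ (na r hr)) hsort hi fun c hc => ?_
    refine ⟨hc.2.1, hc.2.2, ?_⟩
    obtain ⟨j₀, hj₀, t, ht, he⟩ := h.entry c hc.1
    rw [wV]
    exact ⟨j₀, hj₀, t, ht, cE _ _ _ he⟩
  · obtain ⟨-, i2, i3, i4, i5, i6, i7⟩ := hI
    refine ⟨S', i3, ?_, i4, fun x hx hx' => ?_, i6, fun j₀ hj₀ t ht hne => ?_⟩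
    · have := h.nx_le
      omega
    · obtain ⟨j₀, hj₀, hr | ⟨t, ht, hc, -⟩⟩ := i5 x hx hx'
      · exact ⟨j₀, hj₀, .inl hr⟩
      · exact ⟨j₀, hj₀, .inr ⟨t, ht, hc⟩⟩
    · obtain ⟨c, hc, he⟩ := h.entries j₀ hj₀ t ht
      have he' := cE _ _ _ he
      have hcs : χ.a .csz c = (L.cls (σ.a V j₀) t).card := he'.2.2.1
      have := Finset.card_pos.2 hne
      have := hcsz j₀ hj₀ t ht
      obtain ⟨p, hp, e⟩ := hsort.surj c ⟨hc, by omega, by omega⟩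
      exact i7 p hp j₀ hj₀ t ht (e ▸ he')

end CRMM
namespace CRMM

open Cmd

attribute [local simp] eval Store.setV Store.setA Store.setL

/-! ### Reading the edges -/

/-- The memory `l` holds the table of the edges: the edge `j` has the ends `EA j` and `EP j` and the
rank `RK j`. -/
structure EdgeTable (B m nA : ℕ) (EA EP RK l : ℕ → ℕ) : Prop where
  lt : 3 + 3 * m ≤ B
  nA_le : nA ≤ B
  count_left : l 0 = nA
  count_edges : l 2 = m
  ea : ∀ j < m, l (3 + 3 * j) = EA j ∧ EA j ≤ B
  ep : ∀ j < m, l (4 + 3 * j) = EP j ∧ EP j ≤ B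
  rk : ∀ j < m, l (5 + 3 * j) = RK j ∧ RK j ≤ B

/-- The state of the arrays when `i` edges have been read. -/
structure EdgesRead (m : ℕ) (EA EP RK : ℕ → ℕ) (i : ℕ) (τ : Store) : Prop where
  ea : ∀ j, τ.a .ea j = if j < i then EA j else 0
  ep : ∀ j, τ.a .ep j = if j < i then EP j else 0
  rk : ∀ j, τ.a .rk j = if j < i then RK j else 0
  res : ∀ j, τ.a .res j = if j < i then 1 else 0
  src : ∀ j, τ.a .src j = if j < i then m else 0
  dst : ∀ j, τ.a .dst j = if j < i then m + 1 else 0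

theorem update_ite {f : ℕ → ℕ} {i : ℕ} {g : ℕ → ℕ} (h : ∀ j, f j = if j < i then g j else 0) {n : ℕ}
    (hn : n = g i) (j : ℕ) : Function.update f i n j = if j < i + 1 then g j else 0 := by
  by_cases e : j = i
  · rw [e, Function.update_self, if_pos (by omega), hn]
  · rw [Function.update_of_ne e, h j]
    by_cases hj : j < i
    · rw [if_pos hj, if_pos (by omega)]
    · rw [if_neg hj, if_neg (by omega)]

theorem update_lt {f : ℕ → ℕ} {i : ℕ} {g : ℕ → ℕ} (h : ∀ j < i, f j = g j) {n : ℕ}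
    (hn : n = g i) (j : ℕ) (hj : j < i + 1) : Function.update f i n j = g j := by
  by_cases e : j = i
  · rw [e, Function.update_self, hn]
  · rw [Function.update_of_ne e, h j (by omega)]

/-- At first each edge runs directly from the source to the sink, which is its path through empty
forests; inserting nodes later moves its two ends down the trees. -/
theorem readEdges_spec {B m nA : ℕ} {EA EP RK : ℕ → ℕ} {σ : Store}
    (ht : EdgeTable B m nA EA EP RK σ.l) (ha : ∀ r j, σ.a r j = 0) :
    Alg.readEdges.Runs B σ (40 * (m + 1)) fun τ => EdgesRead m EA EP RK m τ ∧
      τ.v .m = m ∧ τ.v .nA = nA ∧ τ.v .one = 1 ∧ τ.v .zr = 0 ∧ τ.v .T = m + 1 ∧ τ.v .nx = m + 2 ∧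
      τ.v .ptr = 3 + 3 * m ∧ τ.v .base = 3 + 3 * m := by
  have hlt := ht.lt
  refine Runs.conseq (n := Alg.readHeader.size + ((1 + m * (1 + Alg.readEdge.size)) + 1)) ?_ ?_
    fun _ _ h => h
  swap
  · simp [Alg.readHeader, Alg.readEdge, size]
    omega
  refine Runs.seq (runs_loopFree rfl ?_)
  generalize hυ : Alg.readHeader.eval B σ = υ
  have hf0 := hυ ▸ Alg.readHeader.frame B σ
  have h0B : 0 < B := by omega
  have h2B : 2 < B := by omega
  have um : υ.v .m = m := by
    rw [← hυ]; simp [Alg.readHeader, ht.count_edges, h2B]; omega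
  have unA : υ.v .nA = nA := by
    rw [← hυ]; simp [Alg.readHeader, ht.count_left, h0B, ht.nA_le]
  have uone : υ.v .one = 1 := by rw [← hυ]; simp [Alg.readHeader]
  have uzr : υ.v .zr = 0 := by rw [← hυ]; simp [Alg.readHeader]
  have uT : υ.v .T = m + 1 := by
    rw [← hυ]; simp [Alg.readHeader, ht.count_edges, h2B]; omega
  have unx : υ.v .nx = m + 2 := by
    rw [← hυ]; simp [Alg.readHeader, ht.count_edges, h2B]; omega
  have uptr : υ.v .ptr = 3 := by rw [← hυ]; simp [Alg.readHeader]
  have ui : υ.v .i = 0 := by rw [← hυ]; simp [Alg.readHeader]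
  have ua : ∀ r j, υ.a r j = 0 := fun r j => by rw [hf0.a r (by simp [Alg.readHeader, wa])]; exact ha r j
  have ul : υ.l = σ.l := hf0.l rfl
  clear hυ hf0
  refine Runs.seq (Runs.conseq (runs_loop (fun i τ => τ.v .i = i ∧ τ.v .ptr = 3 + 3 * i ∧
    EdgesRead m EA EP RK i τ) Alg.readEdge.size ?_ ?_) (by rw [um]) fun τ hf hI => ?_)
  · refine ⟨ui, by simp [uptr], ?_, ?_, ?_, ?_, ?_, ?_⟩ <;> simp [ua]
  · rintro i hi τ hf ⟨h1, h2, g1, g2, g3, g4, g5, g6⟩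
    rw [um] at hi
    refine runs_loopFree rfl ?_
    obtain ⟨x1, y1⟩ := ht.ea i hi
    obtain ⟨x2, y2⟩ := ht.ep i hi
    obtain ⟨x3, y3⟩ := ht.rk i hi
    have el : τ.l = σ.l := (hf.l rfl).trans ul
    have em : τ.v .m = m := (hf.v _ (by decide)).trans um
    have eT : τ.v .T = m + 1 := (hf.v _ (by decide)).trans uT
    have eone : τ.v .one = 1 := (hf.v _ (by decide)).trans uone
    have z1 : 3 + 3 * i < B := by omega
    have z2 : 3 + 3 * i + 1 < B := by omega
    have z3 : 3 + 3 * i + 1 + 1 < B := by omega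
    have s2 : 3 + 3 * i + 1 = 4 + 3 * i := by omega
    have s3 : 4 + 3 * i + 1 = 5 + 3 * i := by omega
    rw [s2] at z2 z3
    rw [s3] at z3
    generalize hω : Alg.readEdge.eval B τ = ω
    have w1 : ω.v .i = i + 1 := by rw [← hω]; simp [Alg.readEdge, h1]
    have w2 : ω.v .ptr = 3 + 3 * (i + 1) := by rw [← hω]; simp [Alg.readEdge, h2]; omega
    have a1 : ω.a .ea = Function.update (τ.a .ea) i (EA i) := by
      rw [← hω]; simp [Alg.readEdge, h1, h2, el, z1, x1, y1]
    have a2 : ω.a .ep = Function.update (τ.a .ep) i (EP i) := by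
      rw [← hω]; simp [Alg.readEdge, h1, h2, el, s2, z2, x2, y2]
    have a3 : ω.a .rk = Function.update (τ.a .rk) i (RK i) := by
      rw [← hω]; simp [Alg.readEdge, h1, h2, el, s2, s3, z3, x3, y3]
    have a4 : ω.a .res = Function.update (τ.a .res) i 1 := by
      rw [← hω]; simp [Alg.readEdge, h1, eone]
    have a5 : ω.a .src = Function.update (τ.a .src) i m := by
      rw [← hω]; simp [Alg.readEdge, h1, em]
    have a6 : ω.a .dst = Function.update (τ.a .dst) i (m + 1) := by
      rw [← hω]; simp [Alg.readEdge, h1, eT]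
    refine ⟨w1, w2, ?_, ?_, ?_, ?_, ?_, ?_⟩
    · rw [a1]; exact update_ite g1 rfl
    · rw [a2]; exact update_ite g2 rfl
    · rw [a3]; exact update_ite g3 rfl
    · rw [a4]; exact update_ite (g := fun _ => 1) g4 rfl
    · rw [a5]; exact update_ite (g := fun _ => m) g5 rfl
    · rw [a6]; exact update_ite (g := fun _ => m + 1) g6 rfl
  · rw [um] at hI
    obtain ⟨-, h2, g1, g2, g3, g4, g5, g6⟩ := hI
    refine runs_loopFree rfl ⟨⟨g1, g2, g3, g4, g5, g6⟩, ?_⟩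
    have fv : ∀ x ∈ [Var.m, .nA, .one, .zr, .T, .nx], τ.v x = υ.v x := by
      intro x hx
      refine hf.v x ?_
      revert x; decide
    simp only [List.mem_cons, List.not_mem_nil, or_false, forall_eq_or_imp, forall_eq] at fv
    obtain ⟨f1, f2, f3, f4, f5, f6⟩ := fv
    simp [f1, f2, f3, f4, f5, f6, um, unA, uone, uzr, uT, unx, h2]

/-! ### Building the network -/

/-- Arcs are prepended in increasing order, which is why the lists decrease and `nxt h ≤ h`. -/
theorem IsAdj.push {src nxt fst : ℕ → ℕ} {H : ℕ} (h : IsAdj src nxt fst H) :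
    IsAdj src (Function.update nxt H (fst (src H))) (Function.update fst (src H) (H + 1)) (H + 1) := by
  have hn : ∀ h' < H, Function.update nxt H (fst (src H)) h' = nxt h' := fun h' hh' =>
    Function.update_of_ne (by omega) _ _
  have hH : Function.update nxt H (fst (src H)) H = fst (src H) := Function.update_self ..
  refine ⟨fun u => ?_, fun u => ?_, fun h' hh' => ?_, fun h' hh' => ?_, fun h' hh' => ?_,
    fun h' hh' h'' hh'' hs => ?_⟩
  · by_cases e : u = src H
    · rw [e, Function.update_self]
    · rw [Function.update_of_ne e]; have := h.fst_le u; omega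
  · by_cases e : u = src H
    · rw [e, Function.update_self]; simp
    · rw [Function.update_of_ne e]; exact h.fst_src u
  · by_cases e : src h' = src H
    · rw [e, Function.update_self]; omega
    · rw [Function.update_of_ne e]
      have : h' ≠ H := by rintro rfl; exact e rfl
      exact h.fst_max h' (by omega)
  · by_cases e : h' = H
    · rw [e, hH]; exact h.fst_le _
    · rw [hn h' (by omega)]; exact h.nxt_le h' (by omega)
  · by_cases e : h' = H
    · rw [e, hH]; exact h.fst_src _
    · rw [hn h' (by omega)]; exact h.nxt_src h' (by omega)
  · by_cases e : h' = H
    · rw [e] at hs hh'' ⊢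
      rw [hH, ← hs]; exact h.fst_max h'' hh''
    · rw [hn h' (by omega)]; exact h.nxt_max h' (by omega) h'' hh'' hs

theorem network_spec {B m N : ℕ} {tl hd rk : ℕ → ℕ} {σ : Store} (hm : σ.v .m = m)
    (hT : σ.v .T = m + 1) (hone : σ.v .one = 1) (hzr : σ.v .zr = 0) (hnx : σ.v .nx = N)
    (hle : m + 2 ≤ N) (htl : ∀ e < N, tl e < N) (hhd : ∀ e < N, hd e < N)
    (hsrc : ∀ e < N, σ.a .src e = tl e) (hdst : ∀ e < N, σ.a .dst e = hd e)
    (hrk : ∀ e < N, σ.a .rk e = rk e) (hfst : ∀ u, σ.a .fst u = 0) :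
    Alg.network.Runs B σ (30 * (N + 1)) (Prepared m N tl hd rk) := by
  refine Runs.conseq (n := 1 + (1 + (1 + ((1 + N * (1 + Alg.reverseStep.size)) + (1 + (1 +
    (1 + (N + N) * (1 + Alg.adjStep.size)))))))) ?_ ?_ fun _ _ h => h
  swap
  · simp [Alg.reverseStep, Alg.adjStep, size]
    omega
  refine Runs.seq (runs_loopFree rfl (Runs.seq (runs_loopFree rfl (Runs.seq (runs_loopFree rfl ?_)))))
  generalize hυ : (zero .i).eval B _ = υ
  have uv : ∀ x ∈ [Var.m, .T, .one, .zr], υ.v x = σ.v x := by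
    intro x hx
    rw [← hυ]
    simp only [List.mem_cons, List.not_mem_nil, or_false] at hx
    rcases hx with rfl | rfl | rfl | rfl <;> simp
  have uN : υ.v .N = N := by rw [← hυ]; simp [hnx]
  have uh : υ.v .h = N := by rw [← hυ]; simp [hnx]
  have ui : υ.v .i = 0 := by rw [← hυ]; simp
  have ua : υ.a = σ.a := by rw [← hυ]; simp
  clear hυ
  refine Runs.seq (Runs.conseq (runs_loop (fun i τ => τ.v .i = i ∧ τ.v .h = N + i ∧
    (∀ e < N, τ.a .src e = tl e) ∧ (∀ e < N, τ.a .dst e = hd e) ∧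
    (∀ e < i, τ.a .src (N + e) = hd e) ∧ (∀ e < i, τ.a .dst (N + e) = tl e) ∧
    (∀ e < i, τ.a .rev e = N + e) ∧ (∀ e < i, τ.a .rev (N + e) = e) ∧
    (∀ e < i, τ.a .un e = e) ∧ (∀ e < i, τ.a .un (N + e) = e)) Alg.reverseStep.size ?_ ?_)
    (by rw [uN]) fun τ hf hI => ?_)
  · rw [ua]
    exact ⟨ui, by simp [uh], hsrc, hdst, by omega, by omega, by omega, by omega, by omega, by omega⟩
  · rintro i hi τ hf ⟨h1, h2, g1, g2, g3, g4, g5, g6, g7, g8⟩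
    rw [uN] at hi
    refine runs_loopFree rfl ?_
    generalize hω : Alg.reverseStep.eval B τ = ω
    have w1 : ω.v .i = i + 1 := by rw [← hω]; simp [Alg.reverseStep, h1]
    have w2 : ω.v .h = N + (i + 1) := by rw [← hω]; simp [Alg.reverseStep, h2]; omega
    have n1 : N ≠ 0 := by omega
    have a1 : ω.a .src = Function.update (τ.a .src) (N + i) (hd i) := by
      rw [← hω]; simp [Alg.reverseStep, h1, h2, n1, g2 i hi]
    have a2 : ω.a .dst = Function.update (τ.a .dst) (N + i) (tl i) := by
      rw [← hω]; simp [Alg.reverseStep, h1, h2, g1 i hi]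
    have a3 : ω.a .rev = Function.update (Function.update (τ.a .rev) i (N + i)) (N + i) i := by
      rw [← hω]; simp [Alg.reverseStep, h1, h2]
    have a4 : ω.a .un = Function.update (Function.update (τ.a .un) i i) (N + i) i := by
      rw [← hω]; simp [Alg.reverseStep, h1, h2]
    rw [a1, a2, a3, a4]
    have key : ∀ (f g : ℕ → ℕ) (n : ℕ), (∀ e < i, f (N + e) = g e) → n = g i → ∀ e < i + 1,
        Function.update f (N + i) n (N + e) = g e := by
      intro f g n hfg hn e he
      by_cases c : e = i
      · rw [c, Function.update_self, hn]
      · rw [Function.update_of_ne (by omega), hfg e (by omega)]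
    have key' : ∀ (f g : ℕ → ℕ) (n n' : ℕ), (∀ e < i, f e = g e) → n = g i → ∀ e < i + 1,
        Function.update (Function.update f i n) (N + i) n' e = g e := by
      intro f g n n' hfg hn e he
      rw [Function.update_of_ne (by omega)]
      exact update_lt hfg hn e he
    refine ⟨w1, w2, fun e he => ?_, fun e he => ?_, key _ _ _ g3 rfl, key _ _ _ g4 rfl,
      key' _ _ _ _ g5 rfl, key _ (fun e => e) _ (fun e he => ?_) rfl, key' _ (fun e => e) _ _ g7 rfl,
      key _ (fun e => e) _ (fun e he => ?_) rfl⟩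
    · rw [Function.update_of_ne (by omega), g1 e he]
    · rw [Function.update_of_ne (by omega), g2 e he]
    · rw [Function.update_of_ne (by omega), g6 e he]
    · rw [Function.update_of_ne (by omega), g8 e he]
  rw [uN] at hI
  obtain ⟨-, h2, g1, g2, g3, g4, g5, g6, g7, g8⟩ := hI
  have tN : τ.v .N = N := (hf.v _ (by decide)).trans uN
  have tv : ∀ x ∈ [Var.m, .T, .one, .zr], τ.v x = σ.v x := by
    intro x hx
    rw [hf.v x, uv x hx]
    revert x; decide
  have trk : τ.a .rk = σ.a .rk := (hf.a _ (by decide)).trans (by rw [ua])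
  have tfst : τ.a .fst = σ.a .fst := (hf.a _ (by decide)).trans (by rw [ua])
  clear hf ua uv uN uh ui υ
  refine Runs.seq (runs_loopFree rfl (Runs.seq (runs_loopFree rfl ?_)))
  generalize hυ : (zero .h).eval B _ = υ
  have uv : ∀ x ∈ [Var.m, .T, .one, .zr, .N], υ.v x = τ.v x := by
    intro x hx
    rw [← hυ]
    simp only [List.mem_cons, List.not_mem_nil, or_false] at hx
    rcases hx with rfl | rfl | rfl | rfl | rfl <;> simp
  have uN2 : υ.v .N2 = N + N := by rw [← hυ]; simp [h2]
  have uh : υ.v .h = 0 := by rw [← hυ]; simp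
  have ua : υ.a = τ.a := by rw [← hυ]; simp
  clear hυ
  refine Runs.conseq (runs_loop (fun i ω => ω.v .h = i ∧
    IsAdj (ω.a .src) (ω.a .nxt) (ω.a .fst) i) Alg.adjStep.size ?_ ?_)
    (by rw [uN2]) fun ω hf hI => ?_
  · refine ⟨uh, ?_⟩
    have e : υ.a .fst = fun _ => 0 := by rw [ua, tfst]; exact funext hfst
    rw [e]
    constructor <;> simp
  · rintro i hi χ hf ⟨h1, h3⟩
    refine runs_loopFree rfl ?_
    generalize hω : Alg.adjStep.eval B χ = ω
    have w1 : ω.v .h = i + 1 := by rw [← hω]; simp [Alg.adjStep, h1]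
    have a1 : ω.a .src = χ.a .src := by rw [← hω]; simp [Alg.adjStep]
    have a2 : ω.a .nxt = Function.update (χ.a .nxt) i (χ.a .fst (χ.a .src i)) := by
      rw [← hω]; simp [Alg.adjStep, h1]
    have a3 : ω.a .fst = Function.update (χ.a .fst) (χ.a .src i) (i + 1) := by
      rw [← hω]; simp [Alg.adjStep, h1]
    rw [a1, a2, a3]
    exact ⟨w1, h3.push⟩
  · rw [uN2] at hI
    have wv' : ∀ x ∈ [Var.m, .T, .one, .zr, .N], ω.v x = τ.v x := by
      intro x hx
      rw [hf.v x, uv x hx]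
      revert x; decide
    have wN2 : ω.v .N2 = N + N := (hf.v _ (by decide)).trans uN2
    have wa' : ∀ r ∈ [Arr.src, .dst, .rev, .un, .rk], ω.a r = τ.a r := by
      intro r hr
      rw [hf.a r, ua]
      revert r; decide
    simp only [List.mem_cons, List.not_mem_nil, or_false, forall_eq_or_imp, forall_eq] at wa' wv' tv
    obtain ⟨a1, a2, a3, a4, a5⟩ := wa'
    obtain ⟨v1, v2, v3, v4, v5⟩ := wv'
    obtain ⟨t1, t2, t3, t4⟩ := tv
    have hadj := hI.2
    constructor <;> (try simp only [a2, a3, a4, a5, v1, v2, v3, v4, v5, t1, t2, t3, t4, trk]) <;>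
      first | assumption | (rw [a1]; assumption)

end CRMM
namespace CRMM

open Cmd

attribute [local simp] eval Store.setV Store.setA Store.setL

/-! ### The network of an instance -/

/-- The path of the edge `j` consists of the nodes above it on both sides and the edge itself. -/
def onPath (m mid N : ℕ) (S S' : ℕ → ℕ → Prop) (e j : ℕ) : Prop :=
  (e < m ∧ e = j) ∨ (m + 2 ≤ e ∧ e < mid ∧ S e j) ∨ (mid ≤ e ∧ e < N ∧ S' e j)

theorem onPath_left {m mid N : ℕ} {S S' : ℕ → ℕ → Prop} {e j : ℕ} (h : m + 2 ≤ e) (h' : e < mid) :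
    onPath m mid N S S' e j ↔ S e j := by
  unfold onPath
  constructor
  · rintro (⟨_, _⟩ | ⟨_, _, h3⟩ | ⟨_, _, _⟩)
    · omega
    · exact h3
    · omega
  · exact fun h3 => .inr (.inl ⟨h, h', h3⟩)

theorem onPath_right {m mid N : ℕ} {S S' : ℕ → ℕ → Prop} {e j : ℕ} (hm : m + 2 ≤ mid)
    (h : mid ≤ e) (h' : e < N) : onPath m mid N S S' e j ↔ S' e j := by
  unfold onPath
  constructor
  · rintro (⟨_, _⟩ | ⟨_, _, _⟩ | ⟨_, _, h3⟩)
    · omega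
    · omega
    · exact h3
  · exact fun h3 => .inr (.inr ⟨h, h', h3⟩)

/-- The path of an edge goes down the applicant's tree, through the edge, and up the post's tree to
the sink; `tele` is the sum of three telescoping identities. The nodes of the two sides are `m + 2`
to `mid - 1` and `mid` to `N - 1`. -/
theorem isNet_of_trees {m mid N : ℕ} {σ₁ σ₂ σ₃ σ₄ : Store} {S S' : ℕ → ℕ → Prop}
    (hmid : m + 2 ≤ mid) (hN : mid ≤ N) (hx : σ₂.v .nx = mid) (hx' : σ₄.v .nx = N)
    (h : TreeState m (m + 2) m .src .dst σ₁ S σ₂) (h' : TreeState m mid (m + 1) .dst .src σ₃ S' σ₄)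
    (ha : σ₃.a = σ₂.a) (hres : ∀ j, σ₁.a .res j = if j < m then 1 else 0) :
    IsNet m N (σ₄.a .src) (σ₄.a .dst) (σ₄.a .res) (onPath m mid N S S') := by
  have hf := h.forest
  have hf' := h'.forest
  rw [hx] at hf
  rw [hx'] at hf'
  have s1 : ∀ y < mid, σ₄.a .src y = σ₂.a .src y := fun y hy => by rw [h'.R' y (.inl hy), ha]
  have s2 : ∀ y, m ≤ y → y < mid → σ₄.a .dst y = σ₂.a .dst y := fun y hy hy' => by
    rw [h'.R y hy (.inl hy'), ha]
  have s3 : ∀ y < mid, σ₄.a .res y = σ₂.a .res y := fun y hy => by rw [h'.res y (.inl hy), ha]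
  have tA : ∀ x, m + 2 ≤ x → x < mid → σ₄.a .dst x = x := fun x hx1 hx2 => by
    rw [s2 x (by omega) hx2, h.self x hx1 (by omega)]
  have tP : ∀ x, mid ≤ x → x < N → σ₄.a .src x = x := fun x hx1 hx2 => h'.self x hx1 (by omega)
  refine ⟨by omega, fun e he j hj => ?_, fun j hj => ?_, fun e he he' => ⟨?_, fun j hj hon => ?_⟩,
    fun j hj φ => ?_, fun x hx1 hx2 => ?_⟩
  · unfold onPath
    constructor
    · rintro (⟨_, h3⟩ | ⟨_, _, _⟩ | ⟨_, _, _⟩)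
      · exact h3
      · omega
      · omega
    · exact fun h3 => .inl ⟨he, h3⟩
  · rw [s3 j (by omega), h.res j (.inl (by omega)), hres, if_pos hj]
  · rw [s3 e (by omega), h.res e (.inl (by omega)), hres, if_neg (by omega)]
  · rcases hon with ⟨_, _⟩ | ⟨_, _, _⟩ | ⟨_, _, _⟩ <;> omega
  · classical
    have hA := hf.tele j hj φ (fun x => S x j) inferInstance fun _ => Iff.rfl
    have hP := hf'.tele j hj φ (fun x => S' x j) inferInstance fun _ => Iff.rfl
    rw [Finset.range_eq_Ico, ← Finset.sum_Ico_consecutive _ (Nat.zero_le mid) hN,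
      ← Finset.sum_Ico_consecutive _ (Nat.zero_le (m + 2)) hmid, ← Finset.range_eq_Ico]
    have e1 : ∑ e ∈ Finset.range (m + 2), (if onPath m mid N S S' e j then
        φ (σ₄.a .dst e) - φ (σ₄.a .src e) else 0) = φ (σ₄.a .dst j) - φ (σ₂.a .src j) := by
      rw [Finset.sum_eq_single_of_mem j (Finset.mem_range.2 (by omega)), if_pos, s1 j (by omega)]
      · exact .inl ⟨hj, rfl⟩
      · intro e he hne
        rw [if_neg]
        have := Finset.mem_range.1 he
        rintro (⟨_, _⟩ | ⟨_, _, _⟩ | ⟨_, _, _⟩) <;> omega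
    have e2 : ∑ e ∈ Finset.Ico (m + 2) mid, (if onPath m mid N S S' e j then
        φ (σ₄.a .dst e) - φ (σ₄.a .src e) else 0) = φ (σ₂.a .src j) - φ m := by
      rw [← hA]
      refine Finset.sum_congr rfl fun x hx0 => ?_
      obtain ⟨x1, x2⟩ := Finset.mem_Ico.1 hx0
      rw [tA x x1 x2, s1 x x2]
      exact if_congr (onPath_left x1 x2) rfl rfl
    have e3 : ∑ e ∈ Finset.Ico mid N, (if onPath m mid N S S' e j then
        φ (σ₄.a .dst e) - φ (σ₄.a .src e) else 0) = φ (m + 1) - φ (σ₄.a .dst j) := by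
      rw [← neg_sub, ← hP, ← Finset.sum_neg_distrib]
      refine Finset.sum_congr rfl fun x hx0 => ?_
      obtain ⟨x1, x2⟩ := Finset.mem_Ico.1 hx0
      rw [tP x x1 x2, if_congr (onPath_right hmid x1 x2) rfl rfl]
      split_ifs <;> ring
    rw [e1, e2, e3]
    ring
  · rcases Nat.lt_or_ge x mid with hlt | hge
    · refine .inl ⟨tA x hx1 hlt, ?_⟩
      rw [s1 x hlt]
      exact hf.lt x hx1 hlt
    · exact .inr ⟨tP x hge hx2, hf'.lt x hge hx2⟩

/-- A set of edges obeys the quotas of the vertices of one side and of their classes. -/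
def Lists.Obeys (L : Lists) (m : ℕ) (V O : ℕ → ℕ) (M : Finset ℕ) : Prop :=
  ∀ j₀ < m, (M.filter fun j => V j = V j₀).card ≤ L.q (V j₀) ∧
    ∀ t < L.nc (V j₀), (M.filter fun j => V j = V j₀ ∧ O j ∈ L.cls (V j₀) t).card ≤
      L.cq (V j₀) t

theorem card_filter_le_of_subset {m : ℕ} {M : Finset ℕ} (hM : M ⊆ Finset.range m) (p : ℕ → Prop)
    [DecidablePred p] : (M.filter p).card ≤ m :=
  (Finset.card_filter_le _ _).trans ((Finset.card_le_card hM).trans (by simp))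

/-- Capacities were capped at `B`, which is harmless because no load exceeds `m ≤ B`. An empty class
has no node, but its constraint is void. -/
theorem SideDone.obeys_iff {L : Lists} {B m lo root : ℕ} {V O : ℕ → ℕ} {R R' : Arr} {σ τ : Store}
    {S : ℕ → ℕ → Prop} (h : SideDone L B m lo root V O R R' σ S τ) (hB : m ≤ B) {M : Finset ℕ}
    (hM : M ⊆ Finset.range m) :
    (∀ x, lo ≤ x → x < τ.v .nx → load S M x ≤ τ.a .res x) ↔ L.Obeys m V O M := by
  classical
  have hload : ∀ x (p : ℕ → Prop) [DecidablePred p], (∀ j < m, S x j ↔ p j) →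
      load S M x = (M.filter p).card := by
    intro x p _ hp
    unfold load
    congr 1
    exact Finset.filter_congr fun j hj => hp j (Finset.mem_range.1 (hM hj))
  have hroot : ∀ x j₀, L.IsRoot B m V S τ x j₀ →
      (load S M x ≤ τ.a .res x ↔ (M.filter fun j => V j = V j₀).card ≤ L.q (V j₀)) := by
    rintro x j₀ ⟨h1, h2⟩
    rw [hload x _ h1, h2]
    have := card_filter_le_of_subset hM fun j => V j = V j₀
    omega
  have hcls : ∀ x j₀ t, L.IsClass B m V O S τ x j₀ t → (load S M x ≤ τ.a .res x ↔
      (M.filter fun j => V j = V j₀ ∧ O j ∈ L.cls (V j₀) t).card ≤ L.cq (V j₀) t) := by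
    rintro x j₀ t ⟨h1, h2⟩
    rw [hload x _ h1, h2]
    have := card_filter_le_of_subset hM fun j => V j = V j₀ ∧ O j ∈ L.cls (V j₀) t
    omega
  constructor
  · intro hx j₀ hj₀
    refine ⟨?_, fun t ht => ?_⟩
    · obtain ⟨x, x1, x2, x3⟩ := h.roots j₀ hj₀
      exact (hroot x j₀ x3).1 (hx x x1 x2)
    · rcases (L.cls (V j₀) t).eq_empty_or_nonempty with he | hne
      · simp [he]
      · obtain ⟨x, x1, x2, x3⟩ := h.classes j₀ hj₀ t ht hne
        exact (hcls x j₀ t x3).1 (hx x x1 x2)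
  · intro ho x x1 x2
    obtain ⟨j₀, hj₀, hr | ⟨t, ht, hc⟩⟩ := h.desc x x1 x2
    · exact (hroot x j₀ hr).2 (ho j₀ hj₀).1
    · exact (hcls x j₀ t hc).2 ((ho j₀ hj₀).2 t ht)

theorem load_congr {on on' : ℕ → ℕ → Prop} {M : Finset ℕ} {e : ℕ} (h : ∀ j, on e j ↔ on' e j) :
    load on M e = load on' M e := by
  classical
  unfold load
  congr 1
  exact Finset.filter_congr fun j _ => h j

/-! ### Writing the matching -/

/-- The number of edges is known only after the scan, so cell 0 is left free for it and written
last. -/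
theorem output_spec {B m N : ℕ} {σ : Store} (hm : σ.v .m = m) (hN : σ.v .N = N)
    (hone : σ.v .one = 1) (hzr : σ.v .zr = 0) (hB : 2 * m + 1 ≤ B) :
    Alg.output.Runs B σ (40 * (m + 1)) fun τ =>
      τ.l 0 = ((List.range m).filter fun e => 0 < flow N σ e).length ∧
      ∀ i e, ((List.range m).filter fun e => 0 < flow N σ e)[i]? = some e →
        τ.l (1 + 2 * i) = σ.a .ea e ∧ τ.l (2 + 2 * i) = σ.a .ep e := by
  refine Runs.conseq (n := 1 + (1 + (1 + (1 + ((1 + m * (1 + Alg.outStep.size)) + 1))))) ?_ ?_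
    fun _ _ h => h
  swap
  · simp [Alg.outStep, size]
    omega
  refine Runs.seq (runs_loopFree rfl (Runs.seq (runs_loopFree rfl (Runs.seq (runs_loopFree rfl
    (Runs.seq (runs_loopFree rfl ?_)))))))
  generalize hυ : (copy .h .N).eval B _ = υ
  have uv : ∀ x ∈ [Var.m, .one, .zr, .N], υ.v x = σ.v x := by
    intro x hx
    rw [← hυ]
    simp only [List.mem_cons, List.not_mem_nil, or_false] at hx
    rcases hx with rfl | rfl | rfl | rfl <;> simp
  have uh : υ.v .h = N := by rw [← hυ]; simp [hN]
  have uj : υ.v .j = 0 := by rw [← hυ]; simp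
  have uc : υ.v .cnt = 0 := by rw [← hυ]; simp
  have up : υ.v .ptr = 1 := by rw [← hυ]; simp [hone]
  have ua : υ.a = σ.a := by rw [← hυ]; simp
  clear hυ
  refine Runs.seq (Runs.conseq (runs_loop (fun j τ => τ.v .j = j ∧ τ.v .h = N + j ∧
    τ.v .cnt = ((List.range j).filter fun e => 0 < flow N σ e).length ∧
    τ.v .ptr = 1 + 2 * ((List.range j).filter fun e => 0 < flow N σ e).length ∧
    ∀ i e, ((List.range j).filter fun e => 0 < flow N σ e)[i]? = some e →
        τ.l (1 + 2 * i) = σ.a .ea e ∧ τ.l (2 + 2 * i) = σ.a .ep e) Alg.outStep.size ?_ ?_)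
    (by rw [uv _ (by simp), hm]) fun τ hf hI => ?_)
  · exact ⟨uj, by simp [uh], by simp [uc], by simp [up], by simp⟩
  · rintro j hj τ hf ⟨h1, h2, h3, h4, h5⟩
    rw [uv _ (by simp), hm] at hj
    have ea : τ.a = σ.a := by
      rw [← ua]; funext r; exact hf.a r (by simp [Alg.outStep, wa])
    have ezr : τ.v .zr = 0 := by rw [hf.v _ (by decide), uv _ (by simp), hzr]
    refine runs_loopFree rfl ?_
    have hlen : ((List.range j).filter fun e => 0 < flow N σ e).length ≤ j :=
      (List.length_filter_le _ _).trans (by simp)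
    rw [List.range_succ, List.filter_append]
    set L := (List.range j).filter fun e => 0 < flow N σ e with hL
    by_cases c : 0 < flow N σ j
    · have c' : 0 < σ.a .res (N + j) := c
      have z1 : 1 + 2 * L.length < B := by omega
      have z2 : 2 + 2 * L.length < B := by omega
      have s : 1 + 2 * L.length + 1 = 2 + 2 * L.length := by omega
      have w1 : (Alg.outStep.eval B τ).v .j = j + 1 := by
        simp [Alg.outStep, h1, h2, h4, ea, ezr, c', z1, s, z2]
      have w2 : (Alg.outStep.eval B τ).v .h = N + (j + 1) := by
        simp [Alg.outStep, h1, h2, h4, ea, ezr, c', z1, s, z2]; omega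
      have w3 : (Alg.outStep.eval B τ).v .cnt = L.length + 1 := by
        simp [Alg.outStep, h1, h2, h3, h4, ea, ezr, c', z1, s, z2]
      have w4 : (Alg.outStep.eval B τ).v .ptr = 1 + 2 * (L.length + 1) := by
        simp [Alg.outStep, h1, h2, h4, ea, ezr, c', z1, s, z2]; omega
      have w5 : (Alg.outStep.eval B τ).l = Function.update (Function.update τ.l
          (1 + 2 * L.length) (σ.a .ea j)) (2 + 2 * L.length) (σ.a .ep j) := by
        simp [Alg.outStep, h1, h2, h4, ea, ezr, c', z1, s, z2]
      rw [w1, w2, w3, w4, w5]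
      refine ⟨rfl, rfl, by simp [c], by simp [c], fun i e he => ?_⟩
      rw [List.filter_singleton] at he
      simp only [c, decide_true, cond_true] at he
      rw [List.getElem?_append] at he
      split_ifs at he with hi
      · rw [Function.update_of_ne (by omega), Function.update_of_ne (by omega),
          Function.update_of_ne (by omega), Function.update_of_ne (by omega)]
        exact h5 i e he
      · have hi' : i = L.length := by
          have := (List.getElem?_eq_some_iff.1 he).1
          simp at this
          omega
        subst hi'
        simp at he
        subst he
        rw [Function.update_of_ne (by omega), Function.update_self, Function.update_self]
        exact ⟨rfl, rfl⟩
    · have c' : σ.a .res (N + j) = 0 := by unfold flow at c; omega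
      have w1 : (Alg.outStep.eval B τ).v .j = j + 1 := by
        simp [Alg.outStep, h1, h2, ea, ezr, c']
      have w2 : (Alg.outStep.eval B τ).v .h = N + (j + 1) := by
        simp [Alg.outStep, h2, ea, ezr, c']; omega
      have w3 : (Alg.outStep.eval B τ).v .cnt = L.length := by
        simp [Alg.outStep, h2, h3, ea, ezr, c']
      have w4 : (Alg.outStep.eval B τ).v .ptr = 1 + 2 * L.length := by
        simp [Alg.outStep, h2, h4, ea, ezr, c']
      have w5 : (Alg.outStep.eval B τ).l = τ.l := by
        simp [Alg.outStep, h2, ea, ezr, c']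
      rw [w1, w2, w3, w4, w5]
      refine ⟨rfl, rfl, by simp [c], by simp [c], fun i e he => ?_⟩
      refine h5 i e ?_
      simpa [c] using he
  · rw [uv _ (by simp), hm] at hI
    obtain ⟨-, -, h3, h4, h5⟩ := hI
    have ezr : τ.v .zr = 0 := by rw [hf.v _ (by decide), uv _ (by simp), hzr]
    have hB0 : 0 < B := by omega
    refine runs_loopFree rfl ?_
    have w : ((write .zr .cnt).eval B τ).l = Function.update τ.l 0 (τ.v .cnt) := by
      simp [ezr, hB0]
    rw [w]
    refine ⟨by rw [Function.update_self, h3], fun i e he => ?_⟩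
    rw [Function.update_of_ne (by omega), Function.update_of_ne (by omega)]
    exact h5 i e he

end CRMM
namespace CRMM

open Cmd

attribute [local simp] eval Store.setV Store.setA Store.setL

/-! ### Correctness of the algorithm -/

theorem netIn_zero (N : ℕ) (tl hd : ℕ → ℕ) {f : ℕ → ℕ} (hf : ∀ e < N, f e = 0) (x : ℕ) :
    netIn N tl hd f x = 0 :=
  Finset.sum_eq_zero fun e he => by simp [hf e (Finset.mem_range.1 he)]

theorem upTo_of_le {m : ℕ} {rk : ℕ → ℕ} (hrk : ∀ j < m, rk j ≤ m) {M : Finset ℕ}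
    (hM : M ⊆ Finset.range m) {i : ℕ} (hi : m ≤ i) : upTo rk M i = upTo rk M m := by
  unfold upTo
  congr 1
  refine Finset.filter_congr fun j hj => ?_
  have := hrk j (Finset.mem_range.1 (hM hj))
  omega

/-- After `2 m` phases, the flow describes an optimal matching. -/
theorem PhaseInv.optimal {m N : ℕ} {tl hd cp rk : ℕ → ℕ} {on : ℕ → ℕ → Prop} {σ : Store}
    (hN : IsNet m N tl hd cp on) (hrk : ∀ j < m, rk j ≤ m)
    (h : PhaseInv m N tl hd cp rk on (m + m) σ) :
    Feas m N cp on (support m (flow N σ)) ∧ ∀ M', Feas m N cp on M' →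
      NotWorse rk m M' (support m (flow N σ)) →
      ∀ i ≤ m, upTo rk M' i = upTo rk (support m (flow N σ)) i := by
  set M := support m (flow N σ) with hM
  have hs := h.settled
  have hMs : M ⊆ Finset.range m := support_subset m _
  have h1 := flow_eq_load hN (f := flow N σ) (fun e he => by
    have := h.cap e he
    unfold flow
    omega) h.cons
  have h2 : netIn N tl hd (flow N σ) (m + 1) = M.card := by
    rw [netIn_congr tl hd h1, ← hM, netIn_load hN hMs, if_pos rfl, if_neg (by omega)]
    simp
  have h3 : M.card ≤ m := (Finset.card_le_card hMs).trans (by simp)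
  have h4 := h.count
  -- Flow value plus `k` is `2 m + 1` and the value is at most `m`, so all ranks up to `m` are
  -- closed.
  have hk : m ≤ σ.v .k - 1 := by
    rw [h2] at h4
    push_cast at h4
    omega
  refine ⟨hs.feas, fun M' hf hw i hi => ?_⟩
  have hw' : NotWorse rk (σ.v .k - 1) M' M := by
    rcases hw with hw | ⟨i, hi, hw⟩
    · refine .inl fun i _ => ?_
      rcases Nat.le_total i m with h' | h'
      · exact hw i h'
      · rw [upTo_of_le hrk hf.1 h', upTo_of_le hrk hMs h', hw m le_rfl]
    · exact .inr ⟨i, by omega, hw⟩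
  exact hs.sound M' hf (hs.complete M' hf hw') i (by omega)

/-- The matching consists of the edges `M`, obeys all quotas, and is optimal. -/
structure Solves (m : ℕ) (EA EP RK : ℕ → ℕ) (L L' : Lists) (M : Finset ℕ) : Prop where
  subset : M ⊆ Finset.range m
  obeys : L.Obeys m EA EP M
  obeys' : L'.Obeys m EP EA M
  optimal : ∀ M' ⊆ Finset.range m, L.Obeys m EA EP M' → L'.Obeys m EP EA M' →
    NotWorse RK m M' M → ∀ i ≤ m, upTo RK M' i = upTo RK M i

/-- The problem is stated in terms of edge numbers only. The tables vanish from `m` on, as the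
arrays do, so both coincide as functions and can be rewritten into each other. -/
theorem main_spec {B m nA : ℕ} {EA EP RK : ℕ → ℕ} {L L' : Lists} {σ : Store}
    (ht : EdgeTable B m nA EA EP RK σ.l) (ha : ∀ r j, σ.a r j = 0)
    (hEA : ∀ j, m ≤ j → EA j = 0) (hEP : ∀ j, m ≤ j → EP j = 0) (hRK : ∀ j, m ≤ j → RK j = 0)
    (hRK' : ∀ j < m, 1 ≤ RK j ∧ RK j ≤ m)
    (hL : L.Valid B m (3 + 3 * m) σ.l EA EP) (hL' : L'.Valid B m (3 + 3 * m + nA) σ.l EP EA)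
    (hB : 3 + 3 * m + nA ≤ B) :
    Alg.main.Runs B σ (20000 * (m + 1) ^ 2) fun τ => ∃ l : List ℕ, l.Nodup ∧
      Solves m EA EP RK L L' l.toFinset ∧ τ.l 0 = l.length ∧
      ∀ i e, l[i]? = some e → τ.l (1 + 2 * i) = EA e ∧ τ.l (2 + 2 * i) = EP e := by
  -- `9 * m + 3` bounds `N + 1`: the first `m + 2` numbers are reserved, and each side adds at most
  -- `4 m` nodes.
  refine Runs.conseq (n := 40 * (m + 1) + (400 * (m + 1) ^ 2 + (1 + (1 + (400 * (m + 1) ^ 2 +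
    (30 * (9 * m + 3) + (1 + (1 + ((1 + m * (1 + 400 * (9 * m + 3))) +
      ((1 + m * (1 + 400 * (9 * m + 3))) + 40 * (m + 1)))))))))))
    ?_ ?_ fun _ _ h => h
  swap
  · nlinarith
  refine Runs.seq ((readEdges_spec ht ha).conseq le_rfl fun σ₁ hf₁ h => ?_)
  obtain ⟨⟨r1, r2, r3, r4, r5, r6⟩, vm, vnA, vone, vzr, vT, vnx, vptr, vbase⟩ := h
  have eEA : σ₁.a .ea = EA := by
    funext j; rw [r1 j]; split_ifs with h
    · rfl
    · exact (hEA j (by omega)).symm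
  have eEP : σ₁.a .ep = EP := by
    funext j; rw [r2 j]; split_ifs with h
    · rfl
    · exact (hEP j (by omega)).symm
  have eRK : σ₁.a .rk = RK := by
    funext j; rw [r3 j]; split_ifs with h
    · rfl
    · exact (hRK j (by omega)).symm
  have l₁ : σ₁.l = σ.l := hf₁.l rfl
  have z₁ : ∀ r, r ∉ [Arr.ea, .ep, .rk, .res, .src, .dst] → ∀ j, σ₁.a r j = 0 := by
    intro r hr j
    rw [hf₁.a r]
    · exact ha r j
    · simp [Alg.readEdges, Alg.readHeader, Alg.readEdge, wa] at hr ⊢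
      tauto
  clear hf₁
  -- the trees of the applicants
  refine Runs.seq ((side_spec (L := L) (B := B) (root := m) (.inl ⟨rfl, rfl, rfl, rfl, rfl⟩)
    (by rw [vbase, l₁, eEA, eEP]; exact hL) le_rfl vm vone vnx (z₁ _ (by decide))
    (fun y => by rw [z₁ _ (by decide)]; omega) (fun j hj => by rw [r5, if_pos hj])
    (by omega)).conseq le_rfl fun σ₂ hf₂ ⟨S, h₂⟩ => ?_)
  rw [eEA, eEP] at h₂
  have v₂ : ∀ x ∈ [Var.m, .nA, .one, .zr, .T, .ptr], σ₂.v x = σ₁.v x := by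
    intro x hx; refine hf₂.v x ?_; revert x; decide
  have a₂ : ∀ r ∈ [Arr.ea, .ep, .rk, .snP, .fst, .dd], σ₂.a r = σ₁.a r := by
    intro x hx; refine hf₂.a x ?_; revert x; decide
  have l₂ : σ₂.l = σ.l := (hf₂.l rfl).trans l₁
  clear hf₂
  refine Runs.seq (runs_loopFree rfl (Runs.seq (runs_loopFree rfl ?_)))
  generalize hσ₃ : (add .base .base .nA).eval B _ = σ₃
  have base₃ : σ₃.v .base = 3 + 3 * m + nA := by
    rw [← hσ₃]; simp [v₂, vptr, vnA, hB]
  have v₃ : ∀ x, x ≠ Var.base → σ₃.v x = σ₂.v x := by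
    intro x hx; rw [← hσ₃]; simp [Function.update_of_ne hx]
  have a₃ : σ₃.a = σ₂.a := by rw [← hσ₃]; simp
  have l₃ : σ₃.l = σ.l := by rw [← hσ₃]; simpa using l₂
  clear hσ₃
  -- the trees of the posts
  set mid := σ₂.v .nx with hmid
  have hmid₁ := h₂.tree.lo_le
  have hmid₂ := h₂.nx_le
  refine Runs.seq ((side_spec (L := L') (B := B) (lo := mid) (root := m + 1) (m := m) (σ := σ₃)
    (.inr ⟨rfl, rfl, rfl, rfl, rfl⟩) ?_ hmid₁ ?_ ?_ ?_ ?_ ?_ ?_ ?_).conseq le_rfl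
    fun σ₄ hf₄ ⟨S', h₄⟩ => ?_)
  · rw [base₃, l₃, a₃, a₂ _ (by simp), a₂ _ (by simp), eEA, eEP]; exact hL'
  · rw [v₃ _ (by decide), v₂ _ (by simp), vm]
  · rw [v₃ _ (by decide), v₂ _ (by simp), vone]
  · rw [v₃ _ (by decide)]
  · intro v; rw [a₃, a₂ _ (by simp), z₁ _ (by decide)]
  · intro y; rw [a₃]; exact h₂.mark y
  · intro j hj; rw [a₃, h₂.tree.R' j (.inl (by omega)), r6, if_pos hj]
  · omega
  rw [a₃, a₂ _ (by simp), a₂ _ (by simp), eEA, eEP] at h₄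
  have v₄ : ∀ x ∈ [Var.m, .one, .zr, .T], σ₄.v x = σ₁.v x := by
    intro x hx
    rw [hf₄.v x, v₃ x, v₂ x]
    all_goals revert x; decide
  have a₄ : ∀ r ∈ [Arr.ea, .ep, .rk, .fst, .dd], σ₄.a r = σ₁.a r := by
    intro x hx
    rw [hf₄.a x, a₃, a₂ x]
    all_goals revert x; decide
  clear hf₄
  -- the network
  set N := σ₄.v .nx with hN
  have hN₁ := h₄.tree.lo_le
  have hN₂ := h₄.nx_le
  rw [← hN] at hN₁ hN₂
  have hnet := isNet_of_trees hmid₁ hN₁ hmid.symm hN.symm h₂.tree h₄.tree a₃ r4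
  set tl := σ₄.a .src with htl
  set hd := σ₄.a .dst with hhd
  set cp := σ₄.a .res with hcp
  have hs1 : ∀ e < N, tl e < N ∧ hd e < N := by
    intro e he
    by_cases he2 : m + 2 ≤ e
    · rcases hnet.tree e he2 he with ⟨_, _⟩ | ⟨_, _⟩ <;> omega
    · have t1 : tl e = σ₂.a .src e := by
        rw [htl, h₄.tree.R' e (.inl (by omega)), a₃]
      by_cases hem : e < m
      · have := h₂.tree.forest.lt_edge e hem
        have := h₄.tree.forest.lt_edge e hem
        rw [← hhd] at this
        omega
      -- The unused arcs `m` and `m + 1` have both ends at node 0, the default content of the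
      -- arrays.
      · have t2 : hd e = 0 := by
          rw [hhd, h₄.tree.R e (by omega) (.inl (by omega)), a₃, h₂.tree.R' e (.inl (by omega)),
            r6, if_neg hem]
        rw [h₂.tree.R e (by omega) (.inl (by omega)), r5, if_neg hem] at t1
        omega
  refine Runs.seq ((network_spec (m := m) (N := N) (tl := tl) (hd := hd) (rk := RK) (σ := σ₄)
    ((v₄ _ (by simp)).trans vm) ((v₄ _ (by simp)).trans vT) ((v₄ _ (by simp)).trans vone)
    ((v₄ _ (by simp)).trans vzr) rfl (by omega) (fun e he => (hs1 e he).1) (fun e he => (hs1 e he).2)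
    (fun _ _ => rfl) (fun _ _ => rfl) (fun e _ => by rw [a₄ _ (by simp), eRK])
    (fun u => by rw [a₄ _ (by simp), z₁ _ (by decide)])).conseq (by omega)
    fun σ₅ hf₅ hprep => ?_)
  have a₅ : ∀ r ∈ [Arr.ea, .ep, .dd], σ₅.a r = σ₁.a r := by
    intro x hx
    rw [hf₅.a x, a₄ x]
    all_goals revert x; decide
  have res₅ : σ₅.a .res = cp := hf₅.a _ (by decide)
  clear hf₅
  refine Runs.seq (runs_loopFree rfl (Runs.seq (runs_loopFree rfl ?_)))
  have hprep' := hprep.of_frame (frame B (zero .k ;; succ .k) σ₅) (by decide) (by decide)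
  have hf₆ := frame B (zero .k ;; succ .k) σ₅
  have hk : ((zero .k ;; succ .k).eval B σ₅).v .k = 1 := by simp
  change ((loop .m Alg.phase) ;; _).Runs B ((zero .k ;; succ .k).eval B σ₅) _ _
  generalize (zero .k ;; succ .k).eval B σ₅ = σ₆ at hprep' hf₆ hk
  have a₆ : σ₆.a = σ₅.a := funext fun r => hf₆.a r (by simp [wa])
  have flow₆ : ∀ e < N, flow N σ₆ e = 0 := by
    intro e he
    unfold flow
    rw [a₆, res₅, hcp, h₄.tree.res _ (.inr (by omega)), a₃, h₂.tree.res _ (.inr (by omega)), r4,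
      if_neg (by omega)]
  have hempty : support m (flow N σ₆) = ∅ := by
    refine Finset.filter_eq_empty_iff.2 fun j hj => ?_
    rw [flow₆ j (by have := Finset.mem_range.1 hj; omega)]
    simp
  have hP0 : PhaseInv m N tl hd cp RK (onPath m mid N S S') 0 σ₆ := by
    refine ⟨hprep', by omega, fun e he => ?_, fun x _ => netIn_zero _ _ _ flow₆ x,
      fun j hj _ => flow₆ j (by omega), ?_, ?_⟩
    · have := flow₆ e he
      unfold flow at this
      rw [this, a₆, res₅, add_zero]
    · rw [hk, hempty]
      refine (settled_zero ⟨by simp, fun e _ => ?_⟩ fun j hj => (hRK' j hj).1).mono_dead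
        fun e _ => ?_
      · simp [load]
      · rw [a₆, a₅ _ (by simp), z₁ _ (by decide)]
        simp
    · rw [netIn_zero _ _ _ flow₆, hk]
      simp
  -- the phases
  refine Runs.seq ((runs_loop (fun i τ => PhaseInv m N tl hd cp RK (onPath m mid N S S') i τ)
    (400 * (N + 1)) hP0 fun i _ τ _ h => phase_spec hnet hRK h).conseq
    (by rw [hprep'.vm]; exact Nat.add_le_add_left (Nat.mul_le_mul_left _ (by omega)) _) fun σ₇ hf₇ hP => ?_)
  rw [hprep'.vm] at hP
  refine Runs.seq ((runs_loop (fun i τ => PhaseInv m N tl hd cp RK (onPath m mid N S S') (m + i) τ)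
    (400 * (N + 1)) hP fun i _ τ _ h => phase_spec hnet hRK h).conseq
    (by rw [hP.prep.vm]; exact Nat.add_le_add_left (Nat.mul_le_mul_left _ (by omega)) _) fun σ₈ hf₈ hP8 => ?_)
  rw [hP.prep.vm] at hP8
  have a₈ : ∀ r ∈ [Arr.ea, .ep], σ₈.a r = σ₁.a r := by
    intro x hx
    rw [hf₈.a x, hf₇.a x, a₆, a₅ x]
    all_goals revert x; decide
  have hopt := hP8.optimal hnet fun j hj => (hRK' j hj).2
  have hfeas : ∀ M ⊆ Finset.range m, Feas m N cp (onPath m mid N S S') M ↔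
      L.Obeys m EA EP M ∧ L'.Obeys m EP EA M := by
    intro M hM
    rw [← h₂.obeys_iff (by omega) hM, ← h₄.obeys_iff (by omega) hM]
    constructor
    · intro h
      refine ⟨fun x x1 x2 => ?_, fun x x1 x2 => ?_⟩
      · have := h.2 x (by omega)
        rwa [load_congr fun j => onPath_left x1 x2, hcp, h₄.tree.res x (.inl x2), a₃] at this
      · have := h.2 x x2
        rwa [load_congr fun j => onPath_right hmid₁ x1 x2] at this
    · rintro ⟨h1, h2⟩
      refine ⟨hM, fun x x2 => ?_⟩
      rcases Nat.lt_or_ge x mid with c | c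
      · rcases Nat.lt_or_ge x (m + 2) with c' | c'
        · rcases Nat.lt_or_ge x m with c'' | c''
          · rw [load_edge hnet hM c'', hnet.cp_edge x c'']
            split_ifs <;> omega
          · rw [load_dummy hnet hM c'' c']; omega
        · rw [load_congr fun j => onPath_left c' c, hcp, h₄.tree.res x (.inl c), a₃]
          exact h1 x c' c
      · rw [load_congr fun j => onPath_right hmid₁ c x2]
        exact h2 x c x2
  have hp8 := hP8.prep
  refine (output_spec hp8.vm hp8.vN hp8.one hp8.zr (by omega)).conseq le_rfl fun τ _ h => ?_
  have hset : ((List.range m).filter fun e => 0 < flow N σ₈ e).toFinset =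
      support m (flow N σ₈) := by
    ext e
    simp [support]
  refine ⟨_, List.nodup_range.filter _, ?_, h.1, fun i e he => ?_⟩
  · rw [hset]
    have hM := support_subset m (flow N σ₈)
    have ho := (hfeas _ hM).1 hopt.1
    exact ⟨hM, ho.1, ho.2, fun M' hM' o1 o2 hw => hopt.2 M' ((hfeas M' hM').2 ⟨o1, o2⟩) hw⟩
  · have := h.2 i e he
    rwa [a₈ _ (by simp), a₈ _ (by simp), eEA, eEP] at this

end CRMM
namespace CRMM

/-! ### Laminar families -/

/-- A laminar family of subsets of a set with `d` elements has at most `2 d + 1` members. -/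
theorem card_laminar_le {α : Type*} [DecidableEq α] (D : Finset α) : ∀ F : Finset (Finset α),
    (∀ X ∈ F, X ⊆ D) → (∀ X ∈ F, ∀ Y ∈ F, X ⊆ Y ∨ Y ⊆ X ∨ Disjoint X Y) →
    F.card ≤ 2 * D.card + 1 := by
  induction D using Finset.induction_on with
  | empty =>
    intro F hF _
    have : F ⊆ {∅} := fun X hX => by simpa using hF X hX
    simpa using Finset.card_le_card this
  | insert a D ha ih =>
    intro F hF hl
    -- Removing `a` from all members leaves a laminar family over `D`. Two members can become equal
    -- only if they are some `X` and `X ∪ {a}`.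
    have h1 := ih (F.image fun X => X.erase a) (by
      intro X hX
      obtain ⟨Y, hY, rfl⟩ := Finset.mem_image.1 hX
      intro x hx
      have := hF Y hY (Finset.mem_of_mem_erase hx)
      exact (Finset.mem_insert.1 this).resolve_left (Finset.ne_of_mem_erase hx)) (by
      intro X hX Y hY
      obtain ⟨X', hX', rfl⟩ := Finset.mem_image.1 hX
      obtain ⟨Y', hY', rfl⟩ := Finset.mem_image.1 hY
      rcases hl X' hX' Y' hY' with h | h | h
      · exact .inl (Finset.erase_subset_erase a h)
      · exact .inr (.inl (Finset.erase_subset_erase a h))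
      · exact .inr (.inr (h.mono (Finset.erase_subset _ _) (Finset.erase_subset _ _))))
    -- Let `X` and `Y` contain `a`, differ from `{a}`, and remain members when `a` is removed.
    -- Comparing full sets with shortened ones, which `a` distinguishes, forces `X ⊆ Y`; by symmetry
    -- at most one such set exists.
    have huniq : ∀ X ∈ F, ∀ Y ∈ F, a ∈ X → a ∈ Y → X.erase a ∈ F → Y.erase a ∈ F → X ≠ {a} →
        Y ≠ {a} → X ⊆ Y := by
      intro X hX Y hY haX haY hX' hY' hXa hYa
      rcases hl X hX (Y.erase a) hY' with h | h | h
      · exact h.trans (Finset.erase_subset _ _)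
      · rcases hl (X.erase a) hX' Y hY with h' | h' | h'
        · intro x hx
          by_cases e : x = a
          · rwa [e]
          · exact h' (Finset.mem_erase.2 ⟨e, hx⟩)
        · exact absurd (h' haY) (Finset.notMem_erase a X)
        · exfalso
          refine hYa (Finset.eq_singleton_iff_unique_mem.2 ⟨haY, fun y hy => ?_⟩)
          by_contra e
          exact Finset.disjoint_left.1 h' (Finset.mem_erase.2 ⟨e, h (Finset.mem_erase.2 ⟨e, hy⟩)⟩) hy
      · rcases hl X hX Y hY with h' | h' | h'
        · exact h'
        · exfalso
          refine hYa (Finset.eq_singleton_iff_unique_mem.2 ⟨haY, fun y hy => ?_⟩)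
          by_contra e
          exact Finset.disjoint_left.1 h (h' hy) (Finset.mem_erase.2 ⟨e, hy⟩)
        · exact absurd haY (Finset.disjoint_left.1 h' haX)
    obtain ⟨T, hT⟩ : ∃ T, ∀ X ∈ F, a ∈ X → X.erase a ∈ F → X = {a} ∨ X = T := by
      by_cases h : ∃ T ∈ F, a ∈ T ∧ T.erase a ∈ F ∧ T ≠ {a}
      · obtain ⟨T, t1, t2, t3, t4⟩ := h
        refine ⟨T, fun X hX haX hX' => ?_⟩
        by_cases e : X = {a}
        · exact .inl e
        · exact .inr ((huniq X hX T t1 haX t2 hX' t3 e t4).antisymm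
            (huniq T t1 X hX t2 haX t3 hX' t4 e))
      · refine ⟨∅, fun X hX haX hX' => ?_⟩
        by_contra e
        exact h ⟨X, hX, haX, hX', fun h => e (.inl h)⟩
    -- Without `{a}` and `T` the removal of `a` is injective, so each element of the ground set
    -- accounts for at most two members.
    have h2 : ((F.erase {a}).erase T).card ≤ (F.image fun X => X.erase a).card := by
      refine Finset.card_le_card_of_injOn (fun X => X.erase a) (fun X hX => ?_)
        fun X hX Y hY hXY => ?_
      · exact Finset.mem_image_of_mem _ (Finset.mem_of_mem_erase (Finset.mem_of_mem_erase hX))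
      · obtain ⟨x1, x2⟩ := Finset.mem_erase.1 (Finset.mem_coe.1 hX)
        obtain ⟨x2, x3⟩ := Finset.mem_erase.1 x2
        obtain ⟨y1, y2⟩ := Finset.mem_erase.1 (Finset.mem_coe.1 hY)
        obtain ⟨y2, y3⟩ := Finset.mem_erase.1 y2
        dsimp only at hXY
        by_cases haX : a ∈ X <;> by_cases haY : a ∈ Y
        · rw [← Finset.insert_erase haX, hXY, Finset.insert_erase haY]
        · rw [Finset.erase_eq_of_notMem haY] at hXY
          rcases hT X x3 haX (hXY ▸ y3) with h | h
          · exact absurd h x2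
          · exact absurd h x1
        · rw [Finset.erase_eq_of_notMem haX] at hXY
          rcases hT Y y3 haY (hXY ▸ x3) with h | h
          · exact absurd h y2
          · exact absurd h y1
        · rwa [Finset.erase_eq_of_notMem haX, Finset.erase_eq_of_notMem haY] at hXY
    have h3 := Finset.pred_card_le_card_erase (s := F.erase {a}) (a := T)
    have h4 := Finset.pred_card_le_card_erase (s := F) (a := {a})
    rw [Finset.card_insert_of_notMem ha]
    omega

/-- The number of nonempty and pairwise disjoint subsets of a set. -/
theorem length_le_card_of_disjoint {α : Type*} [DecidableEq α] : ∀ (L : List (Finset α)) (D : Finset α),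
    (∀ T ∈ L, T.Nonempty) → L.Pairwise Disjoint → (∀ T ∈ L, T ⊆ D) → L.length ≤ D.card
  | [], _, _, _, _ => Nat.zero_le _
  | T :: L, D, h1, h2, h3 => by
    rw [List.pairwise_cons] at h2
    have := length_le_card_of_disjoint L (D \ T) (fun T' h => h1 T' (List.mem_cons_of_mem _ h)) h2.2
      fun T' h => Finset.subset_sdiff.2 ⟨h3 T' (List.mem_cons_of_mem _ h), (h2.1 T' h).symm⟩
    have h4 := Finset.card_sdiff_add_card_eq_card (h3 T (by simp))
    have h5 := Finset.card_pos.2 (h1 T (by simp))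
    simp only [List.length_cons]
    omega

/-! ### The data of the vertices -/

/-- The part of a block that describes a class. -/
def Classification.classBlock {n : ℕ} (c : Classification (Fin n)) (l : List (Fin n)) : List ℕ :=
  c.classQuota l.toFinset :: l.length :: l.map Fin.val

theorem getElem?_flatten {α : Type*} (L : List (List α)) {u : ℕ} (hu : u < L.length) {r : ℕ}
    (hr : r < L[u].length) : L.flatten[(L.take u).flatten.length + r]? = L[u][r]? := by
  have h : L.flatten = (L.take u).flatten ++ (L.drop u).flatten := by
    rw [← List.flatten_append, List.take_append_drop]
  rw [h, List.getElem?_append_right (by omega), Nat.add_sub_cancel_left, List.drop_eq_getElem_cons hu,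
    List.flatten_cons, List.getElem?_append_left hr]

theorem flatten_take_length_add_le {α : Type*} (L : List (List α)) {u : ℕ} (hu : u < L.length) :
    (L.take u).flatten.length + L[u].length ≤ L.flatten.length := by
  conv_rhs => rw [← List.take_append_drop u L, List.flatten_append, List.drop_eq_getElem_cons hu,
    List.flatten_cons]
  simp only [List.length_append]
  omega

/-- The data of the vertices of one side, as found in the memory `l`. -/
def sideLists {n n' : ℕ} (cl : Fin n → Classification (Fin n')) (LL : Fin n → List (List (Fin n')))
    (l : ℕ → ℕ) (base : ℕ) : Lists where
  q v := if h : v < n then (cl ⟨v, h⟩).quota else 0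
  nc v := if h : v < n then (LL ⟨v, h⟩).length else 0
  pos v t := if h : v < n then
    l (base + v) + 2 + (((LL ⟨v, h⟩).map (cl ⟨v, h⟩).classBlock).take t).flatten.length else 0
  cq v t := if h : v < n then (cl ⟨v, h⟩).classQuota ((LL ⟨v, h⟩).getD t []).toFinset else 0
  cls v t := if h : v < n then ((LL ⟨v, h⟩).getD t []).toFinset.map Fin.valEmbedding else ∅

section

variable {n n' : ℕ} {cl : Fin n → Classification (Fin n')} {LL : Fin n → List (List (Fin n'))}
  {l : ℕ → ℕ} {base : ℕ} (v : Fin n) (t : ℕ)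

theorem sideLists_q : (sideLists cl LL l base).q v = (cl v).quota := by simp [sideLists]

theorem sideLists_nc : (sideLists cl LL l base).nc v = (LL v).length := by simp [sideLists]

theorem sideLists_pos : (sideLists cl LL l base).pos v t =
    l (base + v) + 2 + (((LL v).map (cl v).classBlock).take t).flatten.length := by
  simp [sideLists]

theorem sideLists_cq : (sideLists cl LL l base).cq v t =
    (cl v).classQuota ((LL v).getD t []).toFinset := by simp [sideLists]

theorem sideLists_cls : (sideLists cl LL l base).cls v t =
    ((LL v).getD t []).toFinset.map Fin.valEmbedding := by simp [sideLists]

end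

theorem Classification.block_eq {n : ℕ} (c : Classification (Fin n)) (L : List (List (Fin n))) :
    c.block L = c.quota :: L.length :: (L.map c.classBlock).flatten := by
  simp only [block, List.flatMap_def]
  congr 4
  funext l
  simp only [classBlock]
  congr 2
  simp [← List.map_eq_flatMap]

theorem Classification.IsListing.length_eq {n : ℕ} {c : Classification (Fin n)}
    {L : List (List (Fin n))} (h : c.IsListing L) : L.length = c.classes.card := by
  obtain ⟨-, h2, h3⟩ := h
  rw [← h3, List.toFinset_card_of_nodup h2, List.length_map]

theorem Classification.IsListing.mem {n : ℕ} {c : Classification (Fin n)}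
    {L : List (List (Fin n))} (h : c.IsListing L) {t : ℕ} (ht : t < L.length) :
    (L.getD t []).toFinset ∈ c.classes := by
  rw [← h.2.2, List.mem_toFinset, List.getD_eq_getElem _ _ ht]
  exact List.mem_map_of_mem (List.getElem_mem ht)

theorem Classification.IsListing.exists {n : ℕ} {c : Classification (Fin n)}
    {L : List (List (Fin n))} (h : c.IsListing L) {C : Finset (Fin n)} (hC : C ∈ c.classes) :
    ∃ t < L.length, (L.getD t []).toFinset = C := by
  rw [← h.2.2, List.mem_toFinset, List.mem_map] at hC
  obtain ⟨l, hl, rfl⟩ := hC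
  obtain ⟨t, ht, rfl⟩ := List.getElem_of_mem hl
  exact ⟨t, ht, by rw [List.getD_eq_getElem _ _ ht]⟩

/-- The length of the block of a vertex with at most `d` neighbours. -/
theorem Classification.block_length_le {n d : ℕ} {c : Classification (Fin n)}
    {L : List (List (Fin n))} (h : c.IsListing L) (hl : c.IsLaminar) {D : Finset (Fin n)}
    (hD : ∀ C ∈ c.classes, C ⊆ D) (hd : D.card ≤ d) :
    L.length ≤ 2 * D.card + 1 ∧ (c.block L).length ≤ 2 * (d * d) + 5 * d + 4 := by
  have h1 := card_laminar_le D c.classes hD hl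
  rw [← h.length_eq] at h1
  refine ⟨h1, ?_⟩
  have h2 : (L.map c.classBlock).flatten.length ≤ L.length * (2 + d) := by
    rw [List.length_flatten, List.map_map]
    refine (List.sum_le_card_nsmul _ (2 + d) fun x hx => ?_).trans (by simp)
    obtain ⟨l, hl', rfl⟩ := List.mem_map.1 hx
    have h3 : l.toFinset.card ≤ D.card := by
      refine Finset.card_le_card (hD _ ?_)
      rw [← h.2.2, List.mem_toFinset]
      exact List.mem_map_of_mem hl'
    rw [List.toFinset_card_of_nodup (h.1 l hl')] at h3
    simp [classBlock]
    omega
  rw [block_eq]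
  simp only [List.length_cons]
  nlinarith

/-- This links the input format to the abstract `Lists`. The position of a class follows from the
lengths of the class blocks before it, and the number of classes is bounded by `card_laminar_le` on
the set of neighbours. -/
theorem sideLists_valid {n n' B m base : ℕ} {cl : Fin n → Classification (Fin n')}
    {LL : Fin n → List (List (Fin n'))} {l V O : ℕ → ℕ} (hB : 2 * m + 1 ≤ B) (hn' : n' ≤ B)
    (hlist : ∀ v, (cl v).IsListing (LL v)) (hlam : ∀ v, (cl v).IsLaminar)
    (htable : ∀ v : Fin n, base + v < B)
    (hlen : ∀ v : Fin n, l (base + v) + ((cl v).block (LL v)).length ≤ B)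
    (hblock : ∀ v : Fin n, ∀ r x, ((cl v).block (LL v))[r]? = some x → l (l (base + v) + r) = x)
    (hV : ∀ j < m, V j < n)
    (hnbr : ∀ v, ∀ C ∈ (cl v).classes, ∀ x ∈ C, ∃ j < m, V j = v ∧ O j = x) :
    (sideLists cl LL l base).Valid B m base l V O := by
  have hV' : ∀ j < m, ∃ v : Fin n, V j = v := fun j hj => ⟨⟨V j, hV j hj⟩, rfl⟩
  have hlen2 : ∀ v : Fin n, l (base + v) + 2 + ((LL v).map (cl v).classBlock).flatten.length ≤ B := by
    intro v
    have := hlen v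
    rw [Classification.block_eq] at this
    simp only [List.length_cons] at this
    omega
  have hdeg : ∀ v : Fin n, (LL v).length ≤ 2 * deg m V v + 1 := by
    intro v
    set D : Finset (Fin n') := Finset.univ.filter fun x => ∃ j < m, V j = v ∧ O j = x with hD
    refine ((cl v).block_length_le (hlist v) (hlam v) (D := D) (fun C hC x hx => ?_) le_rfl).1.trans ?_
    · simpa [hD] using hnbr v C hC x hx
    · have : D.card ≤ deg m V v := by
        have h1 : D.map Fin.valEmbedding ⊆ ((Finset.range m).filter fun j => V j = v).image O := by
          intro x hx
          obtain ⟨y, hy, rfl⟩ := Finset.mem_map.1 hx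
          obtain ⟨j, hj, e1, e2⟩ := (Finset.mem_filter.1 hy).2
          exact Finset.mem_image.2 ⟨j, by simp [hj, e1], e2⟩
        have h2 := (Finset.card_le_card h1).trans Finset.card_image_le
        rwa [Finset.card_map] at h2
      omega
  have hmap : ∀ (v : Fin n) (t : ℕ) (ht : t < (LL v).length),
      ((LL v).map (cl v).classBlock)[t]'(by simpa using ht) = (cl v).classBlock ((LL v)[t]) := by
    intro v t ht; simp
  have hsucc : ∀ (v : Fin n) (t : ℕ) (ht : t < (LL v).length),
      (((LL v).map (cl v).classBlock).take (t + 1)).flatten.length =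
        (((LL v).map (cl v).classBlock).take t).flatten.length + 2 + ((LL v)[t]).length := by
    intro v t ht
    rw [List.take_succ_eq_append_getElem (by simpa using ht), List.flatten_append, List.length_append, hmap v t ht]
    simp [Classification.classBlock]
    omega
  have hcard : ∀ (v : Fin n) (t : ℕ) (ht : t < (LL v).length),
      ((sideLists cl LL l base).cls v t).card = ((LL v)[t]).length := by
    intro v t ht
    rw [sideLists_cls, Finset.card_map, List.getD_eq_getElem _ _ ht,
      List.toFinset_card_of_nodup ((hlist v).1 _ (List.getElem_mem ht))]
  have hread : ∀ (v : Fin n) (t : ℕ) (ht : t < (LL v).length) (r x : ℕ),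
      ((cl v).classBlock ((LL v)[t]))[r]? = some x →
      l ((sideLists cl LL l base).pos v t + r) = x := by
    intro v t ht r x hx
    rw [sideLists_pos, ← hblock v (2 + (((LL v).map (cl v).classBlock).take t).flatten.length + r) x]
    · congr 1; omega
    · rw [Classification.block_eq, show 2 + (((LL v).map (cl v).classBlock).take t).flatten.length + r =
        (((LL v).map (cl v).classBlock).take t).flatten.length + r + 1 + 1 by omega,
        List.getElem?_cons_succ, List.getElem?_cons_succ, getElem?_flatten _ (by simpa using ht),
        hmap v t ht, hx]
      rw [hmap v t ht]
      exact (List.getElem?_eq_some_iff.1 hx).1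
  refine ⟨fun j hj => ?_, fun j hj => ?_, fun j hj => ?_, fun j hj => ?_, fun j hj => ?_,
    fun j hj => ?_, fun j hj => ?_, fun j hj t ht => ?_, fun j hj t ht => ?_, fun j hj t ht => ?_,
    fun j hj t ht => ?_, fun j hj t ht => ?_, fun j hj t ht p hp => ?_, fun j hj t ht p hp => ?_,
    fun j hj t ht t' ht' => ?_⟩ <;> obtain ⟨v, hv⟩ := hV' j hj
  · rw [hv]; exact htable v
  · rw [hv]; have := hlen2 v; omega
  · rw [hv, sideLists_q]
    have := hblock v 0 (cl v).quota (by simp [Classification.block_eq])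
    simpa using this
  · rw [hv, sideLists_nc]
    exact hblock v 1 _ (by simp [Classification.block_eq])
  · rw [hv, sideLists_nc]; exact hdeg v
  · rw [hv, sideLists_nc]
    have := hdeg v
    have := deg_le m V v
    omega
  · rw [hv, sideLists_pos]; simp
  · rw [hv, sideLists_nc] at ht
    rw [hv, hcard v t ht, sideLists_pos, sideLists_pos, hsucc v t ht]
    omega
  · rw [hv, sideLists_pos]
    have h1 := hlen2 v
    have h2 : (((LL v).map (cl v).classBlock).take t).flatten.length ≤
        ((LL v).map (cl v).classBlock).flatten.length := by
      conv_rhs => rw [← List.take_append_drop t ((LL v).map (cl v).classBlock), List.flatten_append,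
        List.length_append]
      omega
    omega
  · rw [hv, sideLists_nc] at ht
    rw [hv, sideLists_cq, List.getD_eq_getElem _ _ ht]
    exact hread v t ht 0 _ (by simp [Classification.classBlock])
  · rw [hv, sideLists_nc] at ht
    rw [hv, hcard v t ht]
    exact hread v t ht 1 _ (by simp [Classification.classBlock])
  · rw [hv, sideLists_nc] at ht
    rw [hv, hcard v t ht, sideLists_cls, List.getD_eq_getElem _ _ ht]
    have hr : ∀ i (hi : i < ((LL v)[t]).length),
        l ((sideLists cl LL l base).pos v t + 2 + i) = ((LL v)[t][i] : ℕ) := by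
      intro i hi
      rw [add_assoc]
      refine hread v t ht (2 + i) _ ?_
      rw [Classification.classBlock, show 2 + i = i + 1 + 1 by omega, List.getElem?_cons_succ,
        List.getElem?_cons_succ, List.getElem?_map, List.getElem?_eq_getElem hi]
      rfl
    ext x
    simp only [Finset.mem_map, List.mem_toFinset, Finset.mem_image, Finset.mem_range,
      Fin.valEmbedding_apply]
    constructor
    · rintro ⟨y, hy, rfl⟩
      obtain ⟨i, hi, rfl⟩ := List.getElem_of_mem hy
      exact ⟨i, hi, hr i hi⟩
    · rintro ⟨i, hi, rfl⟩
      exact ⟨_, List.getElem_mem hi, (hr i hi).symm⟩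
  · rw [hv, sideLists_cls] at hp
    obtain ⟨y, -, rfl⟩ := Finset.mem_map.1 hp
    exact (y.isLt.le).trans hn'
  · rw [hv, sideLists_nc] at ht
    rw [hv, sideLists_cls] at hp
    obtain ⟨y, hy, rfl⟩ := Finset.mem_map.1 hp
    rw [hv]
    exact hnbr v _ ((hlist v).mem ht) y hy
  · rw [hv, sideLists_nc] at ht ht'
    rw [hv, sideLists_cls, sideLists_cls]
    rcases hlam v _ ((hlist v).mem ht) _ ((hlist v).mem ht') with h | h | h
    · exact .inl (Finset.map_subset_map.2 h)
    · exact .inr (.inl (Finset.map_subset_map.2 h))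
    · exact .inr (.inr ((Finset.disjoint_map _).2 h))

end CRMM
namespace CRMM

/-! ### Edge sets and sets of positions -/

section

variable {α : Type*} [DecidableEq α]

/-- The positions in the list `es` of the elements of `X`. -/
def positions (es : List α) (X : Finset α) : Finset ℕ :=
  (Finset.univ.filter fun i : Fin es.length => es.get i ∈ X).map Fin.valEmbedding

theorem mem_positions {es : List α} {X : Finset α} {j : ℕ} :
    j ∈ positions es X ↔ ∃ h : j < es.length, es[j] ∈ X := by
  simp only [positions, Finset.mem_map, Finset.mem_filter, Finset.mem_univ, true_and,
    Fin.valEmbedding_apply, List.get_eq_getElem]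
  constructor
  · rintro ⟨i, hi, rfl⟩
    exact ⟨i.isLt, hi⟩
  · rintro ⟨h, hj⟩
    exact ⟨⟨j, h⟩, hj, rfl⟩

theorem positions_subset (es : List α) (X : Finset α) : positions es X ⊆ Finset.range es.length :=
  fun j hj => Finset.mem_range.2 (mem_positions.1 hj).1

/-- The list of edges has no repetitions, so reading the entry at a position is a bijection; quotas
and ranks are transported along it. -/
theorem card_filter_positions {es : List α} (hes : es.Nodup) {X : Finset α} (hX : X ⊆ es.toFinset)
    (p : α → Prop) [DecidablePred p] (p' : ℕ → Prop) [DecidablePred p']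
    (h : ∀ (i : ℕ) (hi : i < es.length), p' i ↔ p es[i]) :
    ((positions es X).filter p').card = (X.filter p).card := by
  refine Finset.card_bij (fun j hj => es[j]'(mem_positions.1 (Finset.mem_filter.1 hj).1).1)
    (fun j hj => ?_) (fun j hj j' hj' e => ?_) fun e he => ?_
  · obtain ⟨h1, h2⟩ := Finset.mem_filter.1 hj
    obtain ⟨h3, h4⟩ := mem_positions.1 h1
    exact Finset.mem_filter.2 ⟨h4, (h j h3).1 h2⟩
  · exact (List.Nodup.getElem_inj_iff hes).1 e
  · obtain ⟨h1, h2⟩ := Finset.mem_filter.1 he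
    obtain ⟨j, hj, rfl⟩ := List.getElem_of_mem (List.mem_toFinset.1 (hX h1))
    exact ⟨j, Finset.mem_filter.2 ⟨mem_positions.2 ⟨hj, h1⟩, (h j hj).2 h2⟩, rfl⟩

end

theorem obeys_iff_respects {n n' m : ℕ} {cl : Fin n → Classification (Fin n')}
    {LL : Fin n → List (List (Fin n'))} (hlist : ∀ v, (cl v).IsListing (LL v)) {l : ℕ → ℕ} {base : ℕ}
    {V O : ℕ → ℕ} (hV : ∀ j < m, V j < n) {M : Finset ℕ} (hM : M ⊆ Finset.range m)
    {Pt : Fin n → Finset (Fin n')} (h1 : ∀ v, (Pt v).card = (M.filter fun j => V j = v).card)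
    (h2 : ∀ v C, (Pt v ∩ C).card =
      (M.filter fun j => V j = v ∧ O j ∈ C.map Fin.valEmbedding).card) :
    (sideLists cl LL l base).Obeys m V O M ↔ ∀ v, (cl v).Respects (Pt v) := by
  constructor
  · intro h v
    by_cases hv : ∃ j < m, V j = v
    · obtain ⟨j₀, hj₀, e⟩ := hv
      obtain ⟨h3, h4⟩ := h j₀ hj₀
      rw [e, sideLists_q] at h3
      rw [e, sideLists_nc] at h4
      refine ⟨by rwa [h1], fun C hC => ?_⟩
      obtain ⟨t, ht, rfl⟩ := (hlist v).exists hC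
      have := h4 t ht
      rwa [sideLists_cls, sideLists_cq, ← h2] at this
    -- `Obeys` speaks only of vertices with edges. Any other vertex has no partners, and its quotas
    -- hold trivially.
    · have hz : ∀ j ∈ M, V j ≠ v := fun j hj e => hv ⟨j, Finset.mem_range.1 (hM hj), e⟩
      have h3 : (Pt v).card = 0 := by
        rw [h1, Finset.card_eq_zero, Finset.filter_eq_empty_iff]
        exact fun j hj => hz j hj
      rw [Finset.card_eq_zero] at h3
      simp [Classification.Respects, h3]
  · intro h j₀ hj₀
    obtain ⟨v, hv⟩ : ∃ v : Fin n, V j₀ = v := ⟨⟨V j₀, hV j₀ hj₀⟩, rfl⟩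
    rw [hv]
    obtain ⟨h3, h4⟩ := h v
    refine ⟨by rwa [sideLists_q, ← h1], fun t ht => ?_⟩
    rw [sideLists_nc] at ht
    rw [sideLists_cls, sideLists_cq, ← h2]
    exact h4 _ ((hlist v).mem ht)

/-! ### Partners, edges and ranks of an instance. -/

namespace Instance

variable {A P : Type*} [Fintype A] [Fintype P] [DecidableEq A] [DecidableEq P]

theorem card_partnersA_inter (X : Finset (A × P)) (a : A) (C : Finset P) :
    (partnersA X a ∩ C).card = (X.filter fun e => e.1 = a ∧ e.2 ∈ C).card := by
  refine Finset.card_bij (fun p _ => (a, p)) (fun p hp => ?_) (fun p _ p' _ e => ?_) fun e he => ?_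
  · simpa [partnersA] using hp
  · exact (Prod.mk.inj e).2
  · obtain ⟨h1, rfl, h2⟩ := Finset.mem_filter.1 he
    exact ⟨e.2, by simpa [partnersA] using ⟨h1, h2⟩, rfl⟩

theorem card_partnersP_inter (X : Finset (A × P)) (p : P) (C : Finset A) :
    (partnersP X p ∩ C).card = (X.filter fun e => e.2 = p ∧ e.1 ∈ C).card := by
  refine Finset.card_bij (fun a _ => (a, p)) (fun a ha => ?_) (fun a _ a' _ e => ?_) fun e he => ?_
  · simpa [partnersP] using ha
  · exact (Prod.mk.inj e).1
  · obtain ⟨h1, rfl, h2⟩ := Finset.mem_filter.1 he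
    exact ⟨e.1, by simpa [partnersP] using ⟨h1, h2⟩, rfl⟩

theorem mem_edges {I : Instance A P} {e : A × P} : e ∈ I.edges ↔ ∃ T ∈ I.pref e.1, e.2 ∈ T := by
  simp [edges]

/-- Ties are nonempty and disjoint, so a list is no longer than the number of posts on it. Hence no
rank exceeds the number of edges. -/
theorem length_pref_le (I : Instance A P) (a : A) : (I.pref a).length ≤ I.edges.card := by
  refine (length_le_card_of_disjoint (I.pref a) (Finset.univ.filter fun p => (a, p) ∈ I.edges)
    (I.tie_nonempty a) (I.tie_disjoint a) fun T hT p hp => ?_).trans ?_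
  · simpa [mem_edges] using ⟨T, hT, hp⟩
  · exact Finset.card_le_card_of_injOn (fun p => (a, p)) (fun p hp => by simpa using hp)
      fun p _ p' _ e => (Prod.mk.inj e).2

theorem maxRank_le (I : Instance A P) : I.maxRank ≤ I.edges.card :=
  Finset.sup_le fun a _ => I.length_pref_le a

theorem rank_le (I : Instance A P) {e : A × P} (he : e ∈ I.edges) : I.rank e ≤ I.edges.card := by
  refine le_trans ?_ (I.length_pref_le e.1)
  obtain ⟨T, hT, hp⟩ := mem_edges.1 he
  exact List.findIdx_lt_length_of_exists ⟨T, hT, by simpa using hp⟩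

end Instance

/-- The positions in a list of edges of the edges of `X` that have rank at most `k`. -/
theorem upTo_succ_positions {nA nP : ℕ} (I : Instance (Fin nA) (Fin nP))
    {es : List (Fin nA × Fin nP)} (hes : es.Nodup) {RK : ℕ → ℕ}
    (hRK : ∀ (i : ℕ) (hi : i < es.length), RK i = I.rank es[i]) {X : Finset (Fin nA × Fin nP)}
    (hX : X ⊆ es.toFinset) (k : Fin I.maxRank) :
    upTo RK (positions es X) (k + 1) = upTo RK (positions es X) k + I.signature X k := by
  unfold upTo Instance.signature
  rw [card_filter_positions hes hX (fun e => I.rank e ≤ k + 1) _ fun i hi => by rw [hRK i hi],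
    card_filter_positions hes hX (fun e => I.rank e ≤ k) _ fun i hi => by rw [hRK i hi],
    ← Finset.card_union_of_disjoint]
  · congr 1
    ext e
    simp only [Finset.mem_filter, Finset.mem_union, ← and_or_left]
    refine and_congr_right fun _ => ?_
    omega
  · refine Finset.disjoint_filter.2 fun e _ h => ?_
    omega

/-- A solution of the problem in terms of the positions of the edges is a CRMM. -/
theorem Solves.isCRMM {nA nP : ℕ} {I : Instance (Fin nA) (Fin nP)}
    {es : List (Fin nA × Fin nP)} (hes : es.Nodup) (hE : es.toFinset = I.edges)
    {LA : Fin nA → List (List (Fin nP))} {LP : Fin nP → List (List (Fin nA))}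
    (hA : ∀ a, (I.clA a).IsListing (LA a)) (hP : ∀ p, (I.clP p).IsListing (LP p))
    {EA EP RK : ℕ → ℕ} (hEA : ∀ (i : ℕ) (hi : i < es.length), EA i = es[i].1)
    (hEP : ∀ (i : ℕ) (hi : i < es.length), EP i = es[i].2)
    (hRK : ∀ (i : ℕ) (hi : i < es.length), RK i = I.rank es[i]) {l : ℕ → ℕ} {base base' : ℕ}
    {X : Finset (Fin nA × Fin nP)} (hX : X ⊆ I.edges)
    (h : Solves es.length EA EP RK (sideLists I.clA LA l base) (sideLists I.clP LP l base')
      (positions es X)) : I.IsCRMM X := by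
  have hm : es.length = I.edges.card := by rw [← hE, List.toFinset_card_of_nodup hes]
  have hfeas : ∀ Y ⊆ I.edges, I.IsFeasible Y ↔
      (sideLists I.clA LA l base).Obeys es.length EA EP (positions es Y) ∧
      (sideLists I.clP LP l base').Obeys es.length EP EA (positions es Y) := by
    intro Y hY
    have hY' : Y ⊆ es.toFinset := hE ▸ hY
    have hA2 : ∀ a C, (Instance.partnersA Y a ∩ C).card = ((positions es Y).filter
        fun j => EA j = a ∧ EP j ∈ C.map Fin.valEmbedding).card := by
      intro a C
      rw [Instance.card_partnersA_inter, card_filter_positions hes hY'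
        (fun e => e.1 = a ∧ e.2 ∈ C) _ fun i hi => ?_]
      rw [hEA i hi, hEP i hi, Fin.val_inj, ← Fin.valEmbedding_apply, Finset.mem_map']
    have hP2 : ∀ p C, (Instance.partnersP Y p ∩ C).card = ((positions es Y).filter
        fun j => EP j = p ∧ EA j ∈ C.map Fin.valEmbedding).card := by
      intro p C
      rw [Instance.card_partnersP_inter, card_filter_positions hes hY'
        (fun e => e.2 = p ∧ e.1 ∈ C) _ fun i hi => ?_]
      rw [hEA i hi, hEP i hi, Fin.val_inj, ← Fin.valEmbedding_apply, Finset.mem_map']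
    rw [obeys_iff_respects hA (fun j hj => by rw [hEA j hj]; exact Fin.isLt _)
        (positions_subset _ _) (fun a => ?_) hA2,
      obeys_iff_respects hP (fun j hj => by rw [hEP j hj]; exact Fin.isLt _)
        (positions_subset _ _) (fun a => ?_) hP2]
    · exact ⟨fun h => h.2, fun h => ⟨hY, h⟩⟩
    · have := hP2 a Finset.univ
      rw [Finset.inter_univ] at this
      rw [this]
      congr 1
      refine Finset.filter_congr fun j hj => ?_
      have hj' := Finset.mem_range.1 (positions_subset _ _ hj)
      rw [hEA j hj']
      simp
    · have := hA2 a Finset.univ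
      rw [Finset.inter_univ] at this
      rw [this]
      congr 1
      refine Finset.filter_congr fun j hj => ?_
      have hj' := Finset.mem_range.1 (positions_subset _ _ hj)
      rw [hEP j hj']
      simp
  refine ⟨(hfeas X hX).2 ⟨h.obeys, h.obeys'⟩, fun ⟨Y, hY, k, hk, hlt⟩ => ?_⟩
  obtain ⟨o1, o2⟩ := (hfeas Y hY.1).1 hY
  have hkm : (k : ℕ) + 1 ≤ es.length := by
    have := I.maxRank_le
    have := k.isLt
    omega
  have sX := upTo_succ_positions I hes hRK (hE.symm ▸ hX : X ⊆ es.toFinset)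
  have sY := upTo_succ_positions I hes hRK (hE.symm ▸ hY.1 : Y ⊆ es.toFinset)
  have h0 : ∀ M : Finset ℕ, M ⊆ Finset.range es.length → upTo RK M 0 = 0 := by
    intro M hM
    unfold upTo
    rw [Finset.card_eq_zero, Finset.filter_eq_empty_iff]
    intro j hj
    rw [hRK j (Finset.mem_range.1 (hM hj))]
    simp [Instance.rank]
  -- Equal entries of the signature add up to equal cumulative counts, so the first difference of
  -- the signatures is the first difference of the counts.
  have heq : ∀ i ≤ (k : ℕ), upTo RK (positions es Y) i = upTo RK (positions es X) i := by
    intro i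
    induction i with
    | zero => intro _; rw [h0 _ (positions_subset _ _), h0 _ (positions_subset _ _)]
    | succ i ih =>
      intro hi
      have hi' : i < I.maxRank := by have := k.isLt; omega
      have e1 := sX ⟨i, hi'⟩
      have e2 := sY ⟨i, hi'⟩
      have e3 := hk ⟨i, hi'⟩ (Fin.lt_def.2 hi)
      simp only at e1 e2
      rw [e1, e2, ih (by omega), e3]
  have hlt' : upTo RK (positions es X) (k + 1) < upTo RK (positions es Y) (k + 1) := by
    rw [sX, sY, heq k le_rfl]
    omega
  have := h.optimal _ (positions_subset es Y) o1 o2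
    (.inr ⟨k + 1, hkm, fun i hi => heq i (by omega), hlt'⟩) (k + 1) hkm
  omega

end CRMM
namespace CRMM

/-! ### The encoding -/

/-- The input in the memory `l`: the numbers of applicants, of posts, and of edges, the triples `tri j`,
a table of pointers, and the blocks. -/
structure Layout (nA nP m len : ℕ) (tri blk : ℕ → List ℕ) (l : ℕ → ℕ) : Prop where
  count_left : l 0 = nA
  count_right : l 1 = nP
  count_edges : l 2 = m
  triple : ∀ j < m, ∀ r x, (tri j)[r]? = some x → l (3 + 3 * j + r) = x
  block : ∀ u < nA + nP, ∀ r x, (blk u)[r]? = some x → l (l (3 + 3 * m + u) + r) = x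
  block_le : ∀ u < nA + nP, l (3 + 3 * m + u) + (blk u).length ≤ len
  len_ge : 3 + 3 * m + (nA + nP) ≤ len
  len_le : len = l (2 + 3 * m + (nA + nP)) + (blk (nA + nP - 1)).length ∨
    nA + nP = 0 ∧ len = 3 + 3 * m

theorem layout_of_eq {α : Type*} (es : List α) (tri : α → List ℕ) (htri : ∀ e, (tri e).length = 3)
    (blocks : List (List ℕ)) {nA nP : ℕ} (hb : blocks.length = nA + nP) {w : List ℕ}
    (hw : w = [nA, nP, es.length] ++ es.flatMap tri ++
      ((List.range (nA + nP)).map fun u =>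
        3 + 3 * es.length + (nA + nP) + ((blocks.take u).flatten).length) ++ blocks.flatten) :
    Layout nA nP es.length w.length (fun j => ((es.map tri)[j]?).getD []) (fun u => blocks[u]?.getD [])
      fun i => w.getD i 0 := by
  have hflen : ∀ L : List α, (L.flatMap tri).length = 3 * L.length := by
    intro L
    induction L with
    | nil => rfl
    | cons e L ih => rw [List.flatMap_cons, List.length_append, htri, ih, List.length_cons]; ring
  have hH : ([nA, nP, es.length] ++ es.flatMap tri).length = 3 + 3 * es.length := by
    rw [List.length_append, hflen]; rfl
  have hT : ([nA, nP, es.length] ++ es.flatMap tri ++ ((List.range (nA + nP)).map fun u =>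
      3 + 3 * es.length + (nA + nP) + ((blocks.take u).flatten).length)).length =
      3 + 3 * es.length + (nA + nP) := by
    rw [List.length_append, hH]; simp
  have hlen : w.length = 3 + 3 * es.length + (nA + nP) + blocks.flatten.length := by
    rw [hw, List.length_append, hT]
  have hhead : ∀ i < 3, w[i]? = [nA, nP, es.length][i]? := by
    intro i hi
    rw [hw, List.append_assoc, List.append_assoc, List.getElem?_append_left hi]
  have hptr : ∀ u < nA + nP, w.getD (3 + 3 * es.length + u) 0 =
      3 + 3 * es.length + (nA + nP) + ((blocks.take u).flatten).length := by
    intro u hu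
    rw [List.getD_eq_getElem?_getD, hw, List.getElem?_append_left (by rw [hT]; omega),
      List.getElem?_append_right (by rw [hH]; omega), hH, Nat.add_sub_cancel_left]
    simp [hu]
  have hblk : ∀ u (hu : u < nA + nP), (blocks[u]?.getD []) = blocks[u]'(by omega) := by
    intro u hu
    rw [List.getElem?_eq_getElem (by omega), Option.getD_some]
  refine ⟨?_, ?_, ?_, fun j hj r x hx => ?_, fun u hu r x hx => ?_, fun u hu => ?_, by omega, ?_⟩
  · simp only [List.getD_eq_getElem?_getD]; rw [hhead 0 (by omega)]; rfl
  · simp only [List.getD_eq_getElem?_getD]; rw [hhead 1 (by omega)]; rfl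
  · simp only [List.getD_eq_getElem?_getD]; rw [hhead 2 (by omega)]; rfl
  · have hj' : j < (es.map tri).length := by simpa using hj
    simp only [List.getElem?_eq_getElem hj', Option.getD_some] at hx
    have hr := (List.getElem?_eq_some_iff.1 hx).1
    have hr3 : r < 3 := by rw [List.getElem_map, htri] at hr; exact hr
    simp only [List.getD_eq_getElem?_getD]
    rw [hw, List.append_assoc, List.getElem?_append_left (by rw [hH]; omega),
      List.getElem?_append_right (by simp; omega), List.flatMap_def]
    have e1 : 3 + 3 * j + r - [nA, nP, es.length].length = ((es.map tri).take j).flatten.length + r := by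
      rw [← List.map_take, ← List.flatMap_def, hflen, List.length_take, min_eq_left hj.le]
      simp; omega
    rw [e1, getElem?_flatten _ hj' hr, hx]
    rfl
  · simp only [hblk u hu] at hx
    have hr := (List.getElem?_eq_some_iff.1 hx).1
    simp only [hptr u hu]
    rw [List.getD_eq_getElem?_getD, hw, List.getElem?_append_right (by rw [hT]; omega), hT,
      add_assoc (3 + 3 * es.length + (nA + nP)), Nat.add_sub_cancel_left,
      getElem?_flatten _ (by omega) hr, hx]
    rfl
  · simp only [hblk u hu, hptr u hu]
    have := flatten_take_length_add_le blocks (u := u) (by omega)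
    omega
  -- The last pointer gives the end of the input up to the length of the last block; without
  -- vertices there is neither a pointer nor a block.
  · rcases Nat.eq_zero_or_pos (nA + nP) with h0 | h0
    · refine .inr ⟨h0, ?_⟩
      have : blocks = [] := List.length_eq_zero_iff.1 (by omega)
      rw [hlen, this, h0]
      simp
    · left
      have e : 2 + 3 * es.length + (nA + nP) = 3 + 3 * es.length + (nA + nP - 1) := by omega
      rw [e]
      simp only [hblk _ (show nA + nP - 1 < nA + nP by omega), hptr _ (show nA + nP - 1 < nA + nP by omega)]
      have h2 : blocks.flatten = (blocks.take (nA + nP - 1)).flatten ++ (blocks.drop (nA + nP - 1)).flatten := by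
        rw [← List.flatten_append, List.take_append_drop]
      rw [hlen, h2, List.length_append, List.drop_eq_getElem_cons (by omega), List.flatten_cons,
        List.length_append, List.drop_eq_nil_of_le (by omega)]
      simp
      omega

/-! ### The bound for the addresses of the input -/

/-- Put into register `2` the pointer to the last block plus `4 + m (2 m + 5)`. -/
def prelude : Program :=
  .seq (.const 1 1) <| .seq (.const 3 2) <| .seq (.load 3 3) <| .seq (.copy 5 3) <|
  .seq (.add 4 3 3) <| .seq (.add 4 4 3) <| .seq (.const 2 0) <| .seq (.load 7 2) <|
  .seq (.const 2 1) <| .seq (.load 9 2) <| .seq (.add 4 4 7) <| .seq (.add 4 4 9) <|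
  .seq (.const 2 2) <| .seq (.add 4 4 2) <| .seq (.load 2 4) <| .seq (.const 4 4) <|
  .seq (.add 2 2 4) <| .seq (.const 4 5) <| .seq (.add 4 4 3) <| .seq (.add 4 4 3) <|
  .while (.lt 0 5) (.seq (.add 2 2 4) (.sub 5 5 1))

/-- Multiplication by repeated addition: with `q = 2 m + 5` and `m` passes, the time is linear in
`m`. -/
theorem exec_add_loop {W : ℕ} : ∀ (n : ℕ) (s : State) (b q : ℕ), s.reg 0 = 0 → s.reg 1 = 1 →
    s.reg 5 = n → s.reg 4 = q → s.reg 2 = b → b + n * q < W →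
    ∃ (t : ℕ) (s' : State), Exec W (.while (.lt 0 5) (.seq (.add 2 2 4) (.sub 5 5 1))) s t s' ∧
      t ≤ 3 * n + 1 ∧ s'.mem = s.mem ∧ s'.reg 2 = b + n * q ∧
      ∀ x, x ≠ 2 → x ≠ 5 → s'.reg x = s.reg x := by
  intro n
  induction n with
  | zero =>
    intro s b q h0 h1 h5 h4 h2 hW
    exact ⟨1, s, .while_false (by simp [Test.Holds, h0, h5]), by omega, rfl, by simpa using h2,
      fun _ _ _ => rfl⟩
  | succ n ih =>
    intro s b q h0 h1 h5 h4 h2 hW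
    rw [Nat.succ_mul] at hW
    obtain ⟨t, s', e, ht, hm, hr, hx⟩ := ih ((s.setReg 2 (b + q)).setReg 5 n) (b + q) q
      (by simpa [State.setReg] using h0) (by simpa [State.setReg] using h1) (by simp [State.setReg])
      (by simpa [State.setReg] using h4) (by simp [State.setReg]) (by omega)
    refine ⟨_, s', .while_true (by simp [Test.Holds, h0, h5]) (.seq
      (.add s 2 2 4 (by rw [h2, h4]; omega)) (.sub _ 5 5 1)) (t₂ := t) ?_, by omega, ?_, ?_, ?_⟩
    · have e5 : (s.setReg 2 (s.reg 2 + s.reg 4)).reg 5 - (s.setReg 2 (s.reg 2 + s.reg 4)).reg 1 = n := by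
        simp [State.setReg, h5, h1]
      rw [e5, h2, h4]
      exact e
    · rw [hm]; rfl
    · rw [hr, Nat.succ_mul]; omega
    · intro x x2 x5
      rw [hx x x2 x5]
      simp [State.setReg, x2, x5]

/-- The empty state of a loop program for the input `w`. -/
def Store.initial (w : List ℕ) : Store := ⟨fun _ => 0, fun _ _ => 0, fun i => w.getD i 0⟩

/-- The registers with the numbers `1, 2, 3, 4, 5, 7, 9`, all others being zero. -/
def regs (r₁ r₂ r₃ r₄ r₅ r₇ r₉ x : ℕ) : ℕ :=
  if x = 1 then r₁ else if x = 2 then r₂ else if x = 3 then r₃ else if x = 4 then r₄ else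
    if x = 5 then r₅ else if x = 7 then r₇ else if x = 9 then r₉ else 0

section

variable (r₁ r₂ r₃ r₄ r₅ r₇ r₉ n : ℕ)

theorem update_regs_1 : Function.update (regs r₁ r₂ r₃ r₄ r₅ r₇ r₉) 1 n = regs n r₂ r₃ r₄ r₅ r₇ r₉ := by
  funext x
  simp only [Function.update_apply, regs]
  split_ifs <;> rfl

theorem update_regs_2 : Function.update (regs r₁ r₂ r₃ r₄ r₅ r₇ r₉) 2 n = regs r₁ n r₃ r₄ r₅ r₇ r₉ := by
  funext x
  simp only [Function.update_apply, regs]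
  split_ifs <;> first | rfl | omega

theorem update_regs_3 : Function.update (regs r₁ r₂ r₃ r₄ r₅ r₇ r₉) 3 n = regs r₁ r₂ n r₄ r₅ r₇ r₉ := by
  funext x
  simp only [Function.update_apply, regs]
  split_ifs <;> first | rfl | omega

theorem update_regs_4 : Function.update (regs r₁ r₂ r₃ r₄ r₅ r₇ r₉) 4 n = regs r₁ r₂ r₃ n r₅ r₇ r₉ := by
  funext x
  simp only [Function.update_apply, regs]
  split_ifs <;> first | rfl | omega

theorem update_regs_5 : Function.update (regs r₁ r₂ r₃ r₄ r₅ r₇ r₉) 5 n = regs r₁ r₂ r₃ r₄ n r₇ r₉ := by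
  funext x
  simp only [Function.update_apply, regs]
  split_ifs <;> first | rfl | omega

theorem update_regs_7 : Function.update (regs r₁ r₂ r₃ r₄ r₅ r₇ r₉) 7 n = regs r₁ r₂ r₃ r₄ r₅ n r₉ := by
  funext x
  simp only [Function.update_apply, regs]
  split_ifs <;> first | rfl | omega

theorem update_regs_9 : Function.update (regs r₁ r₂ r₃ r₄ r₅ r₇ r₉) 9 n = regs r₁ r₂ r₃ r₄ r₅ r₇ n := by
  funext x
  simp only [Function.update_apply, regs]
  split_ifs <;> first | rfl | omega

end

theorem exec_regs {W t : ℕ} {p : Program} {s s₁ : State} {f : ℕ → ℕ} {l : ℕ → ℕ}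
    (h : Exec W p s t s₁) (hr : s₁.reg = f) (hl : s₁.mem = l) : Exec W p s t ⟨f, l⟩ := by
  subst hr hl; exact h

theorem exec_prelude_head {W m nA nP p : ℕ} {l : ℕ → ℕ} (hA : l 0 = nA) (hP : l 1 = nP)
    (hm : l 2 = m) (hp : l (m + m + m + nA + nP + 2) = p) (hW : p + 3 * m + nA + nP + 10 < W)
    {t : ℕ} {s : State} (h : Exec W (.while (.lt 0 5) (.seq (.add 2 2 4) (.sub 5 5 1)))
      ⟨regs 1 (p + 4) m (5 + m + m) m nA nP, l⟩ t s) :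
    ∃ t' ≤ 20 + t, Exec W prelude ⟨regs 0 0 0 0 0 0 0, l⟩ t' s := by
  have e0 : Exec W (.const 1 1) ⟨regs 0 0 0 0 0 0 0, l⟩ 1 ⟨regs 1 0 0 0 0 0 0, l⟩ :=
    exec_regs (.const _ 1 1 (by omega))
      (update_regs_1 ..) rfl
  have e1 : Exec W (.const 3 2) ⟨regs 1 0 0 0 0 0 0, l⟩ 1 ⟨regs 1 0 2 0 0 0 0, l⟩ :=
    exec_regs (.const _ 3 2 (by omega))
      (update_regs_3 ..) rfl
  have e2 : Exec W (.load 3 3) ⟨regs 1 0 2 0 0 0 0, l⟩ 1 ⟨regs 1 0 m 0 0 0 0, l⟩ :=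
    exec_regs (.load _ 3 3)
      ((update_regs_3 ..).trans (by simp [regs, hm])) rfl
  have e3 : Exec W (.copy 5 3) ⟨regs 1 0 m 0 0 0 0, l⟩ 1 ⟨regs 1 0 m 0 m 0 0, l⟩ :=
    exec_regs (.copy _ 5 3)
      ((update_regs_5 ..).trans (by simp [regs])) rfl
  have e4 : Exec W (.add 4 3 3) ⟨regs 1 0 m 0 m 0 0, l⟩ 1 ⟨regs 1 0 m (m + m) m 0 0, l⟩ :=
    exec_regs (.add _ 4 3 3 (by simp only [regs]; norm_num; omega))
      ((update_regs_4 ..).trans (by simp [regs])) rfl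
  have e5 : Exec W (.add 4 4 3) ⟨regs 1 0 m (m + m) m 0 0, l⟩ 1 ⟨regs 1 0 m (m + m + m) m 0 0, l⟩ :=
    exec_regs (.add _ 4 4 3 (by simp only [regs]; norm_num; omega))
      ((update_regs_4 ..).trans (by simp [regs])) rfl
  have e6 : Exec W (.const 2 0) ⟨regs 1 0 m (m + m + m) m 0 0, l⟩ 1 ⟨regs 1 0 m (m + m + m) m 0 0, l⟩ :=
    exec_regs (.const _ 2 0 (by omega))
      (update_regs_2 ..) rfl
  have e7 : Exec W (.load 7 2) ⟨regs 1 0 m (m + m + m) m 0 0, l⟩ 1 ⟨regs 1 0 m (m + m + m) m nA 0, l⟩ :=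
    exec_regs (.load _ 7 2)
      ((update_regs_7 ..).trans (by simp [regs, hA])) rfl
  have e8 : Exec W (.const 2 1) ⟨regs 1 0 m (m + m + m) m nA 0, l⟩ 1 ⟨regs 1 1 m (m + m + m) m nA 0, l⟩ :=
    exec_regs (.const _ 2 1 (by omega))
      (update_regs_2 ..) rfl
  have e9 : Exec W (.load 9 2) ⟨regs 1 1 m (m + m + m) m nA 0, l⟩ 1 ⟨regs 1 1 m (m + m + m) m nA nP, l⟩ :=
    exec_regs (.load _ 9 2)
      ((update_regs_9 ..).trans (by simp [regs, hP])) rfl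
  have e10 : Exec W (.add 4 4 7) ⟨regs 1 1 m (m + m + m) m nA nP, l⟩ 1 ⟨regs 1 1 m (m + m + m + nA) m nA nP, l⟩ :=
    exec_regs (.add _ 4 4 7 (by simp only [regs]; norm_num; omega))
      ((update_regs_4 ..).trans (by simp [regs])) rfl
  have e11 : Exec W (.add 4 4 9) ⟨regs 1 1 m (m + m + m + nA) m nA nP, l⟩ 1 ⟨regs 1 1 m (m + m + m + nA + nP) m nA nP, l⟩ :=
    exec_regs (.add _ 4 4 9 (by simp only [regs]; norm_num; omega))
      ((update_regs_4 ..).trans (by simp [regs])) rfl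
  have e12 : Exec W (.const 2 2) ⟨regs 1 1 m (m + m + m + nA + nP) m nA nP, l⟩ 1 ⟨regs 1 2 m (m + m + m + nA + nP) m nA nP, l⟩ :=
    exec_regs (.const _ 2 2 (by omega))
      (update_regs_2 ..) rfl
  have e13 : Exec W (.add 4 4 2) ⟨regs 1 2 m (m + m + m + nA + nP) m nA nP, l⟩ 1 ⟨regs 1 2 m (m + m + m + nA + nP + 2) m nA nP, l⟩ :=
    exec_regs (.add _ 4 4 2 (by simp only [regs]; norm_num; omega))
      ((update_regs_4 ..).trans (by simp [regs])) rfl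
  have e14 : Exec W (.load 2 4) ⟨regs 1 2 m (m + m + m + nA + nP + 2) m nA nP, l⟩ 1 ⟨regs 1 p m (m + m + m + nA + nP + 2) m nA nP, l⟩ :=
    exec_regs (.load _ 2 4)
      ((update_regs_2 ..).trans (by simp [regs, hp])) rfl
  have e15 : Exec W (.const 4 4) ⟨regs 1 p m (m + m + m + nA + nP + 2) m nA nP, l⟩ 1 ⟨regs 1 p m 4 m nA nP, l⟩ :=
    exec_regs (.const _ 4 4 (by omega))
      (update_regs_4 ..) rfl
  have e16 : Exec W (.add 2 2 4) ⟨regs 1 p m 4 m nA nP, l⟩ 1 ⟨regs 1 (p + 4) m 4 m nA nP, l⟩ :=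
    exec_regs (.add _ 2 2 4 (by simp only [regs]; norm_num; omega))
      ((update_regs_2 ..).trans (by simp [regs])) rfl
  have e17 : Exec W (.const 4 5) ⟨regs 1 (p + 4) m 4 m nA nP, l⟩ 1 ⟨regs 1 (p + 4) m 5 m nA nP, l⟩ :=
    exec_regs (.const _ 4 5 (by omega))
      (update_regs_4 ..) rfl
  have e18 : Exec W (.add 4 4 3) ⟨regs 1 (p + 4) m 5 m nA nP, l⟩ 1 ⟨regs 1 (p + 4) m (5 + m) m nA nP, l⟩ :=
    exec_regs (.add _ 4 4 3 (by simp only [regs]; norm_num; omega))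
      ((update_regs_4 ..).trans (by simp [regs])) rfl
  have e19 : Exec W (.add 4 4 3) ⟨regs 1 (p + 4) m (5 + m) m nA nP, l⟩ 1 ⟨regs 1 (p + 4) m (5 + m + m) m nA nP, l⟩ :=
    exec_regs (.add _ 4 4 3 (by simp only [regs]; norm_num; omega))
      ((update_regs_4 ..).trans (by simp [regs])) rfl
  refine ⟨_, ?_, .seq e0 <| .seq e1 <| .seq e2 <| .seq e3 <| .seq e4 <| .seq e5 <| .seq e6 <| .seq e7 <| .seq e8 <| .seq e9 <| .seq e10 <| .seq e11 <| .seq e12 <| .seq e13 <| .seq e14 <| .seq e15 <| .seq e16 <| .seq e17 <| .seq e18 <| .seq e19 <| h⟩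
  omega

/-- The arrays must start beyond the input, whose length is not stored in it, and the input can be
too long to be scanned in the time allowed. The last pointer plus a bound for the length of the last
block serves instead. The variables start at zero because only odd registers above 5 are used. -/
theorem exec_prelude {W m nA nP B : ℕ} {w : List ℕ} (hA : w.getD 0 0 = nA) (hP : w.getD 1 0 = nP)
    (hm : w.getD 2 0 = m) (hB : B = w.getD (2 + 3 * m + (nA + nP)) 0 + 4 + m * (2 * m + 5))
    (hlen : w.length ≤ B) (hW : B + 3 * m + nA + nP + 10 < W) :
    ∃ (t : ℕ) (s : State), Exec W prelude (State.initial w) t s ∧ t ≤ 3 * m + 30 ∧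
      Represents B (Store.initial w) s := by
  have hq : m * (5 + m + m) = m * (2 * m + 5) := by ring
  obtain ⟨p, hp⟩ : ∃ p, w.getD (m + m + m + nA + nP + 2) 0 = p := ⟨_, rfl⟩
  rw [show 2 + 3 * m + (nA + nP) = m + m + m + nA + nP + 2 by omega, hp] at hB
  obtain ⟨t, s, e, ht, e1, e2, e3⟩ := exec_add_loop (W := W) m
    ⟨regs 1 (p + 4) m (5 + m + m) m nA nP, fun i => w.getD i 0⟩
    (p + 4) (5 + m + m) rfl rfl rfl rfl rfl (by omega)
  have hi : State.initial w = ⟨regs 0 0 0 0 0 0 0, fun i => w.getD i 0⟩ := by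
    have : regs 0 0 0 0 0 0 0 = fun _ => 0 := by funext x; simp [regs]
    rw [this]; rfl
  obtain ⟨t', ht', e'⟩ := exec_prelude_head (l := fun i => w.getD i 0) hA hP hm hp (by omega) e
  refine ⟨t', s, hi ▸ e', by omega, ?_⟩
  have hreg : ∀ x : Var, 6 ≤ x.reg ∧ x.reg % 2 = 0 := by
    intro x; unfold Var.reg; omega
  refine ⟨by rw [e3 0 (by omega) (by omega)]; rfl, by rw [e3 1 (by omega) (by omega)]; rfl,
    ?_, fun x => ?_, fun i _ => by rw [e1]; rfl, fun r i => ?_⟩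
  · omega
  · obtain ⟨h1, h2⟩ := hreg x
    rw [e3 _ (by omega) (by omega)]
    simp only [regs]
    split_ifs <;> first | rfl | omega
  · rw [e1]
    exact List.getD_eq_default _ _ (by omega)

end CRMM
namespace CRMM

/-! ### The main theorem -/

/-- The program. -/
def program : Program := .seq prelude (Alg.main.compile 0)

theorem exec_program {W c : ℕ} (hc : 500000 ≤ c) {nA nP : ℕ} {I : Instance (Fin nA) (Fin nP)}
    (hI : I.IsLaminar) {w : List ℕ} (hw : IsEncoding I w) (hW : (w.length + 2) ^ c ≤ W) :
    ∃ (t : ℕ) (s : State) (M : Finset (Fin nA × Fin nP)),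
      Exec W program (State.initial w) t s ∧ t ≤ c * (I.edges.card ^ 2 + 1) ∧ s.Outputs M ∧
      I.IsCRMM M := by
  obtain ⟨es, LA, LP, hes, hE, hA, hP, hw⟩ := hw
  set blocks : List (List ℕ) :=
    (List.ofFn fun a => (I.clA a).block (LA a)) ++ (List.ofFn fun p => (I.clP p).block (LP p))
    with hblocks
  have hbl : blocks.length = nA + nP := by simp [hblocks]
  have hlay := layout_of_eq es (fun e => [(e.1 : ℕ), (e.2 : ℕ), I.rank e]) (fun _ => rfl) blocks hbl hw
  set m := es.length with hm
  have hmE : m = I.edges.card := by rw [← hE, List.toFinset_card_of_nodup hes]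
  -- the blocks of the vertices
  have hbA : ∀ a : Fin nA, blocks[(a : ℕ)]?.getD [] = (I.clA a).block (LA a) := by
    intro a
    rw [hblocks, List.getElem?_append_left (by simp)]
    simp
  have hbP : ∀ p : Fin nP, blocks[nA + (p : ℕ)]?.getD [] = (I.clP p).block (LP p) := by
    intro p
    rw [hblocks, List.getElem?_append_right (by simp)]
    simp
  have hlA : ∀ a : Fin nA, ((I.clA a).block (LA a)).length ≤ 2 * (m * m) + 5 * m + 4 := by
    intro a
    refine ((I.clA a).block_length_le (hA a) (hI.1 a)
      (D := Finset.univ.filter fun p => (a, p) ∈ I.edges) (fun C hC p hp => ?_) ?_).2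
    · simpa [Instance.mem_edges] using I.classA_subset a C hC p hp
    · rw [hmE]
      exact Finset.card_le_card_of_injOn (fun p => (a, p)) (fun p hp => by simpa using hp)
        fun p _ p' _ e => (Prod.mk.inj e).2
  have hlP : ∀ p : Fin nP, ((I.clP p).block (LP p)).length ≤ 2 * (m * m) + 5 * m + 4 := by
    intro p
    refine ((I.clP p).block_length_le (hP p) (hI.2 p)
      (D := Finset.univ.filter fun a => (a, p) ∈ I.edges) (fun C hC a ha => ?_) ?_).2
    · simpa [Instance.mem_edges] using I.classP_subset p C hC a ha
    · rw [hmE]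
      exact Finset.card_le_card_of_injOn (fun a => (a, p)) (fun a ha => by simpa using ha)
        fun a _ a' _ e => (Prod.mk.inj e).1
  -- the bound for the addresses
  obtain ⟨B, hB⟩ : ∃ B, B = w.getD (2 + 3 * m + (nA + nP)) 0 + 4 + m * (2 * m + 5) := ⟨_, rfl⟩
  have hmm : m * (2 * m + 5) = 2 * (m * m) + 5 * m := by ring
  have hge := hlay.len_ge
  -- By laminarity a block has at most `2 m² + 5 m + 4` cells; the last one belongs to a post, or to
  -- an applicant if there are no posts. Without vertices there are no edges, and the address of the
  -- last pointer falls on cell 2, which contains 0.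
  have hwB : w.length ≤ B := by
    rcases hlay.len_le with h | ⟨h, h'⟩
    · rcases Nat.eq_zero_or_pos (nA + nP) with h0 | h0
      · have hb0 : blocks = [] := List.length_eq_zero_iff.1 (by omega)
        simp only [hb0] at h
        simp at h
        simp at hB
        omega
      · have : (blocks[nA + nP - 1]?.getD []).length ≤ 2 * (m * m) + 5 * m + 4 := by
          by_cases hp : nP = 0
          · have := hbA ⟨nA + nP - 1, by omega⟩
            simp only at this
            rw [this]
            exact hlA _
          · have := hbP ⟨nP - 1, by omega⟩
            simp only at this
            rw [show nA + nP - 1 = nA + (nP - 1) by omega, this]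
            exact hlP _
        omega
    · have : m = 0 := by
        by_contra hne
        have := (es[0]'(by omega)).1.isLt
        omega
      rw [h', this]
      omega
  have hBw : B ≤ w.length + 4 + w.length * (2 * w.length + 5) := by
    have h1 : w.getD (2 + 3 * m + (nA + nP)) 0 ≤ w.length := by
      rcases hlay.len_le with h | ⟨h, h'⟩
      · omega
      · have hm0 : m = 0 := by
          by_contra hne
          have := (es[0]'(by omega)).1.isLt
          omega
        have := hlay.count_edges
        rw [hm0, h]
        simp only [Nat.mul_zero, Nat.add_zero]
        omega
    have h2 : m * (2 * m + 5) ≤ w.length * (2 * w.length + 5) :=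
      Nat.mul_le_mul (by omega) (by omega)
    omega
  -- The left side is at most a constant below `2 ^ 20` times `(w.length + 2) ^ 2`. As the base is
  -- at least 2, the exponent 22 absorbs the constant.
  have hBig : 33 * (B + 20000 * (m + 1) ^ 2) + 33 < W := by
    have h1 : (w.length + 2) ^ 22 ≤ (w.length + 2) ^ c := Nat.pow_le_pow_right (by omega) (by omega)
    have h2 : 2 ^ 20 ≤ (w.length + 2) ^ 20 := Nat.pow_le_pow_left (by omega) 20
    have h3 : 2 ^ 20 * (w.length + 2) ^ 2 ≤ (w.length + 2) ^ 22 := by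
      rw [pow_add (w.length + 2) 20 2]
      exact Nat.mul_le_mul_right _ h2
    have h4 : (m + 1) ^ 2 ≤ (w.length + 2) ^ 2 := Nat.pow_le_pow_left (by omega) 2
    have h5 : B ≤ 2 * (w.length + 2) ^ 2 := by
      have : 2 * (w.length + 2) ^ 2 = w.length * (2 * w.length + 5) + 3 * w.length + 8 := by ring
      omega
    have h6 : 1 ≤ (w.length + 2) ^ 2 := Nat.one_le_pow _ _ (by omega)
    norm_num at h3
    omega
  have hm1 : 1 ≤ (m + 1) ^ 2 := Nat.one_le_pow _ _ (by omega)
  have hmsq : (m + 1) ^ 2 = m * m + 2 * m + 1 := by ring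
  -- the tables
  set EA : ℕ → ℕ := fun j => (es.map fun e => (e.1 : ℕ)).getD j 0 with hEA
  set EP : ℕ → ℕ := fun j => (es.map fun e => (e.2 : ℕ)).getD j 0 with hEP
  set RK : ℕ → ℕ := fun j => (es.map I.rank).getD j 0 with hRK
  have gEA : ∀ (i : ℕ) (hi : i < es.length), EA i = es[i].1 := fun i hi => by simp [hEA, hi]
  have gEP : ∀ (i : ℕ) (hi : i < es.length), EP i = es[i].2 := fun i hi => by simp [hEP, hi]
  have gRK : ∀ (i : ℕ) (hi : i < es.length), RK i = I.rank es[i] := fun i hi => by simp [hRK, hi]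
  have hmem : ∀ (i : ℕ) (hi : i < es.length), es[i] ∈ I.edges := fun i hi => by
    rw [← hE, List.mem_toFinset]; exact List.getElem_mem hi
  have hex : ∀ e ∈ I.edges, ∃ (i : ℕ) (hi : i < es.length), es[i] = e := by
    intro e he
    rw [← hE, List.mem_toFinset] at he
    exact List.getElem_of_mem he
  have htri : ∀ j < m, ∀ r x, [EA j, EP j, RK j][r]? = some x → w.getD (3 + 3 * j + r) 0 = x := by
    intro j hj r x hx
    refine hlay.triple j hj r x ?_
    rw [List.getElem?_map, List.getElem?_eq_getElem hj]
    simpa [gEA j hj, gEP j hj, gRK j hj] using hx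
  have hrank : ∀ j < m, 1 ≤ RK j ∧ RK j ≤ m := by
    intro j hj
    rw [gRK j hj, hmE]
    exact ⟨by simp [Instance.rank], I.rank_le (hmem j hj)⟩
  have hedge : EdgeTable B m nA EA EP RK (Store.initial w).l := by
    refine ⟨by omega, by omega, hlay.count_left, hlay.count_edges, fun j hj => ⟨?_, ?_⟩,
      fun j hj => ⟨?_, ?_⟩, fun j hj => ⟨?_, ?_⟩⟩
    · exact htri j hj 0 _ rfl
    · rw [gEA j hj]; have := es[j].1.isLt; omega
    · rw [show 4 + 3 * j = 3 + 3 * j + 1 by omega]; exact htri j hj 1 _ rfl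
    · rw [gEP j hj]; have := es[j].2.isLt; omega
    · rw [show 5 + 3 * j = 3 + 3 * j + 2 by omega]; exact htri j hj 2 _ rfl
    · have := (hrank j hj).2; omega
  have hvA : (sideLists I.clA LA (Store.initial w).l (3 + 3 * m)).Valid B m (3 + 3 * m)
      (Store.initial w).l EA EP := by
    refine sideLists_valid (by omega) (by omega) hA hI.1 (fun v => by omega) (fun v => ?_)
      (fun v r x hx => ?_) (fun j hj => by rw [gEA j hj]; exact Fin.isLt _) fun v C hC x hx => ?_
    · have := hlay.block_le v (by omega)
      rw [hbA] at this
      exact this.trans hwB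
    · exact hlay.block v (by omega) r x (by rw [hbA]; exact hx)
    · obtain ⟨i, hi, e⟩ := hex (v, x) (Instance.mem_edges.2 (I.classA_subset v C hC x hx))
      exact ⟨i, hi, by rw [gEA i hi, e], by rw [gEP i hi, e]⟩
  have hvP : (sideLists I.clP LP (Store.initial w).l (3 + 3 * m + nA)).Valid B m (3 + 3 * m + nA)
      (Store.initial w).l EP EA := by
    refine sideLists_valid (by omega) (by omega) hP hI.2 (fun v => by omega) (fun v => ?_)
      (fun v r x hx => ?_) (fun j hj => by rw [gEP j hj]; exact Fin.isLt _) fun v C hC x hx => ?_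
    · have := hlay.block_le (nA + v) (by omega)
      rw [hbP, ← add_assoc] at this
      exact this.trans hwB
    · have := hlay.block (nA + v) (by omega) r x (by rw [hbP]; exact hx)
      rw [← add_assoc] at this
      exact this
    · obtain ⟨i, hi, e⟩ := hex (x, v) (Instance.mem_edges.2 (I.classP_subset v C hC x hx))
      exact ⟨i, hi, by rw [gEP i hi, e], by rw [gEA i hi, e]⟩
  have hz : ∀ {β : Type} (f : Fin nA × Fin nP → ℕ) (j : ℕ), m ≤ j → (es.map f).getD j 0 = 0 :=
    fun f j hj => List.getD_eq_default _ _ (by simpa using hj)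
  -- the run of the program
  obtain ⟨hcost, l, hl, hsol, hl0, hout⟩ := main_spec (B := B) (σ := Store.initial w) hedge
    (fun _ _ => rfl) (hz (β := ℕ) _) (hz (β := ℕ) _) (hz (β := ℕ) _) hrank hvA hvP (by omega)
  obtain ⟨t₁, s₁, x₁, ht₁, r₁⟩ := exec_prelude (W := W) (w := w) hlay.count_left hlay.count_right
    hlay.count_edges hB hwB (by omega)
  obtain ⟨t₂, s₂, x₂, ht₂, r₂, -⟩ := Cmd.exec_compile (W := W) (B := B) (by omega) Alg.main
    (Store.initial w) s₁ B 0 r₁ ⟨fun _ => Nat.zero_le _, fun _ _ => Nat.zero_le _⟩ le_rfl (by omega)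
  have hlt : ∀ e ∈ l, e < es.length := fun e he =>
    Finset.mem_range.1 (hsol.subset (List.mem_toFinset.2 he))
  set L : List (Fin nA × Fin nP) := l.pmap (fun e he => es[e]'he) hlt with hL
  have hLnd : L.Nodup := hl.pmap fun a ha b hb e => (List.Nodup.getElem_inj_iff hes).1 e
  have hLlen : L.length = l.length := by simp [hL]
  have hpos : positions es L.toFinset = l.toFinset := by
    ext j
    rw [mem_positions, List.mem_toFinset]
    simp only [List.mem_toFinset, hL, List.mem_pmap]
    constructor
    · rintro ⟨h, e, he, h'⟩
      rwa [← (List.Nodup.getElem_inj_iff hes).1 h']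
    · intro hj
      exact ⟨hlt j hj, j, hj, rfl⟩
  have hLE : L.toFinset ⊆ I.edges := by
    intro e he
    rw [List.mem_toFinset, hL, List.mem_pmap] at he
    obtain ⟨j, hj, rfl⟩ := he
    exact hmem j (hlt j hj)
  have hlm : l.length ≤ m := by
    have := Finset.card_le_card hsol.subset
    rwa [List.toFinset_card_of_nodup hl, Finset.card_range] at this
  refine ⟨_, s₂, L.toFinset, .seq x₁ x₂, ?_, ⟨L, hLnd, rfl, ?_, fun i hi => ?_⟩, ?_⟩
  · rw [← hmE]
    -- Ten machine steps for each step of the loop program and `(m + 1)² ≤ 2 (m² + 1)` give `400000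
    -- (m² + 1)`; the rest covers the prelude.
    have h1 : 500000 * (m ^ 2 + 1) ≤ c * (m ^ 2 + 1) := Nat.mul_le_mul_right _ hc
    have h2 : m ^ 2 = m * m := sq m
    have h3 : 2 * m ≤ m * m + 1 := by nlinarith [sq_nonneg ((m : ℤ) - 1)]
    rw [h2] at h1 ⊢
    omega
  · rw [r₂.reg0, r₂.low 0 (by omega), hl0, hLlen]
  · have hi' : i < l.length := by rwa [hLlen] at hi
    obtain ⟨o1, o2⟩ := hout i l[i] (List.getElem?_eq_getElem hi')
    have hlti := hlt _ (List.getElem_mem hi')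
    have e : L[i] = es[l[i]] := by simp [hL]
    rw [r₂.reg0, Nat.zero_add, r₂.low _ (by omega), r₂.low _ (by omega), o1, o2, e, gEA _ hlti,
      gEP _ hlti]
    exact ⟨rfl, rfl⟩
  · exact Solves.isCRMM hes hE hA hP gEA gEP gRK hLE (hpos ▸ hsol)

end CRMM
/-- There are a program for the word RAM and a constant `c` such that, on every encoding `w` of an
instance with laminar classifications, and for every word size `W` that is at least polynomial in the
length of `w` and for which the numbers in `w` fit into words, the program halts after at most
`c * (|E| ^ 2 + 1)` steps and outputs a classified rank-maximal matching. -/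
theorem theorem1 :
    ∃ (prog : CRMM.Program) (c : ℕ),
      ∀ (nA nP : ℕ) (I : CRMM.Instance (Fin nA) (Fin nP)), I.IsLaminar →
      ∀ (w : List ℕ), CRMM.IsEncoding I w →
      ∀ (W : ℕ), (w.length + 2) ^ c ≤ W → (∀ x ∈ w, x < W) →
        ∃ (t : ℕ) (s : CRMM.State) (M : Finset (Fin nA × Fin nP)),
          CRMM.Exec W prog (CRMM.State.initial w) t s ∧
          t ≤ c * (I.edges.card ^ 2 + 1) ∧
          s.Outputs M ∧ I.IsCRMM M :=
  ⟨CRMM.program, 500000, fun _ _ _ hI _ hw _ hW _ => CRMM.exec_program le_rfl hI hw hW⟩
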